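/- All point processes below are random Radon counting measures on the plane $\mathbb R^2$. For a point process $\Phi$ and $r\ge 0$ let $C(\Phi,r)=\bigcup_{X\in\Phi}B_r(X)$ (closed Euclidean balls) be its Boolean model. A set percolates if it contains an unbounded connected subset, and $$r_c(\Phi)=\inf\{r\ge 0:\ \mathbb P(C(\Phi,r)\text{ percolates})>0\}\in[0,\infty].$$ A point process $\Phi$ has intensity $a$ if $\mathbb E\,\Phi(B)=a|B|$ for all Borel $B$. Write $\Phi_1\le_{dcx}\Phi_2$ if for all bounded Borel sets $B_1,\dots,B_k$ and every Lebesgue-measurable directionally convex $f:\mathbb R^k\to\mathbb R$ (that is, $\Delta^i_\epsilon\Delta^j_\delta f\ge 0$ for all $\epsilon,\delta>0$ and all $i,j$, where $\Delta^i_\epsilon f(x)=f(x+\epsilon e_i)-f(x)$) one has $\mathbb E f(\Phi_1(B_1),\dots,\Phi_1(B_k))\le \mathbb E f(\Phi_2(B_1),\dots,\Phi_2(B_k))$ whenever both expectations are finite. For $\alpha,\mu>0$ and $0<\delta\le R<\infty$ let $\Phi_\alpha^{R,\delta,\mu}$ be the Poisson–Poisson cluster process with annular clusters, i.e. the Cox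 process with random intensity measure $\mu\sum_{X\in\Phi_\alpha}U_X$, where $\Phi_\alpha$ is the homogeneous Poisson process of intensity $\alpha$ and $U_x$ is the uniform distribution on the annulus $B_R(x)\setminus B_{R-\delta}(x)$. Let $a>0$. (i) For every $r>0$ there exist $\alpha,\mu>0$ and $0<\delta\le R<\infty$ with $\alpha\mu=a$ such that $\Phi_\alpha^{R,\delta,\mu}$ exists, has intensity $a$, is $dcx$-larger than the homogeneous Poisson process of intensity $a$, and satisfies $r_c(\Phi_\alpha^{R,\delta,\mu})\le r$. (ii) There is a point process $\Phi$ that is a superposition of a sequence of independent Poisson–Poisson cluster processes with annular clusters, has intensity $a$, is $dcx$-larger than the homogeneous Poisson process $\Phi_a$ of intensity $a$, and for which $\mathbb P(C(\Phi,r)\text{ percolates})>0$ for every $r>0$, i.e. $r_c(\Phi)=0$; whereas $r_c(\Phi_a)>0$. (iii) Consequently $r_c$ is not monotone in the $dcx$ order: there are a homogeneous Poisson process $\Phi_1$ of intensity $a$ and a point process $\Phi_2$ of intensity $a$ with $\Phi_1\le_{dcx}\Phi_2$ and $r_c(\Phi_2)<r_c(\Phi_1)$. -/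

import Mathlib

open MeasureTheory ProbabilityTheory
open scoped ENNReal NNReal

universe u v

noncomputable section

namespace ClusterPerc

/-- The Euclidean plane. -/
abbrev Plane : Type := EuclideanSpace ℝ (Fin 2)

/-- A Radon counting measure on the plane: it gives every bounded Borel set a finite
non-negative integer mass. -/
def IsCountingMeasure (φ : Measure Plane) : Prop :=
  ∀ B : Set Plane, MeasurableSet B → Bornology.IsBounded B → ∃ n : ℕ, φ B = n

/-- A point process: a random element of the space of Radon counting measures. Mathlib's
sigma-algebra on measures is the one generated by the evaluations `φ ↦ φ B`. -/
structure IsPointProcess {Ω : Type u} [MeasurableSpace Ω] (Φ : Ω → Measure Plane) : Prop where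
  measurable : Measurable Φ
  counting : ∀ ω, IsCountingMeasure (Φ ω)

/-- `Φ` is a point process of intensity `a`: its mean measure is `a` times Lebesgue measure. -/
def HasIntensity {Ω : Type u} [MeasurableSpace Ω] (P : Measure Ω) (Φ : Ω → Measure Plane)
    (a : ℝ) : Prop :=
  ∀ B : Set Plane, MeasurableSet B → ∫⁻ ω, Φ ω B ∂P = ENNReal.ofReal a * volume B

/-- `Φ` is a homogeneous Poisson point process of intensity `a`: for pairwise disjoint bounded
Borel sets `B i` the counts `Φ (B i)` are independent and Poisson with means `a * volume (B i)`
(written through the joint probabilities of the counts). -/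
structure IsPoissonProcess {Ω : Type u} [MeasurableSpace Ω] (P : Measure Ω)
    (Φ : Ω → Measure Plane) (a : ℝ) : Prop where
  pointProcess : IsPointProcess Φ
  joint_counts : ∀ (k : ℕ) (B : Fin k → Set Plane), (∀ i, MeasurableSet (B i)) →
    (∀ i, Bornology.IsBounded (B i)) → (∀ i j, i ≠ j → Disjoint (B i) (B j)) →
    ∀ n : Fin k → ℕ,
      P {ω | ∀ i, Φ ω (B i) = n i} =
        ∏ i, poissonMeasure (ENNReal.ofReal a * volume (B i)).toNNReal {n i}

/-- `Φ` is a Cox point process with random intensity measure `Λ`: `Λ` is a random Radon measure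
and, conditionally on `Λ`, `Φ` is a Poisson point process with intensity measure `Λ`. The
conditional statement is written by integrating over the events `{Λ ∈ G}`. -/
structure IsCoxProcess {Ω : Type u} [MeasurableSpace Ω] (P : Measure Ω)
    (Φ Λ : Ω → Measure Plane) : Prop where
  pointProcess : IsPointProcess Φ
  measurable_intensity : Measurable Λ
  intensity_lt_top : ∀ ω, ∀ B : Set Plane, Bornology.IsBounded B → Λ ω B < ∞
  joint_counts : ∀ G : Set (Measure Plane), MeasurableSet G →
    ∀ (k : ℕ) (B : Fin k → Set Plane), (∀ i, MeasurableSet (B i)) →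
    (∀ i, Bornology.IsBounded (B i)) → (∀ i j, i ≠ j → Disjoint (B i) (B j)) →
    ∀ n : Fin k → ℕ,
      P {ω | Λ ω ∈ G ∧ ∀ i, Φ ω (B i) = n i} =
        ∫⁻ ω in Λ ⁻¹' G, ∏ i, poissonMeasure (Λ ω (B i)).toNNReal {n i} ∂P

/-- The annulus centred at `x` with inner radius `R - δ` and outer radius `R`. -/
def annulus (R δ : ℝ) (x : Plane) : Set Plane :=
  Metric.closedBall x R \ Metric.closedBall x (R - δ)

/-- The measure `μ * ∑_{X ∈ φ} (uniform distribution on the annulus centred at X)`. -/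
def clusterIntensity (R δ μ : ℝ) (φ : Measure Plane) : Measure Plane :=
  ENNReal.ofReal μ • φ.bind (fun x => volume[|annulus R δ x])

/-- `Φ` is a Poisson–Poisson cluster process with annular clusters: a Cox process with intensity
measure `clusterIntensity R δ μ Φα`, where the process `Φα` of cluster centres is a homogeneous
Poisson process of intensity `α`. -/
def IsAnnularClusterProcess {Ω : Type u} [MeasurableSpace Ω] (P : Measure Ω)
    (Φ : Ω → Measure Plane) (α R δ μ : ℝ) : Prop :=
  ∃ Φα : Ω → Measure Plane, IsPoissonProcess P Φα α ∧
    IsCoxProcess P Φ (fun ω => clusterIntensity R δ μ (Φα ω))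

/-- Admissible parameters of an annular cluster process. -/
def AdmissibleParams (α R δ μ : ℝ) : Prop :=
  0 < α ∧ 0 < μ ∧ 0 < δ ∧ δ ≤ R

/-- `Φ` is the superposition of a sequence of independent annular cluster processes. -/
def IsAnnularClusterSuperposition {Ω : Type u} [MeasurableSpace Ω] (P : Measure Ω)
    (Φ : Ω → Measure Plane) : Prop :=
  ∃ (α R δ μ : ℕ → ℝ) (Φs : ℕ → Ω → Measure Plane),
    (∀ n, AdmissibleParams (α n) (R n) (δ n) (μ n)) ∧
    (∀ n, IsAnnularClusterProcess P (Φs n) (α n) (R n) (δ n) (μ n)) ∧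
    iIndepFun Φs P ∧
    ∀ᵐ ω ∂P, Φ ω = Measure.sum (fun n => Φs n ω)

/-- Directionally convex functions: Lebesgue measurable, with
`Δ_ε^i Δ_δ^j f ≥ 0` for all `i`, `j` (including `i = j`) and all `ε, δ > 0`. -/
def IsDirectionallyConvex {k : ℕ} (f : (Fin k → ℝ) → ℝ) : Prop :=
  AEMeasurable f volume ∧
  ∀ (x : Fin k → ℝ) (ε δ : ℝ), 0 < ε → 0 < δ → ∀ i j : Fin k,
    0 ≤ (f (x + Pi.single i ε + Pi.single j δ) - f (x + Pi.single i ε))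
        - (f (x + Pi.single j δ) - f x)

/-- The `dcx` order of random vectors: `E f(X) ≤ E f(Y)` for every directionally convex `f` for
which both expectations are finite. -/
def VectorDcxLE {Ω₁ : Type u} {Ω₂ : Type v} [MeasurableSpace Ω₁] [MeasurableSpace Ω₂] {k : ℕ}
    (P₁ : Measure Ω₁) (X : Ω₁ → Fin k → ℝ) (P₂ : Measure Ω₂) (Y : Ω₂ → Fin k → ℝ) : Prop :=
  ∀ f : (Fin k → ℝ) → ℝ, IsDirectionallyConvex f →
    Integrable (fun ω => f (X ω)) P₁ → Integrable (fun ω => f (Y ω)) P₂ →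
    ∫ ω, f (X ω) ∂P₁ ≤ ∫ ω, f (Y ω) ∂P₂

/-- The `dcx` order of point processes: comparison of the vectors of counts on all finite families
of bounded Borel sets. -/
def DcxLE {Ω₁ : Type u} {Ω₂ : Type v} [MeasurableSpace Ω₁] [MeasurableSpace Ω₂]
    (P₁ : Measure Ω₁) (Φ₁ : Ω₁ → Measure Plane)
    (P₂ : Measure Ω₂) (Φ₂ : Ω₂ → Measure Plane) : Prop :=
  ∀ (k : ℕ) (B : Fin k → Set Plane), (∀ i, MeasurableSet (B i)) →
    (∀ i, Bornology.IsBounded (B i)) →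
    VectorDcxLE P₁ (fun ω i => (Φ₁ ω (B i)).toReal) P₂ (fun ω i => (Φ₂ ω (B i)).toReal)

/-- The Boolean model with grains of radius `r`: the set of `y` whose coverage number
`∑_{X ∈ φ} 1[y ∈ B_r(X)] = φ (B_r(y))` is at least one. -/
def booleanModel (φ : Measure Plane) (r : ℝ) : Set Plane :=
  {y | 1 ≤ φ (Metric.closedBall y r)}

/-- A set percolates if it contains an unbounded connected subset. -/
def Percolates (A : Set Plane) : Prop :=
  ∃ S : Set Plane, S ⊆ A ∧ IsConnected S ∧ ¬ Bornology.IsBounded S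

/-- The critical radius `inf {r ≥ 0 : P (the Boolean model of radius r percolates) > 0}`, with
value `∞` if there is no such `r`. -/
def criticalRadius {Ω : Type u} [MeasurableSpace Ω] (P : Measure Ω)
    (Φ : Ω → Measure Plane) : ℝ≥0∞ :=
  sInf {ρ : ℝ≥0∞ | ∃ r : ℝ≥0, ρ = r ∧ 0 < P {ω | Percolates (booleanModel (Φ ω) r)}}

end ClusterPerc

end

open ClusterPerc

open ClusterPerc

/-! The point of annular clusters is to spend a fixed intensity on few parents with very many
daughters each, all daughters lying near a circle. The circle is then covered by tiny grains, and
circles about neighbouring regions cross, so arbitrarily small grains percolate. Clustering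
nevertheless only increases the process in the `dcx` order.

Order. Counts on arbitrary sets are sums of counts on disjoint atoms. Subtracting from a
directionally convex `f` the affine function that agrees with it at `0` and at the unit vectors
leaves, at integer points, a nonnegative increasing function with nondecreasing increments
(`isIncrDcx_affineExcess`); the affine part has the same expectation for two processes of equal
intensity (`integral_dcx_eq`). Given its intensity `Λ`, a Cox process has conditional expectation
`poissonMean G (Λ A)`, and `poissonMean G` is again increasing with nondecreasing increments in the
means (`poissonMean_supermod`). For clusters, `Λ A` is a shot noise of the Poisson parents, and
Jensen's inequality for combinations of independent Poisson variables (`poissonMean_sum_smul_le`)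
bounds its expectation from below by the value at the mean. Independent superpositions inherit this
domination.

Percolation. Take fine cells of mesh `s = r / 2` and sites of mesh `n * s`, with `n = m ^ 2`, parent
intensity `a / m ^ 3` and mean cluster size `m ^ 3`. A site has about `a * s ^ 2 * m` parents, and a
parent puts at least `m / (80 * π)` points in mean into every fine cell that meets its ring, while
only polynomially many cells are concerned. Hence for large `m` most sites contain the centre of a
complete ring. Sites are dependent, but the probability that all sites of a finite set `T` are bad
is at most `q ^ T.card` with `q` small (`measure_forall_mem_badSites_le`). A hierarchy of `3 × 3`
blocks, in which one bad sub-block is tolerated, turns this into percolation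
(`measure_forall_goodBlock_pos`, `percolates_of_goodBlock`).

Critical radius zero is reached by superposing independent components of intensities `a / 2 / 2 ^ n`
that percolate at radius `1 / (n + 1)`. The Poisson process itself does not percolate at small
radius, since long self-avoiding paths of occupied cells are too rare. -/

namespace ClusterPerc

/-! ### Poisson vectors and the expectation as a function of the means -/

section PoissonVectors

/-- Monotone functions of counts with nondecreasing increments: the extended nonnegative
directionally convex functions on the lattice that are also increasing. -/
structure IsIncrDcx {ι : Type*} (G : (ι → ℕ) → ℝ≥0∞) : Prop where
  mono : Monotone G
  supermod : ∀ x u v, G (x + u) + G (x + v) ≤ G (x + u + v) + G x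

lemma IsIncrDcx.shift {ι : Type*} {G : (ι → ℕ) → ℝ≥0∞} (hG : IsIncrDcx G) (z : ι → ℕ) :
    IsIncrDcx fun x => G (z + x) :=
  ⟨fun _ _ h => hG.mono (by gcongr), fun x u v => by
    simpa [add_assoc] using hG.supermod (z + x) u v⟩

variable {ι : Type*} [Fintype ι]

/-- The law of a vector of independent Poisson variables with means `t i`. -/
noncomputable def poissonVec (t : ι → ℝ≥0) : Measure (ι → ℕ) :=
  Measure.pi fun i => poissonMeasure (t i)

instance (t : ι → ℝ≥0) : IsProbabilityMeasure (poissonVec t) := by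
  unfold poissonVec; infer_instance

lemma poissonVec_singleton (t : ι → ℝ≥0) (n : ι → ℕ) :
    poissonVec t {n} = ∏ i, poissonMeasure (t i) {n i} := by
  rw [poissonVec, Measure.pi_singleton]

lemma poissonVec_zero : poissonVec (0 : ι → ℝ≥0) = Measure.dirac 0 := by
  have h : poissonMeasure 0 = Measure.dirac 0 := by
    refine Measure.ext_of_singleton fun n => ?_
    rw [poissonMeasure_singleton]
    rcases Nat.eq_zero_or_pos n with rfl | hn
    · simp
    · simp [hn.ne', Set.indicator, hn.ne]
  refine Measure.ext_of_singleton fun n => ?_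
  rw [poissonVec_singleton]
  simp only [Pi.zero_apply, h]
  rw [Measure.dirac_apply' _ (measurableSet_singleton _)]
  by_cases hn : n = 0
  · subst hn; simp
  · have : ∃ i, n i ≠ 0 := by
      by_contra hcon
      push Not at hcon
      exact hn (funext hcon)
    obtain ⟨i, hi⟩ := this
    rw [Finset.prod_eq_zero (Finset.mem_univ i)]
    · simp [Ne.symm hn]
    · simp [hi.symm]

lemma poissonVec_conv (s t : ι → ℝ≥0) :
    (poissonVec s).conv (poissonVec t) = poissonVec (s + t) := by
  have h1 := measurePreserving_arrowProdEquivProdArrow ℕ ℕ ι (fun i => poissonMeasure (s i))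
    (fun i => poissonMeasure (t i))
  have h2 : MeasurePreserving (fun (a : ι → ℕ × ℕ) i => (a i).1 + (a i).2)
      (Measure.pi fun i => (poissonMeasure (s i)).prod (poissonMeasure (t i)))
      (poissonVec (s + t)) := by
    refine measurePreserving_pi _ _ (f := fun i (p : ℕ × ℕ) => p.1 + p.2) fun i => ⟨by fun_prop, ?_⟩
    exact poissonMeasure_conv_poissonMeasure (s i) (t i)
  rw [Measure.conv, poissonVec, poissonVec, ← h1.map_eq, Measure.map_map .of_discrete h1.measurable,
    ← h2.map_eq]
  rfl

lemma lintegral_poissonVec_add (G : (ι → ℕ) → ℝ≥0∞) (s t : ι → ℝ≥0) :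
    ∫⁻ n, G n ∂poissonVec (s + t) =
      ∫⁻ x, ∫⁻ y, G (x + y) ∂poissonVec t ∂poissonVec s := by
  rw [← poissonVec_conv, Measure.lintegral_conv .of_discrete]

lemma lintegral_poissonMeasure_id (t : ℝ≥0) : ∫⁻ n : ℕ, (n : ℝ≥0∞) ∂poissonMeasure t = t := by
  have hsum : HasSum (fun n : ℕ => Real.exp (-t) * (t : ℝ) ^ n / (n.factorial : ℝ) * n) t := by
    have h := (hasSum_one_poissonMeasure t).mul_left (t : ℝ)
    rw [← hasSum_nat_add_iff' 1]
    simp only [Finset.range_one, Finset.sum_singleton, Nat.cast_zero, mul_zero, sub_zero]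
    rw [mul_one] at h
    have e : (fun n : ℕ => Real.exp (-t) * (t : ℝ) ^ (n + 1) / ((n + 1).factorial : ℝ)
        * ((n + 1 : ℕ) : ℝ)) = fun n : ℕ => t * (Real.exp (-t) * (t : ℝ) ^ n / (n.factorial : ℝ)) := by
      funext n
      rw [Nat.factorial_succ]
      push_cast
      have : (n.factorial : ℝ) ≠ 0 := by positivity
      field_simp
      ring
    rw [e]
    exact h
  rw [lintegral_countable']
  have : ∀ n : ℕ, (n : ℝ≥0∞) * poissonMeasure t {n}
      = ENNReal.ofReal (Real.exp (-t) * (t : ℝ) ^ n / (n.factorial : ℝ) * n) := by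
    intro n
    rw [poissonMeasure_singleton, mul_comm, ← ENNReal.ofReal_natCast n,
      ← ENNReal.ofReal_mul (by positivity)]
  simp_rw [this]
  rw [← ENNReal.ofReal_tsum_of_nonneg (fun n => by positivity) hsum.summable, hsum.tsum_eq]
  simp

/-- Expectation of `G` under a Poisson vector, as a function of the vector of means. -/
noncomputable def poissonMean (G : (ι → ℕ) → ℝ≥0∞) (t : ι → ℝ≥0) : ℝ≥0∞ :=
  ∫⁻ n, G n ∂poissonVec t

variable {G : (ι → ℕ) → ℝ≥0∞}

lemma poissonMean_add (s t : ι → ℝ≥0) :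
    poissonMean G (s + t) = ∫⁻ x, poissonMean (fun y => G (x + y)) t ∂poissonVec s :=
  lintegral_poissonVec_add G s t

/-- Averaging over a random shift keeps the class. This is what allows independent summands to be
replaced by Poisson vectors one at a time. -/
lemma IsIncrDcx.lintegral {α : Type*} [MeasurableSpace α] {μ : Measure α} {N : α → (ι → ℕ)}
    (hN : Measurable N) (hG : IsIncrDcx G) : IsIncrDcx fun z => ∫⁻ a, G (z + N a) ∂μ := by
  have hm : ∀ z, Measurable fun a => G (z + N a) := fun z =>
    (Measurable.of_discrete (f := fun n => G (z + n))).comp hN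
  refine ⟨fun x y h => lintegral_mono fun a => hG.mono (by gcongr), fun x u v => ?_⟩
  rw [← lintegral_add_left (hm _), ← lintegral_add_left (hm _)]
  refine lintegral_mono fun a => ?_
  have := hG.supermod (x + N a) u v
  convert this using 3 <;> abel

/-- Coupling: a Poisson vector with larger means is the smaller one plus an independent nonnegative
vector. -/
lemma poissonMean_mono (hG : IsIncrDcx G) : Monotone (poissonMean G) := by
  intro s t hst
  obtain ⟨w, rfl⟩ : ∃ w, t = s + w := ⟨t - s, (add_tsub_cancel_of_le hst).symm⟩
  rw [poissonMean_add, poissonMean]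
  refine lintegral_mono fun x => ?_
  calc G x = ∫⁻ _, G x ∂poissonVec w := by simp
    _ ≤ _ := lintegral_mono fun y => hG.mono (by simp)

/-- All four expectations are realised on one space with independent Poisson vectors `x`, `y`, `z`
of means `s`, `t`, `w`; the inequality then holds pointwise. -/
lemma poissonMean_supermod (hG : IsIncrDcx G) (s t w : ι → ℝ≥0) :
    poissonMean G (s + t) + poissonMean G (s + w) ≤ poissonMean G (s + t + w) + poissonMean G s := by
  have e1 : poissonMean G (s + t) = ∫⁻ x, ∫⁻ y, ∫⁻ _, G (x + y) ∂poissonVec w ∂poissonVec t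
      ∂poissonVec s := by
    simp [poissonMean, lintegral_poissonVec_add G s t]
  have e2 : poissonMean G (s + w) = ∫⁻ x, ∫⁻ _, ∫⁻ z, G (x + z) ∂poissonVec w ∂poissonVec t
      ∂poissonVec s := by
    simp [poissonMean, lintegral_poissonVec_add G s w]
  have e3 : poissonMean G (s + t + w) = ∫⁻ x, ∫⁻ y, ∫⁻ z, G (x + y + z) ∂poissonVec w
      ∂poissonVec t ∂poissonVec s := by
    rw [add_assoc, poissonMean, lintegral_poissonVec_add G s (t + w)]
    refine lintegral_congr fun x => ?_
    rw [lintegral_poissonVec_add]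
    simp_rw [add_assoc]
  have e4 : poissonMean G s = ∫⁻ x, ∫⁻ _, ∫⁻ _, G x ∂poissonVec w ∂poissonVec t
      ∂poissonVec s := by
    simp [poissonMean]
  rw [e1, e2, e3, e4, ← lintegral_add_left .of_discrete, ← lintegral_add_left .of_discrete]
  refine lintegral_mono fun x => ?_
  rw [← lintegral_add_left .of_discrete, ← lintegral_add_left .of_discrete]
  refine lintegral_mono fun y => ?_
  rw [← lintegral_add_left .of_discrete, ← lintegral_add_left .of_discrete]
  exact lintegral_mono fun z => hG.supermod x y z

lemma continuous_poissonMeasure_singleton (n : ℕ) :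
    Continuous fun t : ℝ≥0 => poissonMeasure t {n} := by
  simp_rw [poissonMeasure_singleton]
  exact ENNReal.continuous_ofReal.comp (by fun_prop)

lemma continuous_poissonVec_singleton (n : ι → ℕ) :
    Continuous fun t : ι → ℝ≥0 => poissonVec t {n} := by
  have : (fun t : ι → ℝ≥0 => poissonVec t {n})
      = fun t => ENNReal.ofReal (∏ i, (Real.exp (-(t i)) * (t i : ℝ) ^ n i / (n i).factorial)) := by
    funext t
    rw [poissonVec_singleton, ENNReal.ofReal_prod_of_nonneg (fun i _ => by positivity)]
    simp_rw [poissonMeasure_singleton]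
  rw [this]
  exact ENNReal.continuous_ofReal.comp (by fun_prop)

lemma poissonMean_eq_lintegral_count (G : (ι → ℕ) → ℝ≥0∞) (t : ι → ℝ≥0) :
    poissonMean G t = ∫⁻ n, G n * poissonVec t {n} ∂Measure.count := by
  rw [lintegral_count, poissonMean, lintegral_countable']

open Filter Topology in
/-- Lower semicontinuity of the Poisson expectation in the vector of means. -/
lemma poissonMean_le_of_tendsto {t : ι → ℝ≥0} {s : ℕ → ι → ℝ≥0} (hs : Tendsto s atTop (𝓝 t))
    {C : ℝ≥0∞} (hC : ∀ k, poissonMean G (s k) ≤ C) : poissonMean G t ≤ C := by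
  have hlim : ∀ n, G n * poissonVec t {n} ≤ liminf (fun k => G n * poissonVec (s k) {n}) atTop := by
    intro n
    have h := ((continuous_poissonVec_singleton n).tendsto t).comp hs
    -- `G n` may be infinite, and multiplication by `∞` is continuous only away from `0`; at a
    -- vanishing limit weight the left side is `0`.
    rcases eq_or_ne (poissonVec t {n}) 0 with h0 | h0
    · simp [h0]
    · exact (ENNReal.Tendsto.const_mul h (Or.inl h0)).liminf_eq.ge
  calc poissonMean G t = ∫⁻ n, G n * poissonVec t {n} ∂Measure.count :=
        poissonMean_eq_lintegral_count G t
    _ ≤ ∫⁻ n, liminf (fun k => G n * poissonVec (s k) {n}) atTop ∂Measure.count :=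
        lintegral_mono hlim
    _ ≤ liminf (fun k => ∫⁻ n, G n * poissonVec (s k) {n} ∂Measure.count) atTop :=
        lintegral_liminf_le fun k => .of_discrete
    _ ≤ C := by
        simp_rw [← poissonMean_eq_lintegral_count]
        exact liminf_le_of_le (by isBoundedDefault) fun b hb => by
          obtain ⟨k, hk⟩ := hb.exists
          exact hk.trans (hC k)

end PoissonVectors

/-! ### Jensen's inequality for Poisson combinations -/

section Jensen

/-- A monotone function on the half-line with nondecreasing increments lies below its chords. -/
lemma le_chord_of_incr {h : ℝ≥0 → ℝ≥0∞} (hm : Monotone h)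
    (hs : ∀ s t w, h (s + t) + h (s + w) ≤ h (s + t + w) + h s) (s θ : ℝ≥0) (hθ : θ ≤ 1) :
    h (s + θ) ≤ h s + θ * (h (s + 1) - h s) := by
  rcases eq_or_ne (h (s + 1)) ∞ with htop | hfin
  · rcases eq_or_ne (h s) ∞ with h0 | h0
    · simp [h0]
    rcases eq_or_ne θ 0 with rfl | hθ0
    · simp
    · rw [htop, ENNReal.top_sub h0, ENNReal.mul_top (by simpa using hθ0)]; simp
  have hf : ∀ t ≤ 1, h (s + t) ≠ ∞ := fun t ht =>
    ne_top_of_le_ne_top hfin (hm (by gcongr))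
  set g : ℝ≥0 → ℝ := fun t => (h (s + t)).toReal with hg
  have gm : ∀ t u, t ≤ u → u ≤ 1 → g t ≤ g u := fun t u htu hu =>
    ENNReal.toReal_mono (hf u hu) (hm (by gcongr))
  have gs : ∀ t u w, t + u + w ≤ 1 → g (t + u) + g (t + w) ≤ g (t + u + w) + g t := by
    intro t u w htuw
    have h1 : t + u ≤ 1 := le_trans (by simp) htuw
    have h2 : t + w ≤ 1 := le_trans (by gcongr; simp) htuw
    have h3 : t ≤ 1 := le_trans (by simp) h1
    simp only [hg]
    rw [← ENNReal.toReal_add (hf _ h1) (hf _ h2), ← ENNReal.toReal_add (hf _ htuw) (hf _ h3)]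
    refine ENNReal.toReal_mono (by simp [hf _ htuw, hf _ h3]) ?_
    have := hs (s + t) u w
    simpa [add_assoc] using this
  -- Chord inequality at rational points: the increments over a uniform subdivision are
  -- nondecreasing, so the average of the first `p` is at most the average of all `q`.
  have grid : ∀ q : ℕ, 0 < q → ∀ p : ℕ, p ≤ q →
      g (p / q) - g 0 ≤ (p / q : ℝ) * (g 1 - g 0) := by
    intro q hq p hp
    have hq' : (q : ℝ≥0) ≠ 0 := by positivity
    set d : ℕ → ℝ := fun i => g ((i + 1 : ℕ) / q) - g ((i : ℕ) / q) with hd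
    have dmono : ∀ i, i + 1 < q → d i ≤ d (i + 1) := by
      intro i hi
      have := gs ((i : ℝ≥0) / q) (1 / q) (1 / q) (by
        rw [← add_div, ← add_div, div_le_one (by positivity)]
        exact_mod_cast hi)
      have e1 : (i : ℝ≥0) / q + 1 / q = ((i + 1 : ℕ) : ℝ≥0) / q := by push_cast; rw [add_div]
      have e2 : (i : ℝ≥0) / q + 1 / q + 1 / q = ((i + 1 + 1 : ℕ) : ℝ≥0) / q := by
        push_cast; rw [add_div, add_div]
      rw [e2, e1] at this
      simp only [hd]
      linarith
    have dmono' : ∀ i j, i ≤ j → j < q → d i ≤ d j := by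
      intro i j hij
      induction j, hij using Nat.le_induction with
      | base => intro _; exact le_rfl
      | succ j hij ih => intro hj; exact (ih (by omega)).trans (dmono j hj)
    have tel : ∀ n : ℕ, ∑ i ∈ Finset.range n, d i = g (n / q) - g 0 := by
      intro n
      have := Finset.sum_range_sub (fun i : ℕ => g ((i : ℕ) / q)) n
      simpa [hd] using this
    have key : (q : ℝ) * ∑ i ∈ Finset.range p, d i ≤ (p : ℝ) * ∑ i ∈ Finset.range q, d i := by
      have hsplit : ∑ i ∈ Finset.range q, d i
          = ∑ i ∈ Finset.range p, d i + ∑ i ∈ Finset.Ico p q, d i := by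
        rw [Finset.sum_range_add_sum_Ico _ hp]
      rcases eq_or_lt_of_le hp with rfl | hlt
      · exact le_rfl
      have h1 : ∑ i ∈ Finset.range p, d i ≤ p * d p := by
        have := Finset.sum_le_card_nsmul (Finset.range p) d (d p)
          (fun i hi => dmono' i p (Finset.mem_range.1 hi).le hlt)
        simpa using this
      have h2 : ((q : ℝ) - p) * d p ≤ ∑ i ∈ Finset.Ico p q, d i := by
        have := Finset.card_nsmul_le_sum (Finset.Ico p q) d (d p)
          (fun i hi => dmono' p i (Finset.mem_Ico.1 hi).1 (Finset.mem_Ico.1 hi).2)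
        rw [Nat.card_Ico, nsmul_eq_mul, Nat.cast_sub hp] at this
        exact this
      have hpq : (p : ℝ) ≤ q := by exact_mod_cast hp
      rw [hsplit]
      have hp0 : (0 : ℝ) ≤ p := by positivity
      nlinarith [mul_le_mul_of_nonneg_left h1 (sub_nonneg.2 hpq), mul_le_mul_of_nonneg_left h2 hp0]
    rw [tel, tel, div_self hq'] at key
    rw [div_mul_eq_mul_div, le_div_iff₀ (by positivity)]
    linarith
  -- Monotonicity replaces continuity: `θ` is rounded up to a multiple of `1 / q`, which costs at
  -- most `(g 1 - g 0) / q`.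
  have real : g θ - g 0 ≤ θ * (g 1 - g 0) := by
    have h10 : 0 ≤ g 1 - g 0 := sub_nonneg.2 (gm 0 1 (by simp) le_rfl)
    refine le_of_forall_pos_le_add fun ε hε => ?_
    obtain ⟨q, hq⟩ := exists_nat_gt ((g 1 - g 0) / ε)
    have hq0 : (0 : ℝ) < q := lt_of_le_of_lt (by positivity) hq
    have hqn : 0 < q := by exact_mod_cast hq0
    have hqnn : (0 : ℝ≥0) < q := by exact_mod_cast hqn
    set p := ⌈θ * q⌉₊ with hpdef
    have hpq : p ≤ q := by
      rw [hpdef, Nat.ceil_le]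
      exact mul_le_of_le_one_left (by positivity) hθ
    have hle : θ ≤ p / q := by
      rw [le_div_iff₀ hqnn]; exact Nat.le_ceil _
    have hp1 : (p : ℝ) / q ≤ θ + 1 / q := by
      have : (p : ℝ≥0) < θ * q + 1 := Nat.ceil_lt_add_one (by positivity)
      have : (p : ℝ) < θ * q + 1 := by exact_mod_cast this
      rw [div_le_iff₀ hq0, add_mul]
      field_simp
      linarith
    have h1 := gm θ (p / q) hle (by rw [div_le_one hqnn]; exact_mod_cast hpq)
    have h2 := grid q hqn p hpq
    have h3 : (p / q : ℝ) * (g 1 - g 0) ≤ (θ + 1 / q) * (g 1 - g 0) := by gcongr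
    have h4 : 1 / q * (g 1 - g 0) ≤ ε := by
      rw [div_mul_eq_mul_div, one_mul, div_le_iff₀ hq0]
      rw [div_lt_iff₀ hε] at hq
      linarith
    linarith
  have h0 : h s ≠ ∞ := by simpa using hf 0 (by simp)
  have hθf := hf θ hθ
  have hsub : h (s + 1) - h s ≠ ∞ := ENNReal.sub_ne_top hfin
  rw [← ENNReal.toReal_le_toReal hθf (by simp [h0, hsub, ENNReal.mul_ne_top]),
    ENNReal.toReal_add h0 (by simp [hsub, ENNReal.mul_ne_top]), ENNReal.toReal_mul,
    ENNReal.toReal_sub_of_le (hm (by simp)) hfin]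
  simp only [hg, add_zero] at real
  simp only [ENNReal.coe_toReal]
  linarith

/-- Jensen's inequality for a Poisson variable. -/
lemma le_lintegral_poissonMeasure_of_incr {h : ℝ≥0 → ℝ≥0∞} (hm : Monotone h)
    (hs : ∀ s t w, h (s + t) + h (s + w) ≤ h (s + t + w) + h s) (d : ℝ≥0) :
    h d ≤ ∫⁻ m : ℕ, h m ∂poissonMeasure d := by
  rcases eq_or_ne d 0 with rfl | hd
  · have : poissonMeasure 0 {0} = 1 := by simp [poissonMeasure_singleton]
    rw [lintegral_countable']
    refine le_trans ?_ (ENNReal.le_tsum 0)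
    simp [this]
  rcases eq_or_ne (∫⁻ m : ℕ, h m ∂poissonMeasure d) ∞ with htop | hfin
  · simp [htop]
  -- For `d > 0` every integer has positive Poisson mass, so a single infinite value would make the
  -- integral infinite.
  have hfinN : ∀ m : ℕ, h m ≠ ∞ := by
    intro m hcon
    apply hfin
    rw [lintegral_countable']
    refine ENNReal.tsum_eq_top_of_eq_top ⟨m, ?_⟩
    rw [hcon, ENNReal.top_mul]
    rw [poissonMeasure_singleton]
    have : 0 < (d : ℝ) := by exact_mod_cast pos_iff_ne_zero.2 hd
    simp only [ne_eq, ENNReal.ofReal_eq_zero, not_le]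
    positivity
  -- The line through the values at `k` and `k + 1` lies below `h` at all integers (`gline`) and
  -- above `h` at the point `d` between them (`chord`).
  set k := ⌊d⌋₊ with hk
  have hkd : (k : ℝ≥0) ≤ d := Nat.floor_le (by simp)
  have hdk : d ≤ k + 1 := (Nat.lt_floor_add_one d).le
  set g : ℕ → ℝ := fun m => (h m).toReal with hg
  set m := g (k + 1) - g k with hmdef
  have gmono : ∀ i j : ℕ, i ≤ j → g i ≤ g j := fun i j hij =>
    ENNReal.toReal_mono (hfinN j) (hm (by exact_mod_cast hij))
  have gconv : ∀ i : ℕ, g (i + 1) - g i ≤ g (i + 2) - g (i + 1) := by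
    intro i
    have := hs i 1 1
    have e2 : (i : ℝ≥0) + 1 + 1 = ((i + 2 : ℕ) : ℝ≥0) := by push_cast; ring
    have e1 : (i : ℝ≥0) + 1 = ((i + 1 : ℕ) : ℝ≥0) := by push_cast; ring
    rw [e2, e1] at this
    have := ENNReal.toReal_mono (ENNReal.add_ne_top.2 ⟨hfinN _, hfinN _⟩) this
    rw [ENNReal.toReal_add (hfinN _) (hfinN _), ENNReal.toReal_add (hfinN _) (hfinN _)] at this
    simp only [hg]
    linarith
  have gslope : ∀ i j : ℕ, i ≤ j → g (i + 1) - g i ≤ g (j + 1) - g j := by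
    intro i j hij
    induction j, hij using Nat.le_induction with
    | base => exact le_rfl
    | succ j hij ih => exact ih.trans (gconv j)
  have gline : ∀ j : ℕ, g k + ((j : ℝ) - k) * m ≤ g j := by
    intro j
    rcases le_total k j with hkj | hjk
    · induction j, hkj using Nat.le_induction with
      | base => simp
      | succ j hij ih =>
        have := gslope k j hij
        push_cast
        linarith
    · induction hjk using Nat.decreasingInduction with
      | self => simp
      | of_succ j hij ih =>
        have := gslope j k (by omega)
        push_cast at ih
        linarith
  have chord : (h d).toReal ≤ g k + ((d : ℝ) - k) * m := by
    have := le_chord_of_incr hm hs k (d - k) (by rw [tsub_le_iff_left]; exact hdk)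
    rw [add_tsub_cancel_of_le hkd] at this
    have e1 : (k : ℝ≥0) + 1 = ((k + 1 : ℕ) : ℝ≥0) := by push_cast; ring
    rw [e1] at this
    have hne : h ((k + 1 : ℕ) : ℝ≥0) - h k ≠ ∞ := ENNReal.sub_ne_top (hfinN _)
    have := ENNReal.toReal_mono (by
      simp only [ne_eq, ENNReal.add_eq_top, hfinN, false_or]
      exact ENNReal.mul_ne_top ENNReal.coe_ne_top hne) this
    rw [ENNReal.toReal_add (hfinN _) (ENNReal.mul_ne_top ENNReal.coe_ne_top hne),
      ENNReal.toReal_mul, ENNReal.toReal_sub_of_le (hm (by gcongr; simp)) (hfinN _)] at this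
    simp only [ENNReal.coe_toReal, NNReal.coe_sub hkd, NNReal.coe_natCast] at this
    exact this
  have hm0 : 0 ≤ m := sub_nonneg.2 (gmono _ _ (by simp))
  have hdfin : h d ≠ ∞ := ne_top_of_le_ne_top (hfinN (k + 1)) (hm (by push_cast; exact hdk))
  -- The supporting line, arranged without subtraction. After integration the two linear terms are
  -- equal, because the Poisson mean is `d`, and cancel.
  have pt : ∀ j : ℕ, h d + ENNReal.ofReal m * j ≤ h j + ENNReal.ofReal m * d := by
    intro j
    rw [← ENNReal.toReal_le_toReal (by simp [hdfin, ENNReal.mul_ne_top])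
      (by simp [hfinN, ENNReal.mul_ne_top]),
      ENNReal.toReal_add hdfin (by simp [ENNReal.mul_ne_top]),
      ENNReal.toReal_add (hfinN _) (by simp [ENNReal.mul_ne_top])]
    simp only [ENNReal.toReal_mul, ENNReal.toReal_ofReal hm0, ENNReal.toReal_natCast,
      ENNReal.coe_toReal]
    have := gline j
    simp only [hg] at this chord
    nlinarith
  have int := lintegral_mono (μ := poissonMeasure d) pt
  rw [lintegral_add_left .of_discrete, lintegral_add_left .of_discrete,
    lintegral_const_mul _ .of_discrete, lintegral_poissonMeasure_id] at int
  simp only [lintegral_const, measure_univ, mul_one] at int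
  exact (ENNReal.add_le_add_iff_right (by simp [ENNReal.mul_ne_top])).1 int

variable {ι : Type*} [Fintype ι] {G : (ι → ℕ) → ℝ≥0∞}

/-- Along the ray `t ↦ s + t • c` the Poisson expectation is increasing with nondecreasing
increments, so the one-variable inequality applies. -/
lemma poissonMean_add_smul_le (hG : IsIncrDcx G) (s c : ι → ℝ≥0) (d : ℝ≥0) :
    poissonMean G (s + d • c) ≤ ∫⁻ m : ℕ, poissonMean G (s + (m : ℝ≥0) • c) ∂poissonMeasure d := by
  refine le_lintegral_poissonMeasure_of_incr (h := fun t => poissonMean G (s + t • c)) ?_ ?_ d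
  · intro t w htw
    exact poissonMean_mono hG (by gcongr)
  · intro t w z
    have := poissonMean_supermod hG (s + t • c) (w • c) (z • c)
    simpa [add_smul, add_assoc] using this

/-- Jensen's inequality for nonnegative linear combinations of independent Poisson variables. -/
lemma poissonMean_sum_smul_le (hG : IsIncrDcx G) : ∀ {k : ℕ} (s : ι → ℝ≥0) (c : Fin k → ι → ℝ≥0)
    (d : Fin k → ℝ≥0), poissonMean G (s + ∑ j, d j • c j) ≤
      ∫⁻ m, poissonMean G (s + ∑ j, (m j : ℝ≥0) • c j) ∂poissonVec d := by
  intro k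
  induction k with
  | zero => intro s c d; simp
  | succ k ih =>
    intro s c d
    have hmp := measurePreserving_piFinSuccAbove (fun i => poissonMeasure (d i)) 0
    have e : ∫⁻ m, poissonMean G (s + ∑ j, (m j : ℝ≥0) • c j) ∂poissonVec d
        = ∫⁻ p : ℕ × (Fin k → ℕ), poissonMean G
          (s + (p.1 : ℝ≥0) • c 0 + ∑ j, (p.2 j : ℝ≥0) • c j.succ)
          ∂((poissonMeasure (d 0)).prod (poissonVec fun j => d j.succ)) := by
      have := hmp.lintegral_comp (f := fun p : ℕ × (Fin k → ℕ) => poissonMean G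
          (s + (p.1 : ℝ≥0) • c 0 + ∑ j, (p.2 j : ℝ≥0) • c j.succ)) .of_discrete
      simp only [Fin.zero_succAbove] at this
      unfold poissonVec
      rw [← this]
      refine lintegral_congr fun m => ?_
      rw [Fin.sum_univ_succ, ← add_assoc]
      rfl
    rw [e, lintegral_prod _ (Measurable.of_discrete).aemeasurable, Fin.sum_univ_succ]
    -- The first coefficient is randomised while the others stay at their means; the induction
    -- hypothesis then randomises these for each value of the first.
    have h1 := poissonMean_add_smul_le hG (s + ∑ j : Fin k, d j.succ • c j.succ) (c 0) (d 0)
    rw [add_assoc, add_comm (∑ j : Fin k, d j.succ • c j.succ)] at h1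
    refine h1.trans (lintegral_mono fun m => ?_)
    rw [add_right_comm]
    exact ih _ _ _

end Jensen

/-! ### Count vectors of Poisson and Cox processes -/

section Counts

/-- The vector of counts of a measure on a family of sets, as natural numbers. -/
noncomputable def countVec {ι : Type*} (φ : Measure Plane) (B : ι → Set Plane) : ι → ℕ :=
  fun i => ⌊(φ (B i)).toReal⌋₊

lemma IsCountingMeasure.coe_countVec {φ : Measure Plane} (hφ : IsCountingMeasure φ) {ι : Type*}
    {B : ι → Set Plane} {i : ι} (hB : MeasurableSet (B i)) (hb : Bornology.IsBounded (B i)) :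
    (countVec φ B i : ℝ≥0∞) = φ (B i) := by
  obtain ⟨n, hn⟩ := hφ _ hB hb
  simp [countVec, hn]

lemma IsCountingMeasure.lt_top {φ : Measure Plane} (hφ : IsCountingMeasure φ) {B : Set Plane}
    (hb : Bornology.IsBounded B) : φ B < ∞ := by
  obtain ⟨r, hr⟩ := hb.subset_closedBall 0
  obtain ⟨n, hn⟩ := hφ (Metric.closedBall 0 r) Metric.isClosed_closedBall.measurableSet
    Metric.isBounded_closedBall
  exact (measure_mono hr).trans_lt (by simp [hn])

lemma sigmaFinite_of_isBounded_lt_top {φ : Measure Plane}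
    (h : ∀ B, Bornology.IsBounded B → φ B < ∞) : SigmaFinite φ := by
  refine ⟨⟨⟨fun n : ℕ => Metric.closedBall 0 n, fun _ => trivial,
    fun n => h _ Metric.isBounded_closedBall, ?_⟩⟩⟩
  exact Metric.iUnion_closedBall_nat 0

lemma IsCountingMeasure.sigmaFinite {φ : Measure Plane} (hφ : IsCountingMeasure φ) :
    SigmaFinite φ :=
  sigmaFinite_of_isBounded_lt_top fun _ hb => hφ.lt_top hb

variable {Ω : Type u} [MeasurableSpace Ω] {P : Measure Ω} {Φ Λ : Ω → Measure Plane} {a : ℝ}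

lemma measurable_countVec {ι : Type*} (hΦ : Measurable Φ) {B : ι → Set Plane}
    (hB : ∀ i, MeasurableSet (B i)) : Measurable fun ω => countVec (Φ ω) B := by
  refine measurable_pi_lambda _ fun i => ?_
  exact Nat.measurable_floor.comp ((Measure.measurable_coe (hB i)).comp hΦ).ennreal_toReal

lemma IsPointProcess.eq_iff_countVec (hΦ : IsPointProcess Φ) {ι : Type*} {B : ι → Set Plane}
    (hB : ∀ i, MeasurableSet (B i)) (hb : ∀ i, Bornology.IsBounded (B i)) (ω : Ω) (n : ι → ℕ) :
    countVec (Φ ω) B = n ↔ ∀ i, Φ ω (B i) = n i := by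
  rw [funext_iff]
  refine forall_congr' fun i => ?_
  rw [← (hΦ.counting ω).coe_countVec (hB i) (hb i)]
  simp

lemma IsPoissonProcess.map_countVec (h : IsPoissonProcess P Φ a) {ι : Type*} [Fintype ι]
    {B : ι → Set Plane} (hB : ∀ i, MeasurableSet (B i)) (hb : ∀ i, Bornology.IsBounded (B i))
    (hd : Pairwise fun i j => Disjoint (B i) (B j)) :
    P.map (fun ω => countVec (Φ ω) B) =
      poissonVec fun i => (ENNReal.ofReal a * volume (B i)).toNNReal := by
  refine Measure.ext_of_singleton fun n => ?_
  rw [Measure.map_apply (measurable_countVec h.1.measurable hB)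
    (measurableSet_singleton _), poissonVec_singleton]
  let e := Fintype.equivFin ι
  have := h.joint_counts (Fintype.card ι) (B ∘ e.symm) (fun i => hB _) (fun i => hb _)
    (fun i j hij => hd (by simpa using hij)) (n ∘ e.symm)
  rw [← e.symm.prod_comp]
  simp only [Function.comp_apply] at this ⊢
  rw [← this]
  congr 1
  ext ω
  simp only [Set.mem_preimage, Set.mem_singleton_iff, Set.mem_ofPred_eq]
  rw [h.1.eq_iff_countVec hB hb]
  exact e.symm.forall_congr_right.symm

lemma IsPoissonProcess.lintegral_countVec (h : IsPoissonProcess P Φ a) {ι : Type*} [Fintype ι]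
    {B : ι → Set Plane} (hB : ∀ i, MeasurableSet (B i)) (hb : ∀ i, Bornology.IsBounded (B i))
    (hd : Pairwise fun i j => Disjoint (B i) (B j)) (G : (ι → ℕ) → ℝ≥0∞) :
    ∫⁻ ω, G (countVec (Φ ω) B) ∂P =
      poissonMean G fun i => (ENNReal.ofReal a * volume (B i)).toNNReal := by
  rw [poissonMean, ← h.map_countVec hB hb hd, lintegral_map .of_discrete
    (measurable_countVec h.1.measurable hB)]

/-- Conditioning on `Λ` makes the counts a Poisson vector. Since `ι → ℕ` is countable, it suffices
to sum the joint probabilities with the trivial event for `Λ`. -/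
lemma IsCoxProcess.lintegral_countVec (h : IsCoxProcess P Φ Λ) {ι : Type*} [Fintype ι]
    {B : ι → Set Plane} (hB : ∀ i, MeasurableSet (B i)) (hb : ∀ i, Bornology.IsBounded (B i))
    (hd : Pairwise fun i j => Disjoint (B i) (B j)) (G : (ι → ℕ) → ℝ≥0∞) :
    ∫⁻ ω, G (countVec (Φ ω) B) ∂P =
      ∫⁻ ω, poissonMean G (fun i => (Λ ω (B i)).toNNReal) ∂P := by
  have hm := measurable_countVec h.1.measurable hB
  have hmΛ : Measurable fun ω => fun i => (Λ ω (B i)).toNNReal :=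
    measurable_pi_lambda _ fun i =>
      ((Measure.measurable_coe (hB i)).comp h.measurable_intensity).ennreal_toNNReal
  have key : ∀ n : ι → ℕ, P.map (fun ω => countVec (Φ ω) B) {n}
      = ∫⁻ ω, poissonVec (fun i => (Λ ω (B i)).toNNReal) {n} ∂P := by
    intro n
    rw [Measure.map_apply hm (measurableSet_singleton _)]
    let e := Fintype.equivFin ι
    have := h.joint_counts Set.univ .univ (Fintype.card ι) (B ∘ e.symm) (fun i => hB _)
      (fun i => hb _) (fun i j hij => hd (by simpa using hij)) (n ∘ e.symm)
    simp only [Set.mem_univ, true_and, Set.preimage_univ, Measure.restrict_univ,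
      Function.comp_apply] at this
    simp_rw [poissonVec_singleton]
    have hp : ∀ ω, ∏ i, poissonMeasure (Λ ω (B i)).toNNReal {n i}
        = ∏ i, poissonMeasure (Λ ω (B (e.symm i))).toNNReal {n (e.symm i)} := fun ω =>
      (e.symm.prod_comp fun i => poissonMeasure (Λ ω (B i)).toNNReal {n i}).symm
    simp_rw [hp]
    rw [← this]
    congr 1
    ext ω
    simp only [Set.mem_preimage, Set.mem_singleton_iff, Set.mem_ofPred_eq]
    rw [h.1.eq_iff_countVec hB hb]
    exact e.symm.forall_congr_right.symm
  have hG : Measurable G := .of_discrete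
  rw [← lintegral_map hG hm, lintegral_countable']
  simp_rw [key, poissonMean, lintegral_countable']
  have hmn : ∀ n, Measurable fun ω => poissonVec (fun i => (Λ ω (B i)).toNNReal) {n} := fun n =>
    (continuous_poissonVec_singleton n).measurable.comp hmΛ
  rw [lintegral_tsum fun n => ((hmn n).const_mul _).aemeasurable]
  exact tsum_congr fun n => (lintegral_const_mul _ (hmn n)).symm

end Counts

/-! ### Intensities of Poisson and Cox processes -/

section Intensity

variable {Ω : Type u} [MeasurableSpace Ω] {P : Measure Ω} {Φ Λ : Ω → Measure Plane} {a : ℝ}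

/-- In this form Campbell's formula for the mean of `∫ f dΦ` is an instance of
`Measure.lintegral_bind`. -/
lemma hasIntensity_iff_bind (hΦ : Measurable Φ) :
    HasIntensity P Φ a ↔ P.bind Φ = ENNReal.ofReal a • volume := by
  rw [Measure.ext_iff]
  refine forall₂_congr fun B hB => ?_
  rw [Measure.bind_apply hB hΦ.aemeasurable]
  rfl

lemma hasIntensity_of_isBounded (hΦ : Measurable Φ)
    (h : ∀ B : Set Plane, MeasurableSet B → Bornology.IsBounded B →
      ∫⁻ ω, Φ ω B ∂P = ENNReal.ofReal a * volume B) : HasIntensity P Φ a := by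
  rw [hasIntensity_iff_bind hΦ]
  ext B hB
  have hU : B = ⋃ n : ℕ, B ∩ Metric.closedBall 0 n := by
    rw [← Set.inter_iUnion, Metric.iUnion_closedBall_nat, Set.inter_univ]
  have hmono : Monotone fun n : ℕ => B ∩ Metric.closedBall (0 : Plane) n := fun n m hnm =>
    Set.inter_subset_inter_right _ (Metric.closedBall_subset_closedBall (by exact_mod_cast hnm))
  rw [hU, hmono.measure_iUnion, hmono.measure_iUnion]
  refine iSup_congr fun n => ?_
  have hm : MeasurableSet (B ∩ Metric.closedBall (0 : Plane) n) :=
    hB.inter Metric.isClosed_closedBall.measurableSet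
  rw [Measure.bind_apply hm hΦ.aemeasurable,
    h _ hm (Metric.isBounded_closedBall.subset Set.inter_subset_right)]
  rfl

lemma lintegral_poissonVec_eval {ι : Type*} [Fintype ι] (t : ι → ℝ≥0) (i : ι) :
    ∫⁻ n, (n i : ℝ≥0∞) ∂poissonVec t = t i := by
  rw [← lintegral_poissonMeasure_id (t i)]
  exact (measurePreserving_eval (fun i => poissonMeasure (t i)) i).lintegral_comp
    (f := fun n : ℕ => (n : ℝ≥0∞)) .of_discrete

lemma volume_lt_top_of_isBounded {B : Set Plane} (hb : Bornology.IsBounded B) : volume B < ∞ :=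
  hb.measure_lt_top

lemma IsPoissonProcess.hasIntensity (h : IsPoissonProcess P Φ a) : HasIntensity P Φ a := by
  refine hasIntensity_of_isBounded h.1.measurable fun B hB hb => ?_
  have h1 := h.lintegral_countVec (ι := Unit) (B := fun _ => B) (fun _ => hB) (fun _ => hb)
    (fun i j hij => (hij rfl).elim) (fun n => (n () : ℝ≥0∞))
  rw [poissonMean, lintegral_poissonVec_eval, ENNReal.coe_toNNReal
    (ENNReal.mul_ne_top ENNReal.ofReal_ne_top (volume_lt_top_of_isBounded hb).ne)] at h1
  rw [← h1]
  exact lintegral_congr fun ω =>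
    ((h.1.counting ω).coe_countVec (B := fun _ : Unit => B) hB hb).symm

lemma IsCoxProcess.lintegral_eq (h : IsCoxProcess P Φ Λ) {B : Set Plane} (hB : MeasurableSet B)
    (hb : Bornology.IsBounded B) : ∫⁻ ω, Φ ω B ∂P = ∫⁻ ω, Λ ω B ∂P := by
  have h1 := h.lintegral_countVec (ι := Unit) (B := fun _ => B) (fun _ => hB) (fun _ => hb)
    (fun i j hij => (hij rfl).elim) (fun n => (n () : ℝ≥0∞))
  simp_rw [poissonMean, lintegral_poissonVec_eval] at h1
  rw [← lintegral_congr fun ω => ENNReal.coe_toNNReal (h.intensity_lt_top ω B hb).ne, ← h1]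
  exact lintegral_congr fun ω =>
    ((h.1.counting ω).coe_countVec (B := fun _ : Unit => B) hB hb).symm

end Intensity

/-! ### Annuli and the cluster intensity measure -/

section Annulus

variable {R δ : ℝ}

lemma mem_annulus {x y : Plane} : y ∈ annulus R δ x ↔ dist y x ≤ R ∧ R - δ < dist y x := by
  simp [annulus]

lemma mem_annulus_comm {x y : Plane} : y ∈ annulus R δ x ↔ x ∈ annulus R δ y := by
  rw [mem_annulus, mem_annulus, dist_comm]

lemma measurableSet_annulus (x : Plane) : MeasurableSet (annulus R δ x) :=
  Metric.isClosed_closedBall.measurableSet.diff Metric.isClosed_closedBall.measurableSet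

lemma measurableSet_annulus_prod :
    MeasurableSet {p : Plane × Plane | p.2 ∈ annulus R δ p.1} := by
  have hd : Measurable fun p : Plane × Plane => dist p.2 p.1 := by fun_prop
  simp_rw [mem_annulus]
  exact (measurableSet_le hd measurable_const).inter (measurableSet_lt measurable_const hd)

lemma volume_annulus (hδ : 0 ≤ δ) (hR : δ ≤ R) (x : Plane) :
    volume (annulus R δ x) = ENNReal.ofReal (δ * (2 * R - δ) * Real.pi) := by
  have hR0 : 0 ≤ R := hδ.trans hR
  rw [annulus, measure_sdiff (Metric.closedBall_subset_closedBall (by linarith))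
    Metric.isClosed_closedBall.measurableSet.nullMeasurableSet
    (volume_lt_top_of_isBounded Metric.isBounded_closedBall).ne,
    EuclideanSpace.volume_closedBall_fin_two, EuclideanSpace.volume_closedBall_fin_two,
    ← ENNReal.ofReal_pow hR0, ← ENNReal.ofReal_pow (sub_nonneg.2 hR),
    ← ENNReal.ofReal_mul (by positivity), ← ENNReal.ofReal_mul (by positivity),
    ← ENNReal.ofReal_sub _ (by positivity)]
  congr 1
  ring

lemma volume_annulus_ne_zero (hδ : 0 < δ) (hR : δ ≤ R) (x : Plane) :
    volume (annulus R δ x) ≠ 0 := by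
  rw [volume_annulus hδ.le hR, Ne, ENNReal.ofReal_eq_zero, not_le]
  have : 0 < 2 * R - δ := by linarith
  positivity

lemma volume_annulus_ne_top (x : Plane) : volume (annulus R δ x) ≠ ∞ :=
  (volume_lt_top_of_isBounded (Metric.isBounded_closedBall.subset Set.sdiff_subset)).ne

lemma measurable_uniform_annulus (R δ : ℝ) :
    Measurable fun x : Plane => (volume[|annulus R δ x] : Measure Plane) := by
  refine Measure.measurable_of_measurable_coe _ fun B hB => ?_
  have h : ∀ C : Set Plane, MeasurableSet C →
      Measurable fun x : Plane => volume (annulus R δ x ∩ C) := fun C hC =>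
    measurable_measure_prodMk_left (ν := (volume : Measure Plane))
      (s := {p : Plane × Plane | p.2 ∈ annulus R δ p.1} ∩ Prod.snd ⁻¹' C)
      (measurableSet_annulus_prod.inter (measurable_snd hC))
  have hU := h Set.univ .univ
  simp only [Set.inter_univ] at hU
  simp_rw [cond_apply (measurableSet_annulus _)]
  exact hU.inv.mul (h B hB)

lemma clusterIntensity_apply (μ : ℝ) (φ : Measure Plane) {B : Set Plane} (hB : MeasurableSet B) :
    clusterIntensity R δ μ φ B =
      ENNReal.ofReal μ * ∫⁻ x, (volume[|annulus R δ x] : Measure Plane) B ∂φ := by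
  rw [clusterIntensity, Measure.smul_apply, smul_eq_mul,
    Measure.bind_apply hB (measurable_uniform_annulus R δ).aemeasurable]

lemma measurable_clusterIntensity (R δ μ : ℝ) : Measurable (clusterIntensity R δ μ) := by
  refine Measure.measurable_of_measurable_coe _ fun B hB => ?_
  simp_rw [clusterIntensity_apply μ _ hB]
  exact (Measure.measurable_lintegral
    ((Measure.measurable_coe hB).comp (measurable_uniform_annulus R δ))).const_mul _

/-- The averaged uniform annulus measures give back Lebesgue measure. -/
lemma lintegral_uniform_annulus (hδ : 0 < δ) (hR : δ ≤ R) {B : Set Plane} (hB : MeasurableSet B) :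
    ∫⁻ x : Plane, (volume[|annulus R δ x] : Measure Plane) B = volume B := by
  have hs : MeasurableSet ({p : Plane × Plane | p.2 ∈ annulus R δ p.1} ∩ Prod.snd ⁻¹' B) :=
    measurableSet_annulus_prod.inter (measurable_snd hB)
  have hV : ∀ x, volume (annulus R δ x) = volume (annulus R δ 0) := fun x => by
    rw [volume_annulus hδ.le hR, volume_annulus hδ.le hR]
  simp_rw [cond_apply (measurableSet_annulus _), hV]
  have hm : Measurable fun x => volume (annulus R δ x ∩ B) :=
    measurable_measure_prodMk_left (ν := (volume : Measure Plane)) hs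
  rw [lintegral_const_mul _ hm]
  -- Fubini for the incidence set: membership in an annulus is symmetric in centre and point, so the
  -- sections in both directions are annuli of the same area.
  have h1 := Measure.prod_apply (μ := (volume : Measure Plane)) (ν := (volume : Measure Plane)) hs
  have h2 := Measure.prod_apply_symm (μ := (volume : Measure Plane))
    (ν := (volume : Measure Plane)) hs
  have e1 : ∀ x : Plane, Prod.mk x ⁻¹' ({p : Plane × Plane | p.2 ∈ annulus R δ p.1} ∩
      Prod.snd ⁻¹' B) = annulus R δ x ∩ B := fun x => rfl
  have e2 : ∀ y : Plane, volume ((fun x => (x, y)) ⁻¹'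
      ({p : Plane × Plane | p.2 ∈ annulus R δ p.1} ∩ Prod.snd ⁻¹' B))
      = B.indicator (fun _ => volume (annulus R δ 0)) y := by
    intro y
    by_cases hy : y ∈ B
    · rw [Set.indicator_of_mem hy, ← hV y]
      congr 1
      ext x
      simp [hy, mem_annulus_comm (x := x)]
    · rw [Set.indicator_of_notMem hy]
      convert measure_empty (μ := (volume : Measure Plane))
      ext x
      simp [hy]
  simp_rw [e1] at h1
  simp_rw [e2] at h2
  rw [lintegral_indicator hB, lintegral_const, Measure.restrict_apply .univ,
    Set.univ_inter] at h2
  rw [← h1, h2, ← mul_assoc, ENNReal.inv_mul_cancel (volume_annulus_ne_zero hδ hR 0)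
    (volume_annulus_ne_top 0), one_mul]

lemma uniform_annulus_eq_zero {B : Set Plane} {x : Plane} (h : Disjoint (annulus R δ x) B) :
    (volume[|annulus R δ x] : Measure Plane) B = 0 := by
  rw [cond_apply (measurableSet_annulus _), h.inter_eq]; simp

/-- Only centres within `r + R` of the origin have an annulus reaching the ball of radius `r`, and
there are finitely many of them. -/
lemma clusterIntensity_lt_top (μ : ℝ) {φ : Measure Plane} (hφ : IsCountingMeasure φ)
    {B : Set Plane} (hb : Bornology.IsBounded B) : clusterIntensity R δ μ φ B < ∞ := by
  obtain ⟨r, hr⟩ := hb.subset_closedBall 0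
  refine (measure_mono hr).trans_lt ?_
  rw [clusterIntensity_apply μ φ Metric.isClosed_closedBall.measurableSet]
  refine ENNReal.mul_lt_top ENNReal.ofReal_lt_top ?_
  calc ∫⁻ x, (volume[|annulus R δ x] : Measure Plane) (Metric.closedBall 0 r) ∂φ
      ≤ ∫⁻ x, (Metric.closedBall (0 : Plane) (r + R)).indicator 1 x ∂φ := by
        refine lintegral_mono fun x => ?_
        by_cases hx : x ∈ Metric.closedBall (0 : Plane) (r + R)
        · rw [Set.indicator_of_mem hx]; exact prob_le_one
        · rw [uniform_annulus_eq_zero]; · simp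
          rw [Set.disjoint_left]
          intro y hy hy'
          rw [mem_annulus] at hy
          rw [Metric.mem_closedBall] at hx hy'
          have := dist_triangle x y 0
          rw [dist_comm x y] at this
          linarith [hy.1]
    _ = φ (Metric.closedBall 0 (r + R)) :=
        lintegral_indicator_one Metric.isClosed_closedBall.measurableSet
    _ < ∞ := hφ.lt_top Metric.isBounded_closedBall

lemma lintegral_clusterIntensity {Ω : Type u} [MeasurableSpace Ω] {P : Measure Ω}
    {Φ : Ω → Measure Plane} {α μ : ℝ} (hα : 0 ≤ α) (hδ : 0 < δ) (hR : δ ≤ R)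
    (h : IsPoissonProcess P Φ α) {B : Set Plane} (hB : MeasurableSet B) :
    ∫⁻ ω, clusterIntensity R δ μ (Φ ω) B ∂P = ENNReal.ofReal (α * μ) * volume B := by
  have hm := (Measure.measurable_coe hB).comp (measurable_uniform_annulus R δ)
  simp_rw [clusterIntensity_apply μ _ hB]
  have hml : Measurable fun ω => ∫⁻ x, (volume[|annulus R δ x] : Measure Plane) B ∂Φ ω :=
    (Measure.measurable_lintegral hm).comp h.1.measurable
  rw [lintegral_const_mul _ hml]
  have h1 := Measure.lintegral_bind (m := P) (μ := Φ) h.1.measurable.aemeasurable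
    (f := fun x => (volume[|annulus R δ x] : Measure Plane) B) hm.aemeasurable
  rw [← h1, (hasIntensity_iff_bind h.1.measurable).1 h.hasIntensity,
    lintegral_smul_measure, lintegral_uniform_annulus hδ hR hB, smul_eq_mul, ENNReal.ofReal_mul hα,
    ← mul_assoc, mul_comm (ENNReal.ofReal μ)]

lemma IsAnnularClusterProcess.hasIntensity {Ω : Type u} [MeasurableSpace Ω] {P : Measure Ω}
    {Φ : Ω → Measure Plane} {α μ : ℝ} (hp : AdmissibleParams α R δ μ)
    (h : IsAnnularClusterProcess P Φ α R δ μ) : HasIntensity P Φ (α * μ) := by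
  obtain ⟨Φα, hα, hcox⟩ := h
  refine hasIntensity_of_isBounded hcox.1.measurable fun B hB hb => ?_
  rw [hcox.lintegral_eq hB hb, lintegral_clusterIntensity hp.1.le hp.2.2.1 hp.2.2.2 hα hB]

end Annulus

/-! ### Domination of Poisson vectors -/

section Domination

variable {ι : Type*} [Fintype ι] {Ω : Type u} [MeasurableSpace Ω] {P : Measure Ω}

/-- The random vector `N` of counts is larger than the vector of independent Poisson variables with
means `t` for the expectations of increasing directionally convex functions. -/
def DominatesPoisson (P : Measure Ω) (N : Ω → ι → ℕ) (t : ι → ℝ≥0) : Prop :=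
  ∀ G : (ι → ℕ) → ℝ≥0∞, IsIncrDcx G → poissonMean G t ≤ ∫⁻ ω, G (N ω) ∂P

/-- With the first summand frozen at `x`, the hypothesis on `N'` applies to the shifted function `G
(x + ·)`; averaging over `N'` leaves an admissible function, to which the hypothesis on `N` applies.
-/
lemma DominatesPoisson.add [IsProbabilityMeasure P] {N N' : Ω → ι → ℕ} {t t' : ι → ℝ≥0}
    (hN : Measurable N) (hN' : Measurable N') (hi : IndepFun N N' P)
    (h : DominatesPoisson P N t) (h' : DominatesPoisson P N' t') :
    DominatesPoisson P (N + N') (t + t') := by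
  intro G hG
  have e : ∫⁻ ω, G ((N + N') ω) ∂P = ∫⁻ ω, ∫⁻ ω', G (N ω + N' ω') ∂P ∂P := by
    have h1 := (indepFun_iff_map_prod_eq_prod_map_map hN.aemeasurable hN'.aemeasurable).1 hi
    have hm : Measurable fun p : (ι → ℕ) × (ι → ℕ) => G (p.1 + p.2) := .of_discrete
    have h2 := lintegral_map (μ := P) hm (hN.prodMk hN')
    simp only [Pi.add_apply]
    rw [← h2, h1, lintegral_prod _ hm.aemeasurable, lintegral_map .of_discrete hN]
    refine lintegral_congr fun ω => ?_
    rw [lintegral_map .of_discrete hN']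
  rw [e, poissonMean_add]
  refine le_trans ?_ (h _ (hG.lintegral hN'))
  exact lintegral_mono fun x => h' _ (hG.shift x)

lemma dominatesPoisson_zero [IsProbabilityMeasure P] :
    DominatesPoisson P (0 : Ω → ι → ℕ) 0 := by
  intro G _
  rw [poissonMean, poissonVec_zero, lintegral_dirac' _ .of_discrete]
  simp

lemma DominatesPoisson.sum_range [IsProbabilityMeasure P] {N : ℕ → Ω → ι → ℕ} {t : ℕ → ι → ℝ≥0}
    (hN : ∀ n, Measurable (N n)) (hi : iIndepFun N P) (h : ∀ n, DominatesPoisson P (N n) (t n))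
    (K : ℕ) :
    DominatesPoisson P (∑ n ∈ Finset.range K, N n) (∑ n ∈ Finset.range K, t n) := by
  induction K with
  | zero => simpa using dominatesPoisson_zero
  | succ K ih =>
    rw [Finset.sum_range_succ, Finset.sum_range_succ]
    have hm : Measurable (∑ n ∈ Finset.range K, N n) := by
      simpa [Finset.sum_fn] using Finset.measurable_sum (Finset.range K) fun n _ => hN n
    refine DominatesPoisson.add hm (hN K) ?_ ih (h K)
    exact hi.indepFun_sum_range_succ hN K

/-- No convergence of `M K` to `N` is needed: `G` is increasing, and the Poisson side is lower
semicontinuous in the means. -/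
lemma DominatesPoisson.of_tendsto {N : Ω → ι → ℕ} {t : ι → ℝ≥0} {M : ℕ → Ω → ι → ℕ}
    {s : ℕ → ι → ℝ≥0} (hle : ∀ K, ∀ᵐ ω ∂P, M K ω ≤ N ω) (h : ∀ K, DominatesPoisson P (M K) (s K))
    (hs : Filter.Tendsto s Filter.atTop (nhds t)) : DominatesPoisson P N t := by
  intro G hG
  refine poissonMean_le_of_tendsto hs fun K => (h K G hG).trans (lintegral_mono_ae ?_)
  filter_upwards [hle K] with ω hω using hG.mono hω

end Domination

/-! ### Shot noise of a Poisson process and its mean -/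

section ShotNoise

variable {ι : Type*} [Fintype ι] {Ω : Type u} [MeasurableSpace Ω] {P : Measure Ω}
  {Φ : Ω → Measure Plane} {α : ℝ}

/-- Shot-noise fields of a Poisson process are larger than their means in the increasing
directionally convex order, for step response functions. -/
lemma IsPoissonProcess.poissonMean_step_le (h : IsPoissonProcess P Φ α)
    {G : (ι → ℕ) → ℝ≥0∞} (hG : IsIncrDcx G) {N : ℕ} {D : Fin N → Set Plane}
    (hD : ∀ j, MeasurableSet (D j)) (hb : ∀ j, Bornology.IsBounded (D j))
    (hd : Pairwise fun i j => Disjoint (D i) (D j)) (c : Fin N → ι → ℝ≥0) :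
    poissonMean G (fun i => (ENNReal.ofReal α * ∑ j, c j i * volume (D j)).toNNReal) ≤
      ∫⁻ ω, poissonMean G (fun i => (∑ j, c j i * Φ ω (D j)).toNNReal) ∂P := by
  have h1 := poissonMean_sum_smul_le hG 0 c
    (fun j => (ENNReal.ofReal α * volume (D j)).toNNReal)
  have h2 := h.lintegral_countVec hD hb hd
    (fun m => poissonMean G (0 + ∑ j, (m j : ℝ≥0) • c j))
  rw [poissonMean] at h2
  rw [← h2] at h1
  have e1 : (fun i => (ENNReal.ofReal α * ∑ j, c j i * volume (D j)).toNNReal)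
      = 0 + ∑ j, (ENNReal.ofReal α * volume (D j)).toNNReal • c j := by
    funext i
    rw [zero_add, Finset.sum_apply, Finset.mul_sum, ENNReal.toNNReal_sum]
    · refine Finset.sum_congr rfl fun j _ => ?_
      rw [mul_left_comm, ENNReal.toNNReal_mul]
      simp [mul_comm]
    · intro j _
      exact ENNReal.mul_ne_top ENNReal.ofReal_ne_top
        (ENNReal.mul_ne_top ENNReal.coe_ne_top (volume_lt_top_of_isBounded (hb j)).ne)
  rw [e1]
  refine h1.trans (lintegral_mono fun ω => le_of_eq ?_)
  congr 1
  funext i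
  rw [zero_add, Finset.sum_apply, ENNReal.toNNReal_sum]
  · refine Finset.sum_congr rfl fun j _ => ?_
    rw [← (h.1.counting ω).coe_countVec (hD j) (hb j), ENNReal.toNNReal_mul]
    simp [mul_comm]
  · intro j _
    exact ENNReal.mul_ne_top ENNReal.coe_ne_top ((h.1.counting ω).lt_top (hb j)).ne

open Filter Topology in
/-- Shot-noise fields of a Poisson process are larger than their means in the increasing
directionally convex order. -/
lemma IsPoissonProcess.poissonMean_shotNoise_le (h : IsPoissonProcess P Φ α)
    {G : (ι → ℕ) → ℝ≥0∞} (hG : IsIncrDcx G) {p : ι → Plane → ℝ≥0∞} (hp : ∀ i, Measurable (p i))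
    (hfin : ∀ i, ∫⁻ x, p i x ≠ ∞) (hfinΦ : ∀ ω i, ∫⁻ x, p i x ∂Φ ω ≠ ∞) :
    poissonMean G (fun i => (ENNReal.ofReal α * ∫⁻ x, p i x).toNNReal) ≤
      ∫⁻ ω, poissonMean G (fun i => (∫⁻ x, p i x ∂Φ ω).toNNReal) ∂P := by
  classical
  set W : ℕ → Set Plane := fun k => Metric.closedBall 0 k with hW
  set s : ℕ → ι → SimpleFunc Plane ℝ≥0∞ := fun k i => SimpleFunc.eapprox (p i) k with hs
  have hWm : ∀ k, MeasurableSet (W k) := fun k => Metric.isClosed_closedBall.measurableSet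
  have hle : ∀ k i x, (W k).indicator (s k i) x ≤ p i x := fun k i x =>
    (Set.indicator_le_self _ _ _).trans (by
      rw [← SimpleFunc.iSup_eapprox_apply (hp i) x]
      exact le_iSup (fun n => (SimpleFunc.eapprox (p i) n) x) k)
  have hstep : ∀ k, poissonMean G
      (fun i => (ENNReal.ofReal α * ∫⁻ x, (W k).indicator (s k i) x).toNNReal) ≤
      ∫⁻ ω, poissonMean G (fun i => (∫⁻ x, p i x ∂Φ ω).toNNReal) ∂P := by
    intro k
    -- The common level sets of the simple functions, cut to the window `W k`, turn all responses
    -- simultaneously into step functions on disjoint bounded sets.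
    set J : Finset (ι → ℝ≥0∞) := Fintype.piFinset fun i => (s k i).range with hJ
    let e := J.equivFin
    set D : Fin J.card → Set Plane := fun j => W k ∩ ⋂ i, s k i ⁻¹' {(e.symm j).1 i} with hD
    set c : Fin J.card → ι → ℝ≥0 := fun j i => ((e.symm j).1 i).toNNReal with hc
    have hDm : ∀ j, MeasurableSet (D j) := fun j =>
      (hWm k).inter (MeasurableSet.iInter fun i => (s k i).measurableSet_preimage _)
    have hDd : Pairwise fun i j => Disjoint (D i) (D j) := by
      intro j j' hjj'
      rw [Set.disjoint_left]
      rintro x ⟨-, hx⟩ ⟨-, hx'⟩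
      apply hjj'
      apply e.symm.injective
      apply Subtype.ext
      funext i
      have h1 : s k i x = (e.symm j).1 i := Set.mem_iInter.1 hx i
      have h2 : s k i x = (e.symm j').1 i := Set.mem_iInter.1 hx' i
      rw [← h1, h2]
    have hpt : ∀ i x, (W k).indicator (s k i) x
        = ∑ j, (c j i : ℝ≥0∞) * (D j).indicator 1 x := by
      intro i x
      by_cases hx : x ∈ W k
      · have hmem : (fun i => s k i x) ∈ J :=
          Fintype.mem_piFinset.2 fun i => SimpleFunc.mem_range_self _ _
        rw [Set.indicator_of_mem hx, Finset.sum_eq_single (e ⟨_, hmem⟩)]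
        · rw [Set.indicator_of_mem]
          · simp only [hc, Equiv.symm_apply_apply, Pi.one_apply, mul_one]
            exact (ENNReal.coe_toNNReal (SimpleFunc.eapprox_lt_top _ _ _).ne).symm
          · exact ⟨hx, Set.mem_iInter.2 fun i => by simp⟩
        · intro j _ hj
          rw [Set.indicator_of_notMem, mul_zero]
          rintro ⟨-, hx'⟩
          apply hj
          rw [← e.apply_symm_apply j]
          congr 1
          apply Subtype.ext
          funext i
          have h1 : s k i x = (e.symm j).1 i := Set.mem_iInter.1 hx' i
          exact h1.symm
        · simp
      · rw [Set.indicator_of_notMem hx]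
        refine (Finset.sum_eq_zero fun j _ => ?_).symm
        rw [Set.indicator_of_notMem (fun h => hx h.1), mul_zero]
    have hint : ∀ (φ : Measure Plane) i, ∫⁻ x, (W k).indicator (s k i) x ∂φ
        = ∑ j, c j i * φ (D j) := by
      intro φ i
      simp_rw [hpt]
      rw [lintegral_finsetSum _ fun j _ => (measurable_one.indicator (hDm j)).const_mul _]
      refine Finset.sum_congr rfl fun j _ => ?_
      rw [lintegral_const_mul _ (measurable_one.indicator (hDm j)),
        lintegral_indicator_one (hDm j)]
    simp_rw [hint]
    refine (h.poissonMean_step_le hG hDm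
      (fun j => Metric.isBounded_closedBall.subset Set.inter_subset_left) hDd c).trans ?_
    refine lintegral_mono fun ω => poissonMean_mono hG fun i => ?_
    rw [← hint]
    exact ENNReal.toNNReal_mono (hfinΦ ω i) (lintegral_mono (hle k i))
  -- The right side of `hstep` already carries the full response `p`, by monotonicity, so only the
  -- deterministic means have to converge.
  refine poissonMean_le_of_tendsto (tendsto_pi_nhds.2 fun i => ?_) hstep
  have hm : Monotone fun k x => (W k).indicator (s k i) x := by
    intro k l hkl x
    have h1 : W k ⊆ W l := Metric.closedBall_subset_closedBall (by exact_mod_cast hkl)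
    calc (W k).indicator (s k i) x ≤ (W l).indicator (s k i) x :=
          Set.indicator_le_indicator_of_subset h1 (fun _ => zero_le) x
      _ ≤ _ := Set.indicator_le_indicator (SimpleFunc.monotone_eapprox (p i) hkl x)
  have hlim : Tendsto (fun k => ∫⁻ x, (W k).indicator (s k i) x) atTop (𝓝 (∫⁻ x, p i x)) := by
    refine lintegral_tendsto_of_tendsto_of_monotone
      (fun k => ((s k i).measurable.indicator (hWm k)).aemeasurable)
      (.of_forall fun x k l hkl => hm hkl x) (.of_forall fun x => ?_)
    have h1 : Tendsto (fun k => s k i x) atTop (𝓝 (p i x)) := by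
      rw [← SimpleFunc.iSup_eapprox_apply (hp i) x]
      exact tendsto_atTop_iSup fun k l hkl => SimpleFunc.monotone_eapprox (p i) hkl x
    refine h1.congr' ?_
    obtain ⟨n, hn⟩ := exists_nat_ge (dist x 0)
    filter_upwards [eventually_ge_atTop n] with k hk
    rw [Set.indicator_of_mem]
    exact hn.trans (by exact_mod_cast hk)
  have hc : ENNReal.ofReal α * ∫⁻ x, p i x ≠ ∞ := ENNReal.mul_ne_top ENNReal.ofReal_ne_top (hfin i)
  exact (ENNReal.tendsto_toNNReal hc).comp
    (ENNReal.Tendsto.const_mul hlim (Or.inr ENNReal.ofReal_ne_top))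

/-- The random means `Λ (A i)` are the shot noise of the parents with response `x ↦ μ U_x (A i)`,
whose integral is `μ |A i|` by averaging the annuli. -/
lemma IsAnnularClusterProcess.dominatesPoisson {R δ μ : ℝ} (hpar : AdmissibleParams α R δ μ)
    (h : IsAnnularClusterProcess P Φ α R δ μ) {A : ι → Set Plane} (hA : ∀ i, MeasurableSet (A i))
    (hb : ∀ i, Bornology.IsBounded (A i)) (hd : Pairwise fun i j => Disjoint (A i) (A j)) :
    DominatesPoisson P (fun ω => countVec (Φ ω) A)
      fun i => (ENNReal.ofReal (α * μ) * volume (A i)).toNNReal := by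
  intro G hG
  obtain ⟨Φα, hα, hcox⟩ := h
  rw [hcox.lintegral_countVec hA hb hd]
  set p : ι → Plane → ℝ≥0∞ := fun i x =>
    ENNReal.ofReal μ * (volume[|annulus R δ x] : Measure Plane) (A i) with hp
  have hm : ∀ i, Measurable fun x => (volume[|annulus R δ x] : Measure Plane) (A i) := fun i =>
    (Measure.measurable_coe (hA i)).comp (measurable_uniform_annulus R δ)
  have hint : ∀ (φ : Measure Plane) i, ∫⁻ x, p i x ∂φ = clusterIntensity R δ μ φ (A i) := by
    intro φ i
    rw [clusterIntensity_apply _ _ (hA i), ← lintegral_const_mul _ (hm i)]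
  have hvol : ∀ i, ∫⁻ x, p i x = ENNReal.ofReal μ * volume (A i) := fun i => by
    simp only [hp]
    rw [lintegral_const_mul _ (hm i), lintegral_uniform_annulus hpar.2.2.1 hpar.2.2.2 (hA i)]
  have := hα.poissonMean_shotNoise_le hG (p := p) (fun i => (hm i).const_mul _)
    (fun i => by
      rw [hvol]
      exact ENNReal.mul_ne_top ENNReal.ofReal_ne_top (volume_lt_top_of_isBounded (hb i)).ne)
    (fun ω i => by rw [hint]; exact (hcox.intensity_lt_top ω _ (hb i)).ne)
  simp_rw [hvol, hint, ← mul_assoc, ← ENNReal.ofReal_mul hpar.1.le] at this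
  exact this

end ShotNoise

/-! ### From directionally convex functions to increasing ones -/

section DirectionallyConvex

variable {k : ℕ} {f : (Fin k → ℝ) → ℝ}

/-- Directional convexity only speaks of increments along coordinate axes. General nonnegative
increments are built up one coordinate at a time, in one argument and then in the other. -/
lemma IsDirectionallyConvex.supermod (hf : IsDirectionallyConvex f) (x u v : Fin k → ℝ)
    (hu : 0 ≤ u) (hv : 0 ≤ v) : f (x + u) + f (x + v) ≤ f (x + u + v) + f x := by
  have h1 : ∀ (i j : Fin k) (s t : ℝ), 0 ≤ s → 0 ≤ t → ∀ x, f (x + Pi.single i s) +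
      f (x + Pi.single j t) ≤ f (x + Pi.single i s + Pi.single j t) + f x := by
    intro i j s t hs ht x
    rcases hs.eq_or_lt with rfl | hs
    · simp [add_comm]
    rcases ht.eq_or_lt with rfl | ht
    · simp
    linarith [hf.2 x s t hs ht i j]
  have step : ∀ (w : Fin k → ℝ), (∀ (i : Fin k) (s : ℝ), 0 ≤ s → ∀ x, f (x + Pi.single i s) +
      f (x + w) ≤ f (x + Pi.single i s + w) + f x) → ∀ (u : Fin k → ℝ), 0 ≤ u → ∀ x,
      f (x + u) + f (x + w) ≤ f (x + u + w) + f x := by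
    intro w hw u hu
    have : ∀ S : Finset (Fin k), ∀ x, f (x + ∑ i ∈ S, Pi.single i (u i)) + f (x + w) ≤
        f (x + ∑ i ∈ S, Pi.single i (u i) + w) + f x := by
      intro S
      induction S using Finset.induction_on with
      | empty => intro x; simp [add_comm]
      | insert a S ha ih =>
        intro x
        rw [Finset.sum_insert ha, ← add_assoc]
        have h2 := ih (x + Pi.single a (u a))
        have h3 := hw a (u a) (hu a) x
        linarith
    have hsum := this Finset.univ
    rwa [Finset.univ_sum_single] at hsum
  refine step v (fun i s hs x => ?_) u hu x
  have h4 := step (Pi.single i s) (fun j t ht x => h1 j i t s ht hs x) v hv x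
  rw [add_right_comm]
  linarith

/-- The difference between `f` and its affine minorant at the origin. -/
noncomputable def affineExcess (f : (Fin k → ℝ) → ℝ) (y : Fin k → ℝ) : ℝ :=
  f y - f 0 - ∑ i, (f (Pi.single i 1) - f 0) * y i

lemma affineExcess_zero : affineExcess f 0 = 0 := by simp [affineExcess]

lemma affineExcess_supermod (hf : IsDirectionallyConvex f) (x u v : Fin k → ℝ)
    (hu : 0 ≤ u) (hv : 0 ≤ v) :
    affineExcess f (x + u) + affineExcess f (x + v) ≤
      affineExcess f (x + u + v) + affineExcess f x := by
  have := hf.supermod x u v hu hv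
  simp only [affineExcess, Pi.add_apply, mul_add, Finset.sum_add_distrib]
  linarith

lemma affineExcess_superadd (hf : IsDirectionallyConvex f) (u v : Fin k → ℝ)
    (hu : 0 ≤ u) (hv : 0 ≤ v) :
    affineExcess f u + affineExcess f v ≤ affineExcess f (u + v) := by
  have := affineExcess_supermod hf 0 u v hu hv
  simpa [affineExcess_zero] using this

/-- The excess is superadditive and vanishes at unit vectors. Integrality matters: for `f y = y ^ 2`
in one variable the excess `y ^ 2 - y` is negative on `(0, 1)`. -/
lemma affineExcess_single_nonneg (hf : IsDirectionallyConvex f) (i : Fin k) (n : ℕ) :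
    0 ≤ affineExcess f (Pi.single i (n : ℝ)) := by
  induction n with
  | zero => simp [affineExcess_zero]
  | succ n ih =>
    have h1 := affineExcess_superadd hf (Pi.single i (n : ℝ)) (Pi.single i 1)
      (Pi.single_nonneg.2 (by positivity)) (Pi.single_nonneg.2 (by positivity))
    have h2 : affineExcess f (Pi.single i 1) = 0 := by
      rw [affineExcess, Finset.sum_eq_single i]
      · simp
      · intro j _ hj; simp [hj]
      · simp
    rw [← Pi.single_add] at h1
    push_cast
    linarith

lemma affineExcess_nonneg (hf : IsDirectionallyConvex f) (n : Fin k → ℕ) :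
    0 ≤ affineExcess f fun i => (n i : ℝ) := by
  have : ∀ S : Finset (Fin k), 0 ≤ affineExcess f (∑ i ∈ S, Pi.single i (n i : ℝ)) := by
    intro S
    induction S using Finset.induction_on with
    | empty => simp [affineExcess_zero]
    | insert a S ha ih =>
      rw [Finset.sum_insert ha]
      have := affineExcess_superadd hf (Pi.single a (n a : ℝ)) (∑ i ∈ S, Pi.single i (n i : ℝ))
        (Pi.single_nonneg.2 (by positivity))
        (Finset.sum_nonneg fun i _ => Pi.single_nonneg.2 (by positivity))
      linarith [affineExcess_single_nonneg hf a (n a)]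
  have h := this Finset.univ
  rwa [Finset.univ_sum_single] at h

/-- Monotonicity comes from superadditivity together with nonnegativity of the excess at the
increment. The additive map `L` serves to pass from atoms to general sets. -/
lemma isIncrDcx_affineExcess (hf : IsDirectionallyConvex f) {κ : Type*}
    (L : (κ → ℕ) →+ (Fin k → ℕ)) :
    IsIncrDcx fun n : κ → ℕ => ENNReal.ofReal (affineExcess f fun i => (L n i : ℝ)) := by
  have hcast : ∀ n m : κ → ℕ, (fun i => (L (n + m) i : ℝ))
      = (fun i => (L n i : ℝ)) + fun i => (L m i : ℝ) := by
    intro n m; funext i; simp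
  have h0 : ∀ n : κ → ℕ, (0 : Fin k → ℝ) ≤ fun i => (L n i : ℝ) := fun n i => by positivity
  refine ⟨?_, fun x u v => ?_⟩
  · intro x y hxy
    obtain ⟨w, rfl⟩ : ∃ w, y = x + w := ⟨y - x, (add_tsub_cancel_of_le hxy).symm⟩
    refine ENNReal.ofReal_le_ofReal ?_
    rw [hcast]
    linarith [affineExcess_superadd hf _ _ (h0 x) (h0 w), affineExcess_nonneg hf (L w)]
  · rw [← ENNReal.ofReal_add (affineExcess_nonneg hf _) (affineExcess_nonneg hf _),
      ← ENNReal.ofReal_add (affineExcess_nonneg hf _) (affineExcess_nonneg hf _)]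
    refine ENNReal.ofReal_le_ofReal ?_
    rw [hcast, hcast, hcast, hcast]
    exact affineExcess_supermod hf _ _ _ (h0 u) (h0 v)

end DirectionallyConvex

/-! ### Reduction to disjoint sets -/

section Atoms

variable {k : ℕ}

/-- The atoms of the algebra of sets generated by `B`, without the unbounded one. -/
def atoms (B : Fin k → Set Plane) (S : Fin k → Bool) : Set Plane :=
  (⋃ i, B i) ∩ {x | ∀ i, x ∈ B i ↔ S i = true}

variable {B : Fin k → Set Plane}

lemma measurableSet_atoms (hB : ∀ i, MeasurableSet (B i)) (S : Fin k → Bool) :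
    MeasurableSet (atoms B S) := by
  refine (MeasurableSet.iUnion hB).inter ?_
  rw [Set.ofPred_forall]
  refine MeasurableSet.iInter fun i => ?_
  cases S i with
  | true => simpa using hB i
  | false => simp only [Bool.false_eq_true, iff_false]; exact (hB i).compl

lemma isBounded_atoms (hb : ∀ i, Bornology.IsBounded (B i)) (S : Fin k → Bool) :
    Bornology.IsBounded (atoms B S) :=
  (Bornology.isBounded_iUnion.2 hb).subset Set.inter_subset_left

lemma pairwise_disjoint_atoms : Pairwise fun S T => Disjoint (atoms B S) (atoms B T) := by
  intro S T hST
  rw [Set.disjoint_left]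
  rintro x ⟨-, hS⟩ ⟨-, hT⟩
  apply hST
  funext i
  rw [Bool.eq_iff_iff, ← hS i, hT i]

/-- The counts of the sets `B i` from the counts of the atoms. -/
def atomSum : ((Fin k → Bool) → ℕ) →+ (Fin k → ℕ) where
  toFun n i := ∑ S, if S i then n S else 0
  map_zero' := by funext i; simp
  map_add' n m := by
    funext i
    simp only [Pi.add_apply]
    rw [← Finset.sum_add_distrib]
    exact Finset.sum_congr rfl fun S _ => by split_ifs <;> simp

lemma atomSum_countVec {φ : Measure Plane} (hφ : IsCountingMeasure φ)
    (hB : ∀ i, MeasurableSet (B i)) (hb : ∀ i, Bornology.IsBounded (B i)) (i : Fin k) :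
    (atomSum (countVec φ (atoms B)) i : ℝ) = (φ (B i)).toReal := by
  have h1 : B i = ⋃ S ∈ Finset.univ.filter (fun S : Fin k → Bool => S i = true), atoms B S := by
    classical
    ext x
    simp only [Finset.mem_filter, Finset.mem_univ, true_and, Set.mem_iUnion, exists_prop]
    constructor
    · intro hx
      exact ⟨fun j => decide (x ∈ B j), by simpa using hx, Set.mem_iUnion.2 ⟨i, hx⟩, by simp⟩
    · rintro ⟨S, hS, -, hx⟩
      exact (hx i).2 hS
  have h2 : φ (B i) = ∑ S ∈ Finset.univ.filter (fun S : Fin k → Bool => S i = true),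
      φ (atoms B S) := by
    conv_lhs => rw [h1]
    exact measure_biUnion_finset (fun S _ T _ hST => pairwise_disjoint_atoms hST)
      fun S _ => measurableSet_atoms hB S
  rw [h2, ← ENNReal.toReal_natCast]
  congr 1
  simp only [atomSum, AddMonoidHom.coe_mk, ZeroHom.coe_mk, Nat.cast_sum]
  rw [Finset.sum_filter]
  refine Finset.sum_congr rfl fun S _ => ?_
  rw [← hφ.coe_countVec (measurableSet_atoms hB S) (isBounded_atoms hb S)]
  split_ifs <;> simp

end Atoms

/-! ### The `dcx` order from domination of Poisson vectors -/

section DcxOrder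

variable {Ω₁ : Type u} {Ω₂ : Type v} [MeasurableSpace Ω₁] [MeasurableSpace Ω₂]
  {P₁ : Measure Ω₁} {P₂ : Measure Ω₂} {Φ₁ : Ω₁ → Measure Plane} {Φ₂ : Ω₂ → Measure Plane} {a : ℝ}

lemma HasIntensity.integrable_count (hi : HasIntensity P₁ Φ₁ a) (hΦ : Measurable Φ₁)
    {B : Set Plane} (hB : MeasurableSet B) (hb : Bornology.IsBounded B) :
    Integrable (fun ω => (Φ₁ ω B).toReal) P₁ := by
  refine integrable_toReal_of_lintegral_ne_top
    ((Measure.measurable_coe hB).comp hΦ).aemeasurable ?_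
  rw [hi B hB]
  exact ENNReal.mul_ne_top ENNReal.ofReal_ne_top (volume_lt_top_of_isBounded hb).ne

lemma HasIntensity.integral_count (hi : HasIntensity P₁ Φ₁ a) (hΦ : IsPointProcess Φ₁)
    {B : Set Plane} (hB : MeasurableSet B) (hb : Bornology.IsBounded B) :
    ∫ ω, (Φ₁ ω B).toReal ∂P₁ = (ENNReal.ofReal a * volume B).toReal := by
  have hm : Measurable fun ω => Φ₁ ω B := (Measure.measurable_coe hB).comp hΦ.measurable
  rw [integral_toReal hm.aemeasurable (.of_forall fun ω => (hΦ.counting ω).lt_top hb), hi B hB]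

/-- The second summand depends on the process only through its intensity, so comparing two processes
of the same intensity amounts to comparing the excess terms. -/
lemma integral_dcx_eq [IsProbabilityMeasure P₁] (hi : HasIntensity P₁ Φ₁ a)
    (hΦ : IsPointProcess Φ₁) {k : ℕ} {B : Fin k → Set Plane} (hB : ∀ i, MeasurableSet (B i))
    (hb : ∀ i, Bornology.IsBounded (B i)) {f : (Fin k → ℝ) → ℝ} (hf : IsDirectionallyConvex f)
    (hint : Integrable (fun ω => f fun i => (Φ₁ ω (B i)).toReal) P₁) :
    ∫⁻ ω, ENNReal.ofReal (affineExcess f fun i =>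
        (atomSum (countVec (Φ₁ ω) (atoms B)) i : ℝ)) ∂P₁ ≠ ∞ ∧
    ∫ ω, f (fun i => (Φ₁ ω (B i)).toReal) ∂P₁ =
      (∫⁻ ω, ENNReal.ofReal (affineExcess f fun i =>
        (atomSum (countVec (Φ₁ ω) (atoms B)) i : ℝ)) ∂P₁).toReal + (f 0 +
      ∑ i, (f (Pi.single i 1) - f 0) * (ENNReal.ofReal a * volume (B i)).toReal) := by
  set h : Ω₁ → ℝ := fun ω => affineExcess f fun i =>
        (atomSum (countVec (Φ₁ ω) (atoms B)) i : ℝ) with hh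
  have hnn : ∀ ω, 0 ≤ h ω := fun ω => affineExcess_nonneg hf _
  have he : ∀ ω, h ω = f (fun i => (Φ₁ ω (B i)).toReal) -
      (f 0 + ∑ i, (f (Pi.single i 1) - f 0) * (Φ₁ ω (B i)).toReal) := by
    intro ω
    simp only [hh, affineExcess, atomSum_countVec (hΦ.counting ω) hB hb]
    ring
  have hs : Integrable (fun ω => ∑ i, (f (Pi.single i 1) - f 0) * (Φ₁ ω (B i)).toReal) P₁ :=
    integrable_finsetSum _ fun i _ => (hi.integrable_count hΦ.measurable (hB i) (hb i)).const_mul _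
  have hc : Integrable (fun _ : Ω₁ => f 0) P₁ := integrable_const _
  have hcs : Integrable (fun ω => f 0 + ∑ i, (f (Pi.single i 1) - f 0) * (Φ₁ ω (B i)).toReal) P₁ :=
    hc.add hs
  have hhi : Integrable h P₁ := by
    rw [show h = _ from funext he]
    exact hint.sub hcs
  refine ⟨hhi.lintegral_lt_top.ne, ?_⟩
  have e : ∫ ω, h ω ∂P₁ = ∫ ω, f (fun i => (Φ₁ ω (B i)).toReal) ∂P₁ - (f 0 +
      ∑ i, (f (Pi.single i 1) - f 0) * (ENNReal.ofReal a * volume (B i)).toReal) := by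
    simp_rw [he]
    rw [integral_sub hint hcs, integral_add hc hs, integral_finsetSum _ fun i _ =>
      (hi.integrable_count hΦ.measurable (hB i) (hb i)).const_mul _]
    simp_rw [integral_const_mul, hi.integral_count hΦ (hB _) (hb _)]
    simp
  rw [← integral_eq_lintegral_of_nonneg_ae (.of_forall hnn) hhi.aestronglyMeasurable, e]
  ring

lemma dcxLE_of_dominatesPoisson [IsProbabilityMeasure P₁] [IsProbabilityMeasure P₂]
    (h₁ : IsPoissonProcess P₁ Φ₁ a) (h₂ : IsPointProcess Φ₂) (hi : HasIntensity P₂ Φ₂ a)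
    (hdom : ∀ (k : ℕ) (A : (Fin k → Bool) → Set Plane), (∀ S, MeasurableSet (A S)) →
      (∀ S, Bornology.IsBounded (A S)) → (Pairwise fun S T => Disjoint (A S) (A T)) →
      DominatesPoisson P₂ (fun ω => countVec (Φ₂ ω) A)
        fun S => (ENNReal.ofReal a * volume (A S)).toNNReal) :
    DcxLE P₁ Φ₁ P₂ Φ₂ := by
  intro k B hB hb f hf hf₁ hf₂
  obtain ⟨-, e₁⟩ := integral_dcx_eq h₁.hasIntensity h₁.1 hB hb hf hf₁
  obtain ⟨n₂, e₂⟩ := integral_dcx_eq hi h₂ hB hb hf hf₂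
  rw [e₁, e₂]
  -- The affine parts agree; finiteness of the larger excess integral (`n₂`) is what makes `toReal`
  -- monotone here.
  gcongr
  rw [h₁.lintegral_countVec (measurableSet_atoms hB) (isBounded_atoms hb) pairwise_disjoint_atoms
    (fun n => ENNReal.ofReal (affineExcess f fun i => (atomSum n i : ℝ)))]
  exact hdom k _ (measurableSet_atoms hB) (isBounded_atoms hb) pairwise_disjoint_atoms _
    (isIncrDcx_affineExcess hf atomSum)

end DcxOrder

/-! ### Poisson samples with finite intensity -/

section FinitePiece

variable {E : Type} [MeasurableSpace E] {κ : Type*} [Fintype κ]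

open Classical in
/-- The numbers of the first `p.1` points of the sequence `p.2` in the sets `B i`. -/
noncomputable def sampleCount (B : κ → Set E) (p : ℕ × (ℕ → E)) : κ → ℕ :=
  fun i => ∑ j ∈ Finset.range p.1, if p.2 j ∈ B i then 1 else 0

/-- The law of a Poisson number of independent points with law `ρ`. -/
noncomputable def sampleLaw (r : ℝ≥0) (ρ : Measure E) [IsProbabilityMeasure ρ] :
    Measure (ℕ × (ℕ → E)) :=
  (poissonMeasure r).prod (Measure.infinitePi fun _ => ρ)

instance (r : ℝ≥0) (ρ : Measure E) [IsProbabilityMeasure ρ] :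
    IsProbabilityMeasure (sampleLaw r ρ) := by
  unfold sampleLaw; infer_instance

omit [Fintype κ] in
lemma measurable_sampleCount {B : κ → Set E} (hB : ∀ i, MeasurableSet (B i)) :
    Measurable (sampleCount B) := by
  classical
  refine measurable_pi_lambda _ fun i => ?_
  refine measurable_from_prod_countable_right fun n => ?_
  exact Finset.measurable_sum (f := fun j (x : ℕ → E) => if x j ∈ B i then 1 else 0)
    (Finset.range n) fun j _ =>
    Measurable.ite ((measurable_pi_apply j) (hB i)) measurable_const measurable_const

-- By disjointness at most one term is nonzero at any `x`.
omit [MeasurableSpace E] in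
open Complex in
lemma exp_sum_indicator {B : κ → Set E} (hd : Pairwise fun i j => Disjoint (B i) (B j))
    (t : κ → ℝ) (x : E) [∀ i, Decidable (x ∈ B i)] :
    cexp ((∑ i, (if x ∈ B i then t i else 0 : ℝ) : ℝ) * I) =
      1 + ∑ i, (B i).indicator (fun _ => cexp (t i * I) - 1) x := by
  by_cases h : ∃ i, x ∈ B i
  · obtain ⟨i, hi⟩ := h
    have hj : ∀ j, j ≠ i → x ∉ B j := fun j hj hx => Set.disjoint_left.1 (hd hj) hx hi
    rw [Finset.sum_eq_single i (fun j _ hji => by simp [hj j hji]) (by simp),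
      Finset.sum_eq_single i (fun j _ hji => by simp [hj j hji]) (by simp)]
    simp [hi]
  · push Not at h
    simp [h]

open Complex in
/-- The numbers of points of a Poisson sample in disjoint sets are independent and Poisson. -/
lemma map_sampleCount (r : ℝ≥0) (ρ : Measure E) [IsProbabilityMeasure ρ] {B : κ → Set E}
    (hB : ∀ i, MeasurableSet (B i)) (hd : Pairwise fun i j => Disjoint (B i) (B j)) :
    (sampleLaw r ρ).map (sampleCount B) = poissonVec fun i => r * (ρ (B i)).toNNReal := by
  classical
  have hcm : Measurable fun n : κ → ℕ => fun i => (n i : ℝ) := .of_discrete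
  have hcast : MeasurableEmbedding fun n : κ → ℕ => fun i => (n i : ℝ) := by
    refine ⟨fun n m h => funext fun i => by simpa using congrFun h i, hcm, fun {s} _ => ?_⟩
    exact (s.to_countable.image _).measurableSet
  -- The counts are viewed as real vectors so that the product law can be recognised from
  -- characteristic functions.
  apply hcast.map_injective
  have hR : (poissonVec fun i => r * (ρ (B i)).toNNReal).map (fun n i => (n i : ℝ)) =
      Measure.pi fun i => (poissonMeasure (r * (ρ (B i)).toNNReal)).map (Nat.cast : ℕ → ℝ) :=
    (measurePreserving_pi _ _ fun i => ⟨.of_discrete, rfl⟩).map_eq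
  rw [hR, ← charFun_eq_pi_iff]
  intro t
  simp only [charFun_map_cast_poissonMeasure]
  have hm := measurable_sampleCount (E := E) hB
  rw [charFun_apply, Measure.map_map hcm hm,
    integral_map (WithLp.measurable_toLp 2 _).aemeasurable (by fun_prop),
    integral_map (hcm.comp hm).aemeasurable (by fun_prop)]
  set g : E → ℂ := fun x => cexp ((∑ i, (if x ∈ B i then t i else 0 : ℝ) : ℝ) * I) with hg
  have hgm : Measurable g := by
    refine Complex.measurable_exp.comp (Measurable.mul_const ?_ _)
    refine Complex.measurable_ofReal.comp (Finset.measurable_sum _ fun i _ => ?_)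
    exact Measurable.ite (hB i) measurable_const measurable_const
  -- The exponential of a sum over sample points factorises, so given the sample size `n` its
  -- expectation is the `n`-th power of `∫ g dρ`.
  have hint : ∀ p : ℕ × (ℕ → E), cexp (inner ℝ (WithLp.toLp 2
      (((fun (n : κ → ℕ) i => (n i : ℝ)) ∘ sampleCount B) p)) t * I)
      = ∏ j ∈ Finset.range p.1, g (p.2 j) := by
    intro p
    rw [hg, ← Complex.exp_sum, ← Finset.sum_mul, PiLp.inner_apply]
    congr 2
    rw [← Complex.ofReal_sum, Finset.sum_comm]
    congr 1
    refine Finset.sum_congr rfl fun i _ => ?_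
    simp only [Function.comp_apply, sampleCount, Real.inner_apply, Nat.cast_sum]
    rw [Finset.sum_mul]
    exact Finset.sum_congr rfl fun j _ => by split_ifs <;> simp
  simp_rw [hint]
  have hgn : ∀ x, ‖g x‖ = 1 := fun x => Complex.norm_exp_ofReal_mul_I _
  have hpm : Measurable fun p : ℕ × (ℕ → E) => ∏ j ∈ Finset.range p.1, g (p.2 j) :=
    measurable_from_prod_countable_right fun n =>
      Finset.measurable_prod (f := fun j (x : ℕ → E) => g (x j)) (Finset.range n) fun j _ =>
        hgm.comp (measurable_pi_apply j)
  have hpi : Integrable (fun p : ℕ × (ℕ → E) => ∏ j ∈ Finset.range p.1, g (p.2 j))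
      (sampleLaw r ρ) := by
    refine (integrable_const (1 : ℝ)).mono' hpm.aestronglyMeasurable (.of_forall fun p => ?_)
    rw [norm_prod]
    simp [hgn]
  have hpow : ∀ n : ℕ, ∫ x : ℕ → E, ∏ j ∈ Finset.range n, g (x j)
      ∂(Measure.infinitePi fun _ => ρ) = (∫ x, g x ∂ρ) ^ n := by
    intro n
    have hi : iIndepFun (fun (j : Fin n) (x : ℕ → E) => x j)
        (Measure.infinitePi fun _ : ℕ => ρ) :=
      (iIndepFun_infinitePi (P := fun _ : ℕ => ρ) (X := fun _ x => x)
        fun _ => measurable_id).precomp Fin.val_injective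
    have := hi.integral_fun_prod_comp (f := fun _ => g)
      (fun j => (measurable_pi_apply _).aemeasurable) (fun j => hgm.aestronglyMeasurable)
    simp_rw [Finset.prod_range]
    rw [this]
    have h1 : ∀ j : Fin n, ∫ x : ℕ → E, g (x j) ∂(Measure.infinitePi fun _ => ρ)
        = ∫ x, g x ∂ρ := fun j => by
      rw [← integral_map (φ := fun x : ℕ → E => x j) (measurable_pi_apply _).aemeasurable
        hgm.aestronglyMeasurable]
      congr 1
      exact Measure.infinitePi_map_eval (fun _ : ℕ => ρ) j
    simp [h1]
  have hφ : ∫ x, g x ∂ρ = 1 + ∑ i, (ρ (B i)).toReal * (cexp (t i * I) - 1) := by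
    simp_rw [hg, exp_sum_indicator hd]
    rw [integral_add (integrable_const _) (integrable_finsetSum _ fun i _ =>
      (integrable_const _).indicator (hB i)), integral_finsetSum _ fun i _ =>
      (integrable_const _).indicator (hB i)]
    simp only [integral_const, integral_indicator (hB _), measureReal_def]
    simp
  unfold sampleLaw at hpi ⊢
  rw [integral_prod _ hpi]
  simp_rw [hpow]
  rw [integral_poissonMeasure]
  -- Generating function of the Poisson law, `E z ^ N = exp (r * (z - 1))`; its exponent is a sum
  -- over the sets `B i`, which gives independence.
  calc ∑' n : ℕ, (Real.exp (-r) * r ^ n / n.factorial : ℝ) • (∫ x, g x ∂ρ) ^ n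
      = ∑' n : ℕ, cexp (-r) * ((r * ∫ x, g x ∂ρ) ^ n / n.factorial) := by
        refine tsum_congr fun n => ?_
        rw [Complex.real_smul, mul_pow]
        push_cast
        ring
    _ = cexp (-r) * cexp (r * ∫ x, g x ∂ρ) := by
        rw [tsum_mul_left, (NormedSpace.expSeries_div_hasSum_exp (r * ∫ x, g x ∂ρ)).tsum_eq,
          ← Complex.exp_eq_exp_ℂ]
    _ = _ := by
        rw [← Complex.exp_add, hφ, ← Complex.exp_sum]
        congr 1
        rw [mul_add, mul_one, neg_add_cancel_left, Finset.mul_sum]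
        refine Finset.sum_congr rfl fun i _ => ?_
        push_cast
        rw [← mul_assoc]

lemma exists_smul_isProbabilityMeasure [Nonempty E] (ν : Measure E) [IsFiniteMeasure ν] :
    ∃ (r : ℝ≥0) (ρ : Measure E), IsProbabilityMeasure ρ ∧ ν = r • ρ := by
  rcases eq_or_ne ν 0 with rfl | h
  · exact ⟨0, Measure.dirac (Classical.arbitrary E), inferInstance, by simp⟩
  · have h0 : ν Set.univ ≠ 0 := by simpa using h
    refine ⟨(ν Set.univ).toNNReal, (ν Set.univ)⁻¹ • ν, ⟨?_⟩, ?_⟩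
    · simp [ENNReal.inv_mul_cancel h0 (measure_ne_top _ _)]
    · ext s _
      simp only [Measure.smul_apply, smul_eq_mul, ENNReal.smul_def,
        ENNReal.coe_toNNReal (measure_ne_top ν _)]
      rw [← mul_assoc, ENNReal.mul_inv_cancel h0 (measure_ne_top _ _), one_mul]

end FinitePiece

/-! ### Existence of Poisson processes -/

section PoissonKernel

variable {E : Type} [PseudoMetricSpace E] [MeasurableSpace E] [OpensMeasurableSpace E]

/-- Existence of Poisson processes with a given intensity measure, as random measures which are
surely locally finite and integer-valued. -/
theorem exists_poisson_kernel [Nonempty E] (ν : Measure E)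
    (hν : ∀ B, Bornology.IsBounded B → ν B < ∞) :
    ∃ (Ω : Type) (_ : MeasurableSpace Ω) (P : Measure Ω) (_ : IsProbabilityMeasure P)
      (Φ : Kernel Ω E), IsSFiniteKernel Φ ∧
      (∀ ω B, MeasurableSet B → Bornology.IsBounded B → ∃ n : ℕ, Φ ω B = n) ∧
      ∀ (k : ℕ) (B : Fin k → Set E), (∀ i, MeasurableSet (B i)) →
        (∀ i, Bornology.IsBounded (B i)) → (∀ i j, i ≠ j → Disjoint (B i) (B j)) →
        ∀ n : Fin k → ℕ, P {ω | ∀ i, Φ ω (B i) = n i} =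
          ∏ i, poissonMeasure (ν (B i)).toNNReal {n i} := by
  classical
  obtain ⟨x₀⟩ := ‹Nonempty E›
  have : Nonempty E := ⟨x₀⟩
  -- Independent finite samples on disjoint shells are superposed; a bounded set meets only finitely
  -- many shells.
  set S : ℕ → Set E := fun m => Metric.ball x₀ (m + 1) \ Metric.ball x₀ m with hS
  have hSm : ∀ m, MeasurableSet (S m) := fun m =>
    Metric.isOpen_ball.measurableSet.diff Metric.isOpen_ball.measurableSet
  have hSd : Pairwise fun m l => Disjoint (S m) (S l) := by
    have key : ∀ m l : ℕ, m < l → Disjoint (S m) (S l) := by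
      intro m l hml
      rw [Set.disjoint_left]
      rintro x ⟨hx, -⟩ ⟨-, hx'⟩
      exact hx' (Metric.ball_subset_ball (by exact_mod_cast hml) hx)
    intro m l hml
    rcases lt_or_gt_of_ne hml with h | h
    · exact key m l h
    · exact (key l m h).symm
  have hSc : ∀ (K : ℕ) (x : E), x ∈ Metric.ball x₀ K → ∃ m < K, x ∈ S m := by
    intro K x hx
    refine ⟨⌊dist x x₀⌋₊, ?_, ?_, ?_⟩
    · exact (Nat.floor_lt dist_nonneg).2 hx
    · exact Nat.lt_floor_add_one (dist x x₀)
    · rw [Metric.mem_ball, not_lt]; exact Nat.floor_le dist_nonneg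
  have hfin : ∀ m, IsFiniteMeasure (ν.restrict (S m)) := fun m =>
    ⟨by rw [Measure.restrict_apply_univ]
        exact hν _ (Metric.isBounded_ball.subset Set.sdiff_subset)⟩
  choose r ρ hρ hrρ using fun m => exists_smul_isProbabilityMeasure (ν.restrict (S m))
  set Ω : Type := ℕ → ℕ × (ℕ → E)
  set P : Measure Ω := Measure.infinitePi fun m => sampleLaw (r m) (ρ m) with hP
  have hact : ∀ m j, MeasurableSet {ω : Ω | j < (ω m).1 ∧ (ω m).2 j ∈ S m} := by
    intro m j
    have h1 : Measurable fun ω : Ω => (ω m).1 := by fun_prop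
    have h2 : Measurable fun ω : Ω => (ω m).2 j := by fun_prop
    exact (measurableSet_lt measurable_const h1).inter (h2 (hSm m))
  -- The Dirac mass at point `j` of shell `m`, switched off when `j` is beyond the sample size or
  -- the point falls outside its shell. The second condition fails with probability zero, but
  -- imposing it makes local finiteness hold for every `ω`.
  set κ : ℕ × ℕ → Kernel Ω E := fun q =>
    Kernel.piecewise (hact q.1 q.2)
      (Kernel.deterministic (fun ω : Ω => (ω q.1).2 q.2) (by fun_prop)) 0 with hκ
  set Φ : Kernel Ω E := Kernel.sum κ with hΦ
  have hs : IsSFiniteKernel Φ := by rw [hΦ]; infer_instance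
  have hpiece : ∀ (ω : Ω) (m : ℕ) (B : Set E), MeasurableSet B →
      ∑' j, κ (m, j) ω B = (sampleCount (fun _ : Unit => B ∩ S m) (ω m) () : ℝ≥0∞) := by
    intro ω m B hB
    rw [tsum_eq_sum (s := Finset.range (ω m).1)]
    · rw [sampleCount, Nat.cast_sum]
      refine Finset.sum_congr rfl fun j hj => ?_
      rw [Finset.mem_range] at hj
      simp only [hκ, Kernel.piecewise_apply', Set.mem_ofPred_eq, hj, true_and,
        Kernel.deterministic_apply' _ _ hB, Set.mem_inter_iff, Set.indicator]
      by_cases h1 : (ω m).2 j ∈ S m <;> by_cases h2 : (ω m).2 j ∈ B <;> simp [h1, h2]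
    · intro j hj
      rw [Finset.mem_range] at hj
      simp [hκ, Kernel.piecewise_apply', hj]
  have hcount : ∀ (K : ℕ) (ω : Ω) (B : Set E), MeasurableSet B → B ⊆ Metric.ball x₀ K →
      Φ ω B = ((∑ m ∈ Finset.range K,
        sampleCount (fun _ : Unit => B ∩ S m) (ω m) () : ℕ) : ℝ≥0∞) := by
    intro K ω B hB hBK
    rw [hΦ, Kernel.sum_apply' _ _ hB, ENNReal.tsum_prod' (f := fun q => κ q ω B)]
    simp_rw [hpiece ω _ B hB]
    rw [tsum_eq_sum (s := Finset.range K), Nat.cast_sum]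
    intro m hm
    rw [Finset.mem_range] at hm
    have : B ∩ S m = ∅ := by
      rw [Set.eq_empty_iff_forall_notMem]
      rintro x ⟨hx, hx'⟩
      obtain ⟨l, hl, hxl⟩ := hSc K x (hBK hx)
      exact Set.disjoint_left.1 (hSd (show l ≠ m by omega)) hxl hx'
    simp [sampleCount, this]
  refine ⟨Ω, inferInstance, P, inferInstance, Φ, hs, ?_, ?_⟩
  · intro ω B hB hb
    obtain ⟨R, hR⟩ := hb.subset_ball x₀
    obtain ⟨K, hK⟩ := exists_nat_ge R
    exact ⟨_, hcount K ω B hB (hR.trans (Metric.ball_subset_ball hK))⟩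
  · intro k B hB hb hd n
    obtain ⟨R, hR⟩ := (Bornology.isBounded_iUnion.2 hb).subset_ball x₀
    obtain ⟨K, hK⟩ := exists_nat_ge R
    have hBK : ∀ i, B i ⊆ Metric.ball x₀ K := fun i =>
      (Set.subset_iUnion B i).trans (hR.trans (Metric.ball_subset_ball hK))
    set c : ℕ → Ω → Fin k → ℕ := fun m ω => sampleCount (fun i => B i ∩ S m) (ω m) with hc
    have hcm' : ∀ m, Measurable (sampleCount fun i => B i ∩ S m) := fun m =>
      measurable_sampleCount fun i => (hB i).inter (hSm m)
    have hcm : ∀ m, Measurable (c m) := fun m => (hcm' m).comp (measurable_pi_apply m)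
    have hci : iIndepFun c P :=
      iIndepFun_infinitePi (P := fun m => sampleLaw (r m) (ρ m))
        (X := fun m => sampleCount fun i => B i ∩ S m) hcm'
    have hlaw : ∀ m, P.map (c m) = poissonVec fun i => (ν (B i ∩ S m)).toNNReal := by
      intro m
      have h1 : P.map (c m) =
          (sampleLaw (r m) (ρ m)).map (sampleCount fun i => B i ∩ S m) := by
        rw [← (measurePreserving_eval_infinitePi (fun m => sampleLaw (r m) (ρ m)) m).map_eq,
          Measure.map_map (hcm' m) (measurable_pi_apply m)]
        rfl
      rw [h1, map_sampleCount _ _ (fun i => (hB i).inter (hSm m)) fun i j hij =>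
        (hd i j hij).mono Set.inter_subset_left Set.inter_subset_left]
      congr 1
      funext i
      have h2 : ν (B i ∩ S m) = r m * ρ m (B i ∩ S m) := by
        have := congrArg (fun μ => μ (B i ∩ S m)) (hrρ m)
        simp only [Measure.restrict_apply ((hB i).inter (hSm m))] at this
        rw [Set.inter_assoc, Set.inter_self] at this
        rw [this]
        rfl
      rw [h2, ENNReal.toNNReal_mul, ENNReal.toNNReal_coe]
    have hsum : ∀ L : ℕ, P.map (∑ m ∈ Finset.range L, c m) =
        poissonVec fun i => ∑ m ∈ Finset.range L, (ν (B i ∩ S m)).toNNReal := by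
      intro L
      induction L with
      | zero =>
        simp only [Finset.range_zero, Finset.sum_empty]
        have : (fun _ : Fin k => (0 : ℝ≥0)) = 0 := rfl
        rw [this, poissonVec_zero]
        have : (0 : Ω → Fin k → ℕ) = fun _ => 0 := rfl
        rw [this, Measure.map_const]
        simp
      | succ L ih =>
        have hm : Measurable (∑ m ∈ Finset.range L, c m) := by
          simpa [Finset.sum_fn] using Finset.measurable_sum (Finset.range L) fun n _ => hcm n
        rw [Finset.sum_range_succ, (hci.indepFun_sum_range_succ hcm L).map_add_eq_map_conv_map
          hm (hcm L), ih, hlaw, poissonVec_conv]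
        congr 1
        funext i
        simp [Finset.sum_range_succ]
    have hνB : ∀ i, ∑ m ∈ Finset.range K, (ν (B i ∩ S m)).toNNReal = (ν (B i)).toNNReal := by
      intro i
      rw [← ENNReal.toNNReal_sum]
      · rw [← measure_biUnion_finset]
        · congr 2
          ext x
          simp only [Set.mem_iUnion, Finset.mem_range, Set.mem_inter_iff, exists_prop]
          constructor
          · rintro ⟨m, -, hx, -⟩; exact hx
          · intro hx
            obtain ⟨m, hm, hxm⟩ := hSc K x (hBK i hx)
            exact ⟨m, hm, hx, hxm⟩
        · intro m _ l _ hml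
          exact (hSd hml).mono Set.inter_subset_right Set.inter_subset_right
        · exact fun m _ => (hB i).inter (hSm m)
      · exact fun m _ => (hν _ ((hb i).subset Set.inter_subset_left)).ne
    have hset : {ω | ∀ i, Φ ω (B i) = n i} = (∑ m ∈ Finset.range K, c m) ⁻¹' {n} := by
      ext ω
      simp only [Set.mem_ofPred_eq, Set.mem_preimage, Set.mem_singleton_iff, funext_iff,
        Finset.sum_apply]
      refine forall_congr' fun i => ?_
      rw [hcount K ω (B i) (hB i) (hBK i), Nat.cast_inj]
      rfl
    have hm : Measurable (∑ m ∈ Finset.range K, c m) := by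
      simpa [Finset.sum_fn] using Finset.measurable_sum (Finset.range K) fun n _ => hcm n
    rw [hset, ← Measure.map_apply hm (measurableSet_singleton _), hsum, poissonVec_singleton]
    simp_rw [hνB]

end PoissonKernel

/-! ### Pulling processes back along measure-preserving maps -/

section Transfer

variable {Ω : Type u} {Ω' : Type v} [MeasurableSpace Ω] [MeasurableSpace Ω'] {P : Measure Ω}
  {P' : Measure Ω'} {Φ Λ : Ω → Measure Plane} {T : Ω' → Ω} {a : ℝ}

lemma IsPointProcess.comp (h : IsPointProcess Φ) (hT : Measurable T) : IsPointProcess (Φ ∘ T) :=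
  ⟨h.measurable.comp hT, fun ω => h.counting (T ω)⟩

lemma measurableSet_counts_eq (hΦ : Measurable Φ) {k : ℕ} {B : Fin k → Set Plane}
    (hB : ∀ i, MeasurableSet (B i)) (n : Fin k → ℕ) :
    MeasurableSet {ω | ∀ i, Φ ω (B i) = n i} := by
  rw [Set.ofPred_forall]
  exact MeasurableSet.iInter fun i =>
    ((Measure.measurable_coe (hB i)).comp hΦ) (measurableSet_singleton _)

lemma IsPoissonProcess.comp (h : IsPoissonProcess P Φ a) (hT : MeasurePreserving T P' P) :
    IsPoissonProcess P' (Φ ∘ T) a := by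
  refine ⟨h.1.comp hT.measurable, fun k B hB hb hd n => ?_⟩
  rw [← h.joint_counts k B hB hb hd n]
  exact hT.measure_preimage
    (measurableSet_counts_eq h.1.measurable hB n).nullMeasurableSet

lemma IsCoxProcess.comp (h : IsCoxProcess P Φ Λ) (hT : MeasurePreserving T P' P) :
    IsCoxProcess P' (Φ ∘ T) (Λ ∘ T) := by
  refine ⟨h.1.comp hT.measurable, h.measurable_intensity.comp hT.measurable,
    fun ω => h.intensity_lt_top _, fun G hG k B hB hb hd n => ?_⟩
  have hm : Measurable fun ω => ∏ i, poissonMeasure (Λ ω (B i)).toNNReal {n i} :=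
    Finset.measurable_prod _ fun i _ => (continuous_poissonMeasure_singleton (n i)).measurable.comp
      ((Measure.measurable_coe (hB i)).comp h.measurable_intensity).ennreal_toNNReal
  have h1 := hT.setLIntegral_comp_preimage (h.measurable_intensity hG) hm
  rw [← h.joint_counts G hG k B hB hb hd n] at h1
  rw [Set.preimage_comp]
  simp only [Function.comp_apply]
  rw [h1]
  exact hT.measure_preimage ((h.measurable_intensity hG).inter
    (measurableSet_counts_eq h.1.measurable hB n)).nullMeasurableSet

lemma IsAnnularClusterProcess.comp {α R δ μ : ℝ} (h : IsAnnularClusterProcess P Φ α R δ μ)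
    (hT : MeasurePreserving T P' P) : IsAnnularClusterProcess P' (Φ ∘ T) α R δ μ := by
  obtain ⟨Φα, hα, hcox⟩ := h
  exact ⟨Φα ∘ T, hα.comp hT, hcox.comp hT⟩

end Transfer

/-! ### Existence of annular cluster processes -/

section Existence

/-- The s-finite kernel structure is recorded because it gives joint measurability of `(ω, y) ↦ Φ ω
(annulus R δ y)`. -/
theorem exists_poissonProcess (a : ℝ) :
    ∃ (Ω : Type) (_ : MeasurableSpace Ω) (P : Measure Ω) (_ : IsProbabilityMeasure P)
      (Φ : Kernel Ω Plane), IsSFiniteKernel Φ ∧ IsPoissonProcess P Φ a := by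
  obtain ⟨Ω, mΩ, P, hP, Φ, hs, hc, hj⟩ :=
    exists_poisson_kernel (ENNReal.ofReal a • (volume : Measure Plane)) fun B hb =>
      ENNReal.mul_lt_top ENNReal.ofReal_lt_top (volume_lt_top_of_isBounded hb)
  exact ⟨Ω, mΩ, P, hP, Φ, hs, ⟨Φ.measurable, hc⟩, hj⟩

variable {R δ μ : ℝ}

/-- The density of `clusterIntensity R δ μ φ` with respect to Lebesgue measure. -/
noncomputable def clusterDensity (R δ μ : ℝ) (φ : Measure Plane) (y : Plane) : ℝ≥0∞ :=
  ENNReal.ofReal μ * (volume (annulus R δ 0))⁻¹ * φ (annulus R δ y)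

lemma setLIntegral_clusterDensity (hδ : 0 ≤ δ) (hR : δ ≤ R) (μ : ℝ) (φ : Measure Plane)
    [SFinite φ] {B : Set Plane} (hB : MeasurableSet B) :
    ∫⁻ y in B, clusterDensity R δ μ φ y = clusterIntensity R δ μ φ B := by
  have hV : ∀ x, volume (annulus R δ x) = volume (annulus R δ 0) := fun x => by
    rw [volume_annulus hδ hR, volume_annulus hδ hR]
  have hs : MeasurableSet {p : Plane × Plane | p.2 ∈ annulus R δ p.1} := measurableSet_annulus_prod
  have hm1 : Measurable fun x : Plane => (volume.restrict B) (annulus R δ x) :=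
    measurable_measure_prodMk_left (ν := volume.restrict B) hs
  have hm2 : Measurable fun y : Plane => φ (annulus R δ y) :=
    measurable_measure_prodMk_left (ν := φ) hs
  rw [clusterIntensity_apply μ φ hB]
  simp_rw [cond_apply (measurableSet_annulus _), hV, clusterDensity]
  rw [lintegral_const_mul _ hm2]
  have hm3 : Measurable fun x : Plane => volume (annulus R δ x ∩ B) := by
    simpa only [Measure.restrict_apply (measurableSet_annulus _)] using hm1
  rw [lintegral_const_mul _ hm3, mul_assoc]
  congr 2
  have h1 := Measure.prod_apply (μ := φ) (ν := volume.restrict B) hs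
  have h2 := Measure.prod_apply_symm (μ := φ) (ν := volume.restrict B) hs
  have e1 : ∀ x : Plane, Prod.mk x ⁻¹' {p : Plane × Plane | p.2 ∈ annulus R δ p.1}
      = annulus R δ x := fun x => by ext y; rfl
  have e2 : ∀ y : Plane, (fun x => (x, y)) ⁻¹' {p : Plane × Plane | p.2 ∈ annulus R δ p.1}
      = annulus R δ y := fun y => by
    ext x
    rw [Set.mem_preimage, Set.mem_ofPred_eq, mem_annulus_comm]
  simp_rw [e1, Measure.restrict_apply (measurableSet_annulus _)] at h1
  simp_rw [e2] at h2
  rw [← h1, h2]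

lemma clusterDensity_le {φ : Measure Plane} {r : ℝ} {y : Plane}
    (hy : y ∈ Metric.closedBall (0 : Plane) r) :
    clusterDensity R δ μ φ y ≤ ENNReal.ofReal μ * (volume (annulus R δ 0))⁻¹ *
      φ (Metric.closedBall 0 (r + R)) := by
  refine mul_le_mul_right (measure_mono fun x hx => ?_) _
  rw [mem_annulus] at hx
  rw [Metric.mem_closedBall] at hy ⊢
  linarith [dist_triangle x y 0, hx.1]

/-- The points under the graph of `ρ`. -/
def subgraph (ρ : Plane → ℝ≥0∞) (B : Set Plane) : Set (Plane × ℝ) :=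
  {p | p.1 ∈ B ∧ 0 < p.2 ∧ ENNReal.ofReal p.2 ≤ ρ p.1}

lemma measurableSet_subgraph {ρ : Plane → ℝ≥0∞} (hρ : Measurable ρ) {B : Set Plane}
    (hB : MeasurableSet B) : MeasurableSet (subgraph ρ B) :=
  (measurable_fst hB).inter ((measurableSet_lt measurable_const measurable_snd).inter
    (measurableSet_le measurable_snd.ennreal_ofReal (hρ.comp measurable_fst)))

lemma volume_subgraph {ρ : Plane → ℝ≥0∞} (hρ : Measurable ρ) (hfin : ∀ y, ρ y ≠ ∞) {B : Set Plane}
    (hB : MeasurableSet B) : volume (subgraph ρ B) = ∫⁻ y in B, ρ y := by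
  rw [Measure.volume_eq_prod, Measure.prod_apply (measurableSet_subgraph hρ hB),
    ← lintegral_indicator hB]
  refine lintegral_congr fun y => ?_
  by_cases hy : y ∈ B
  · rw [Set.indicator_of_mem hy]
    have : Prod.mk y ⁻¹' subgraph ρ B = Set.Ioc 0 (ρ y).toReal := by
      ext s
      simp only [subgraph, Set.mem_preimage, Set.mem_ofPred_eq, hy, true_and, Set.mem_Ioc]
      refine and_congr_right fun hs => ?_
      exact ENNReal.ofReal_le_iff_le_toReal (hfin y)
    rw [this, Real.volume_Ioc, sub_zero, ENNReal.ofReal_toReal (hfin y)]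
  · rw [Set.indicator_of_notMem hy]
    have : Prod.mk y ⁻¹' subgraph ρ B = ∅ := by
      ext s; simp [subgraph, hy]
    rw [this, measure_empty]

lemma isBounded_subgraph {ρ : Plane → ℝ≥0∞} {B : Set Plane} (hb : Bornology.IsBounded B)
    {M : ℝ≥0∞} (hM : M ≠ ∞) (h : ∀ y ∈ B, ρ y ≤ M) : Bornology.IsBounded (subgraph ρ B) := by
  refine (hb.prod (Metric.isBounded_Icc (0 : ℝ) M.toReal)).subset ?_
  rintro ⟨y, s⟩ ⟨hy, hs, hle⟩
  exact ⟨hy, hs.le, (ENNReal.ofReal_le_iff_le_toReal hM).1 (hle.trans (h y hy))⟩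

/-- A Poisson process `Γ` of unit intensity on `Plane × ℝ`, independent of the parents, is
restricted to the region under the graph of the cluster density and projected to the plane. The
region above `B` has volume `Λ B`, and disjoint sets have disjoint regions, so given the parents the
projection is Poisson with intensity `Λ`. -/
theorem exists_annularClusterProcess {α : ℝ} (hp : AdmissibleParams α R δ μ) :
    ∃ (Ω : Type) (_ : MeasurableSpace Ω) (P : Measure Ω) (_ : IsProbabilityMeasure P)
      (Φ : Ω → Measure Plane), IsAnnularClusterProcess P Φ α R δ μ := by
  obtain ⟨-, -, hδ, hR⟩ := hp
  obtain ⟨Ω₁, m₁, P₁, hP₁, Φα, hs₁, hα⟩ := exists_poissonProcess α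
  obtain ⟨Ω₂, m₂, P₂, hP₂, Γ, hs₂, hc₂, hj₂⟩ :=
    exists_poisson_kernel (volume : Measure (Plane × ℝ)) fun B hb => hb.measure_lt_top
  set V := volume (annulus R δ (0 : Plane)) with hV
  have hVinv : ENNReal.ofReal μ * V⁻¹ ≠ ∞ := ENNReal.mul_ne_top ENNReal.ofReal_ne_top
    (ENNReal.inv_ne_top.2 (volume_annulus_ne_zero hδ hR 0))
  set ρ : Ω₁ → Plane → ℝ≥0∞ := fun ω => clusterDensity R δ μ (Φα ω) with hρ
  have hρm : Measurable (Function.uncurry ρ) := by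
    have h1 : MeasurableSet {q : (Ω₁ × Plane) × Plane | q.2 ∈ annulus R δ q.1.2} :=
      (show Measurable fun q : (Ω₁ × Plane) × Plane => (q.1.2, q.2) by fun_prop)
        measurableSet_annulus_prod
    have h2 := Kernel.measurable_kernel_prodMk_left (κ := Φα.prodMkRight Plane) h1
    exact h2.const_mul _
  have hρm' : ∀ ω, Measurable (ρ ω) := fun ω => hρm.comp measurable_prodMk_left
  have hρb : ∀ ω (r : ℝ), ∃ M : ℝ≥0∞, M ≠ ∞ ∧ ∀ y ∈ Metric.closedBall (0 : Plane) r, ρ ω y ≤ M :=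
    fun ω r => ⟨_, ENNReal.mul_ne_top hVinv
      ((hα.1.counting ω).lt_top (Metric.isBounded_closedBall (x := 0))).ne,
      fun y hy => clusterDensity_le hy⟩
  have hρfin : ∀ ω y, ρ ω y ≠ ∞ := fun ω y => by
    obtain ⟨M, hM, h⟩ := hρb ω (dist y 0)
    exact ne_top_of_le_ne_top hM (h y (Metric.mem_closedBall.2 le_rfl))
  have hsub : ∀ ω B, Bornology.IsBounded B → Bornology.IsBounded (subgraph (ρ ω) B) := by
    intro ω B hb
    obtain ⟨r, hr⟩ := hb.subset_closedBall 0
    obtain ⟨M, hM, h⟩ := hρb ω r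
    exact isBounded_subgraph hb hM fun y hy => h y (hr hy)
  set Φ : Ω₁ × Ω₂ → Measure Plane := fun ω =>
    ((Γ ω.2).restrict (subgraph (ρ ω.1) Set.univ)).map Prod.fst with hΦ
  have hΦapply : ∀ ω B, MeasurableSet B → Φ ω B = Γ ω.2 (subgraph (ρ ω.1) B) := by
    intro ω B hB
    rw [hΦ, Measure.map_apply measurable_fst hB, Measure.restrict_apply (measurable_fst hB)]
    congr 1
    ext p
    simp [subgraph]
  have hΦm : Measurable Φ := by
    refine Measure.measurable_of_measurable_coe _ fun B hB => ?_
    simp_rw [hΦapply _ B hB]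
    have h1 : MeasurableSet {q : (Ω₁ × Ω₂) × (Plane × ℝ) | q.2 ∈ subgraph (ρ q.1.1) B} := by
      have e1 : Measurable fun q : (Ω₁ × Ω₂) × (Plane × ℝ) => q.2.1 := by fun_prop
      have e2 : Measurable fun q : (Ω₁ × Ω₂) × (Plane × ℝ) => q.2.2 := by fun_prop
      have e3 : Measurable fun q : (Ω₁ × Ω₂) × (Plane × ℝ) => ρ q.1.1 q.2.1 :=
        hρm.comp (show Measurable fun q : (Ω₁ × Ω₂) × (Plane × ℝ) => (q.1.1, q.2.1) by fun_prop)
      exact (e1 hB).inter ((measurableSet_lt measurable_const e2).inter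
        (measurableSet_le e2.ennreal_ofReal e3))
    exact Kernel.measurable_kernel_prodMk_left (κ := Γ.prodMkLeft Ω₁) h1
  have hpp : IsPointProcess Φ := by
    refine ⟨hΦm, fun ω B hB hb => ?_⟩
    rw [hΦapply ω B hB]
    exact hc₂ _ _ (measurableSet_subgraph (hρm' _) hB) (hsub _ _ hb)
  refine ⟨Ω₁ × Ω₂, inferInstance, P₁.prod P₂, inferInstance, Φ, fun ω => Φα ω.1,
    hα.comp measurePreserving_fst, hpp, ?_, ?_, ?_⟩
  · exact (measurable_clusterIntensity R δ μ).comp (Φα.measurable.comp measurable_fst)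
  · exact fun ω B hb => clusterIntensity_lt_top μ (hα.1.counting _) hb
  · intro G hG k B hB hb hd n
    have hΛ : Measurable fun ω => clusterIntensity R δ μ (Φα ω) :=
      (measurable_clusterIntensity R δ μ).comp Φα.measurable
    have hm : Measurable fun ω => ∏ i,
        poissonMeasure (clusterIntensity R δ μ (Φα ω) (B i)).toNNReal {n i} :=
      Finset.measurable_prod _ fun i _ =>
        (continuous_poissonMeasure_singleton (n i)).measurable.comp
          ((Measure.measurable_coe (hB i)).comp hΛ).ennreal_toNNReal
    have h1 := (measurePreserving_fst (μ := P₁) (ν := P₂)).setLIntegral_comp_preimage (hΛ hG) hm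
    have h2 : (fun ω : Ω₁ × Ω₂ => clusterIntensity R δ μ (Φα ω.1)) ⁻¹' G =
      Prod.fst ⁻¹' ((fun ω => clusterIntensity R δ μ (Φα ω)) ⁻¹' G) := rfl
    have h3 : MeasurableSet {ω : Ω₁ × Ω₂ | clusterIntensity R δ μ (Φα ω.1) ∈ G ∧
        ∀ i, Φ ω (B i) = n i} :=
      ((hΛ.comp measurable_fst) hG).inter (measurableSet_counts_eq hΦm hB n)
    -- Fubini plays the role of conditioning: the parents, hence the density, are fixed and the
    -- joint law of `Γ` is used on the subgraphs.
    rw [h2, h1, ← lintegral_indicator (hΛ hG), Measure.prod_apply h3]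
    refine lintegral_congr fun ω₁ => ?_
    by_cases hω : clusterIntensity R δ μ (Φα ω₁) ∈ G
    · rw [Set.indicator_of_mem (by exact hω)]
      have h3 := hj₂ k (fun i => subgraph (ρ ω₁) (B i))
        (fun i => measurableSet_subgraph (hρm' _) (hB i)) (fun i => hsub _ _ (hb i))
        (fun i j hij => Set.disjoint_left.2 fun p hp hp' =>
          Set.disjoint_left.1 (hd i j hij) hp.1 hp'.1) n
      have h4 : ∀ i, volume (subgraph (ρ ω₁) (B i)) = clusterIntensity R δ μ (Φα ω₁) (B i) := by
        intro i
        have := (hα.1.counting ω₁).sigmaFinite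
        rw [volume_subgraph (hρm' _) (hρfin _) (hB i),
          setLIntegral_clusterDensity hδ.le hR μ _ (hB i)]
      simp_rw [h4] at h3
      rw [← h3]
      congr 1
      ext ω₂
      simp only [Set.mem_preimage, hω, true_and, Set.mem_ofPred_eq]
      exact forall_congr' fun i => by rw [hΦapply _ _ (hB i)]
    · rw [Set.indicator_of_notMem (by exact hω)]
      convert measure_empty (μ := P₂)
      ext ω₂
      simp [hω]

end Existence

/-! ### Square grids -/

section Grid

lemma abs_sub_apply_le_dist (x y : Plane) (i : Fin 2) : |x i - y i| ≤ dist x y := by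
  have := PiLp.norm_apply_le (p := 2) (x - y) i
  rwa [← dist_eq_norm, PiLp.sub_apply, Real.norm_eq_abs] at this

lemma dist_le_abs_add_abs (x y : Plane) : dist x y ≤ |x 0 - y 0| + |x 1 - y 1| := by
  rw [EuclideanSpace.dist_eq, Fin.sum_univ_two, Real.dist_eq, Real.dist_eq]
  refine Real.sqrt_le_iff.2 ⟨by positivity, ?_⟩
  nlinarith [mul_nonneg (abs_nonneg (x 0 - y 0)) (abs_nonneg (x 1 - y 1))]

/-- The index of the cell of the square grid of mesh `s` that contains `x`. -/
noncomputable def cellIndex (s : ℝ) (x : Plane) : ℤ × ℤ := (⌊x 0 / s⌋, ⌊x 1 / s⌋)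

/-- The cells of the square grid of mesh `s`. -/
def cell (s : ℝ) (c : ℤ × ℤ) : Set Plane := {x | cellIndex s x = c}

variable {s : ℝ}

lemma measurable_cellIndex (s : ℝ) : Measurable (cellIndex s) := by
  have h : ∀ i : Fin 2, Measurable fun x : Plane => x i := fun i => by fun_prop
  exact (Int.measurable_floor.comp ((h 0).div_const s)).prodMk
    (Int.measurable_floor.comp ((h 1).div_const s))

lemma measurableSet_cell (s : ℝ) (c : ℤ × ℤ) : MeasurableSet (cell s c) :=
  measurable_cellIndex s (measurableSet_singleton c)

lemma disjoint_cell {c c' : ℤ × ℤ} (h : c ≠ c') : Disjoint (cell s c) (cell s c') := by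
  rw [Set.disjoint_left]
  rintro x rfl hx
  exact h hx

lemma mem_cell_iff (hs : 0 < s) {c : ℤ × ℤ} {x : Plane} : x ∈ cell s c ↔
    (s * c.1 ≤ x 0 ∧ x 0 < s * c.1 + s) ∧ (s * c.2 ≤ x 1 ∧ x 1 < s * c.2 + s) := by
  have h : ∀ (t : ℝ) (n : ℤ), ⌊t / s⌋ = n ↔ s * n ≤ t ∧ t < s * n + s := by
    intro t n
    rw [Int.floor_eq_iff, le_div_iff₀ hs, div_lt_iff₀ hs, mul_comm s, add_mul, one_mul]
  rw [← h, ← h]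
  exact Prod.ext_iff

lemma dist_le_of_mem_cell (hs : 0 < s) {c : ℤ × ℤ} {x y : Plane} (hx : x ∈ cell s c)
    (hy : y ∈ cell s c) : dist x y ≤ 2 * s := by
  rw [mem_cell_iff hs] at hx hy
  refine (dist_le_abs_add_abs x y).trans ?_
  have h0 : |x 0 - y 0| ≤ s := by rw [abs_le]; constructor <;> linarith
  have h1 : |x 1 - y 1| ≤ s := by rw [abs_le]; constructor <;> linarith
  linarith

lemma isBounded_cell (hs : 0 < s) (c : ℤ × ℤ) : Bornology.IsBounded (cell s c) :=
  Metric.isBounded_iff.2 ⟨2 * s, fun _ hx _ hy => dist_le_of_mem_cell hs hx hy⟩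

lemma volume_cell (hs : 0 < s) (c : ℤ × ℤ) : volume (cell s c) = ENNReal.ofReal (s ^ 2) := by
  set a : Fin 2 → ℝ := ![s * c.1, s * c.2] with ha
  have h1 : cell s c = (WithLp.ofLp : Plane → Fin 2 → ℝ) ⁻¹'
      (Set.univ.pi fun i => Set.Ico (a i) (a i + s)) := by
    ext x
    rw [mem_cell_iff hs]
    simp [ha, Set.mem_pi, Fin.forall_fin_two]
  rw [h1, (PiLp.volume_preserving_ofLp (Fin 2)).measure_preimage
    (MeasurableSet.univ_pi fun i => measurableSet_Ico).nullMeasurableSet, Real.volume_pi_Ico]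
  simp only [add_sub_cancel_left, Finset.prod_const, Finset.card_univ, Fintype.card_fin]
  rw [ENNReal.ofReal_pow hs.le]

lemma iUnion_cell (s : ℝ) : ⋃ c, cell s c = Set.univ :=
  Set.eq_univ_of_forall fun x => Set.mem_iUnion.2 ⟨cellIndex s x, rfl⟩

lemma exists_inter_cell_ne_zero {φ : Measure Plane} {A : Set Plane} (h : φ A ≠ 0) (s : ℝ) :
    ∃ c, φ (A ∩ cell s c) ≠ 0 := by
  by_contra hcon
  push Not at hcon
  apply h
  have : A = ⋃ c, A ∩ cell s c := by rw [← Set.inter_iUnion, iUnion_cell, Set.inter_univ]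
  rw [this]
  exact measure_iUnion_null hcon

end Grid

/-! ### Absence of percolation for Poisson processes at small radius -/

section Subcritical

lemma IsCountingMeasure.one_le_of_ne_zero {φ : Measure Plane} (hφ : IsCountingMeasure φ)
    {B : Set Plane} (hB : MeasurableSet B) (hb : Bornology.IsBounded B) (h : φ B ≠ 0) :
    1 ≤ φ B := by
  obtain ⟨n, hn⟩ := hφ B hB hb
  rw [hn] at h ⊢
  exact_mod_cast Nat.one_le_iff_ne_zero.2 (by exact_mod_cast h)

/-- The part of the plane covered by the grains with centres in a given set is closed. -/
lemma isClosed_booleanModel_inter {φ : Measure Plane} (hφ : IsCountingMeasure φ) {W : Set Plane}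
    (hW : MeasurableSet W) (r : ℝ) : IsClosed {y | 1 ≤ φ (Metric.closedBall y r ∩ W)} := by
  refine isClosed_of_closure_subset fun y hy => ?_
  rw [Metric.mem_closure_iff] at hy
  -- A slightly larger ball about the limit point contains the ball of radius `r` about a nearby
  -- covered point; continuity of `φ` from above then brings the radius back to `r`.
  set u : ℕ → ℝ := fun n => r + 1 / (n + 1) with hu
  have hanti : Antitone fun n => Metric.closedBall y (u n) ∩ W := fun n m hnm =>
    Set.inter_subset_inter_left _ (Metric.closedBall_subset_closedBall (by
      simp only [hu]; gcongr))
  have hlim : Filter.Tendsto u Filter.atTop (nhds r) := by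
    simpa [hu] using (tendsto_one_div_add_atTop_nhds_zero_nat (𝕜 := ℝ)).const_add r
  have hinter : ⋂ n, (Metric.closedBall y (u n) ∩ W) = Metric.closedBall y r ∩ W := by
    rw [← Set.iInter_inter]
    congr 1
    ext x
    simp only [Set.mem_iInter, Metric.mem_closedBall]
    exact ⟨fun h => ge_of_tendsto' hlim h, fun h n => h.trans (by simp only [hu]; simp; positivity)⟩
  have ht := tendsto_measure_iInter_atTop (μ := φ) (s := fun n => Metric.closedBall y (u n) ∩ W)
    (fun n => (Metric.isClosed_closedBall.measurableSet.inter hW).nullMeasurableSet) hanti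
    ⟨0, (hφ.lt_top (Metric.isBounded_closedBall.subset Set.inter_subset_left)).ne⟩
  rw [hinter] at ht
  refine ge_of_tendsto' ht fun n => ?_
  obtain ⟨z, hz, hyz⟩ := hy (1 / (n + 1)) (by positivity)
  refine le_trans hz (measure_mono (Set.inter_subset_inter_left _ ?_))
  exact Metric.closedBall_subset_closedBall' (by simp only [hu]; linarith [dist_comm z y])

/-- Cells of the grid that are close and both charged by `φ`. -/
def cellGraph (φ : Measure Plane) (s : ℝ) : SimpleGraph (ℤ × ℤ) where
  Adj c c' := c ≠ c' ∧ (φ (cell s c) ≠ 0 ∧ φ (cell s c') ≠ 0) ∧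
    |c.1 - c'.1| ≤ 2 ∧ |c.2 - c'.2| ≤ 2
  symm := ⟨fun c c' h => ⟨h.1.symm, h.2.1.symm, by rw [abs_sub_comm]; exact h.2.2.1,
    by rw [abs_sub_comm]; exact h.2.2.2⟩⟩
  loopless := ⟨fun _ h => h.1 rfl⟩

lemma abs_floor_sub_floor_le {s t t' : ℝ} (hs : 0 < s) (h : |t - t'| ≤ 2 * s) :
    |⌊t / s⌋ - ⌊t' / s⌋| ≤ 2 := by
  have key : ∀ t t' : ℝ, t - t' ≤ 2 * s → ⌊t / s⌋ - ⌊t' / s⌋ ≤ 2 := by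
    intro t t' h
    have h1 : t / s ≤ t' / s + (2 : ℤ) := by
      rw [div_add' _ _ _ hs.ne', div_le_div_iff_of_pos_right hs]
      push_cast
      linarith
    have h2 := Int.floor_mono h1
    rw [Int.floor_add_intCast] at h2
    omega
  rw [abs_le] at h ⊢
  exact ⟨by linarith [key t' t (by linarith [h.1])], key t t' h.2⟩

/-- Two points of `φ` covering the same `y` lie in equal or adjacent charged cells, as `r ≤ s`. A
connected covered set therefore sees a single component of the cell graph, and unboundedness forces
long self-avoiding paths in it. -/
lemma exists_path_of_percolates {φ : Measure Plane} (hφ : IsCountingMeasure φ) {r s : ℝ}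
    (hs : 0 < s) (hrs : r ≤ s) (h : Percolates (booleanModel φ r)) :
    ∃ c₀ : ℤ × ℤ, ∀ n : ℕ, ∃ f : Fin (n + 1) → ℤ × ℤ, Function.Injective f ∧ f 0 = c₀ ∧
      (∀ i : Fin n, |(f i.succ - f i.castSucc).1| ≤ 2 ∧ |(f i.succ - f i.castSucc).2| ≤ 2) ∧
      ∀ i, φ (cell s (f i)) ≠ 0 := by
  obtain ⟨S, hSA, hSc, hSb⟩ := h
  set G := cellGraph φ s with hG
  have hnear : ∀ y ∈ S, ∃ c, φ (Metric.closedBall y r ∩ cell s c) ≠ 0 := fun y hy =>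
    exists_inter_cell_ne_zero (zero_lt_one.trans_le (hSA hy)).ne' s
  have hact : ∀ {y c}, φ (Metric.closedBall y r ∩ cell s c) ≠ 0 → φ (cell s c) ≠ 0 :=
    fun {y c} h h0 => h (measure_mono_null Set.inter_subset_right h0)
  have hclose : ∀ {y c c'}, φ (Metric.closedBall y r ∩ cell s c) ≠ 0 →
      φ (Metric.closedBall y r ∩ cell s c') ≠ 0 → G.Reachable c c' := by
    intro y c c' h h'
    rcases eq_or_ne c c' with rfl | hne
    · exact SimpleGraph.Reachable.refl _
    refine SimpleGraph.Adj.reachable ⟨hne, ⟨hact h, hact h'⟩, ?_⟩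
    obtain ⟨x, hx, rfl⟩ := nonempty_of_measure_ne_zero h
    obtain ⟨x', hx', rfl⟩ := nonempty_of_measure_ne_zero h'
    rw [Metric.mem_closedBall] at hx hx'
    have hd : dist x x' ≤ 2 * s := by linarith [dist_triangle_right x x' y]
    exact ⟨abs_floor_sub_floor_le hs ((abs_sub_apply_le_dist x x' 0).trans hd),
      abs_floor_sub_floor_le hs ((abs_sub_apply_le_dist x x' 1).trans hd)⟩
  obtain ⟨y₀, hy₀⟩ := hSc.nonempty
  obtain ⟨c₀, hc₀⟩ := hnear y₀ hy₀
  -- Cells reachable from `c₀` and the remaining cells cover `S` by two closed sets. If both met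
  -- `S`, connectedness would give a point near a cell of each kind, and these two cells would be
  -- adjacent.
  have hall : ∀ y ∈ S, ∃ c, G.Reachable c₀ c ∧ φ (Metric.closedBall y r ∩ cell s c) ≠ 0 := by
    set W : Set (ℤ × ℤ) → Set Plane := fun V => ⋃ c ∈ V, cell s c with hW
    have hWm : ∀ V, MeasurableSet (W V) := fun V =>
      MeasurableSet.biUnion V.to_countable fun c _ => measurableSet_cell s c
    have hW1 : ∀ V y c, c ∈ V → φ (Metric.closedBall y r ∩ cell s c) ≠ 0 →
        1 ≤ φ (Metric.closedBall y r ∩ W V) := by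
      intro V y c hc h
      refine hφ.one_le_of_ne_zero (Metric.isClosed_closedBall.measurableSet.inter (hWm V))
        (Metric.isBounded_closedBall.subset Set.inter_subset_left) fun h0 => h ?_
      exact measure_mono_null (Set.inter_subset_inter_right _ (Set.subset_biUnion_of_mem hc)) h0
    have hW2 : ∀ V y, 1 ≤ φ (Metric.closedBall y r ∩ W V) → ∃ c ∈ V,
        φ (Metric.closedBall y r ∩ cell s c) ≠ 0 := by
      intro V y h
      obtain ⟨c, hc⟩ := exists_inter_cell_ne_zero (zero_lt_one.trans_le h).ne' s
      refine ⟨c, ?_, fun h0 => hc (measure_mono_null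
        (Set.inter_subset_inter_left _ Set.inter_subset_left) h0)⟩
      obtain ⟨x, ⟨-, hx⟩, hxc⟩ := nonempty_of_measure_ne_zero hc
      simp only [hW, Set.mem_iUnion, exists_prop] at hx
      obtain ⟨c', hc', hxc'⟩ := hx
      have : c = c' := hxc.symm.trans hxc'
      exact this ▸ hc'
    set V : Set (ℤ × ℤ) := {c | G.Reachable c₀ c} with hV
    by_contra hcon
    push Not at hcon
    obtain ⟨y₁, hy₁, hno⟩ := hcon
    obtain ⟨c₁, hc₁⟩ := hnear y₁ hy₁
    have hc₁V : c₁ ∈ Vᶜ := fun h => hc₁ (hno c₁ h)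
    obtain ⟨y, hy, hy1, hy2⟩ := isPreconnected_closed_iff.1 hSc.isPreconnected _ _
      (isClosed_booleanModel_inter hφ (hWm V) r) (isClosed_booleanModel_inter hφ (hWm Vᶜ) r)
      (fun y hy => by
        obtain ⟨c, hc⟩ := hnear y hy
        by_cases hcV : c ∈ V
        · exact Or.inl (hW1 _ _ c hcV hc)
        · exact Or.inr (hW1 _ _ c hcV hc))
      ⟨y₀, hy₀, hW1 V y₀ c₀ (SimpleGraph.Reachable.refl _) hc₀⟩
      ⟨y₁, hy₁, hW1 Vᶜ y₁ c₁ hc₁V hc₁⟩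
    obtain ⟨c, hcV, hc⟩ := hW2 _ _ hy1
    obtain ⟨c', hcV', hc'⟩ := hW2 _ _ hy2
    exact hcV' (SimpleGraph.Reachable.trans hcV (hclose hc hc'))
  have hstep : ∀ {c c'} (p : G.Walk c c'), |c'.1 - c.1| ≤ 2 * p.length ∧
      |c'.2 - c.2| ≤ 2 * p.length := by
    intro c c' p
    induction p with
    | nil => simp
    | cons hadj p ih =>
      have h1 := hadj.2.2.1
      have h2 := hadj.2.2.2
      rw [SimpleGraph.Walk.length_cons]
      push_cast
      rw [abs_le] at h1 h2
      rw [abs_le, abs_le] at ih ⊢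
      omega
  refine ⟨c₀, fun n => ?_⟩
  -- If all paths from `c₀` were shorter than `n`, all reachable cells would be within `2 * n` of
  -- `c₀` in each coordinate and `S` would be bounded.
  have hlong : ∃ c, ∃ p : G.Walk c₀ c, p.IsPath ∧ n ≤ p.length := by
    by_contra hcon
    push Not at hcon
    apply hSb
    refine (Metric.isBounded_closedBall (x := (0 : Plane))
      (r := r + (s * (|(c₀.1 : ℝ)| + 2 * n) + s) + (s * (|(c₀.2 : ℝ)| + 2 * n) + s))).subset ?_
    intro y hy
    obtain ⟨c, ⟨hc, hyc⟩⟩ := hall y hy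
    obtain ⟨p, hp⟩ := hc.exists_isPath
    have hlen := hcon c p hp
    obtain ⟨h1, h2⟩ := hstep p
    obtain ⟨x, hx, hxc⟩ := nonempty_of_measure_ne_zero hyc
    rw [mem_cell_iff hs] at hxc
    rw [Metric.mem_closedBall] at hx ⊢
    have hb : ∀ (a b : ℤ) (t : ℝ), |a - b| ≤ 2 * (p.length : ℤ) → s * a ≤ t → t < s * a + s →
        |t| ≤ s * (|(b : ℝ)| + 2 * n) + s := by
      intro a b t hab h1 h2
      have h3 : |(a : ℝ) - b| ≤ 2 * n := by
        have : |a - b| ≤ 2 * (n : ℤ) := hab.trans (by omega)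
        exact_mod_cast this
      have h4 : |(a : ℝ)| ≤ |(b : ℝ)| + 2 * n := by
        linarith [abs_sub_abs_le_abs_sub (a : ℝ) b]
      have h5 : s * |(a : ℝ)| ≤ s * (|(b : ℝ)| + 2 * n) := by gcongr
      have h6 : |s * (a : ℝ)| = s * |(a : ℝ)| := by rw [abs_mul, abs_of_pos hs]
      rw [abs_le]
      constructor
      · linarith [neg_abs_le (s * (a : ℝ))]
      · linarith [le_abs_self (s * (a : ℝ))]
    have hx0 := hb _ _ _ h1 hxc.1.1 hxc.1.2
    have hx1 := hb _ _ _ h2 hxc.2.1 hxc.2.2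
    have hx' := dist_le_abs_add_abs x 0
    simp only [PiLp.zero_apply, sub_zero] at hx'
    rw [dist_comm x y] at hx
    linarith [dist_triangle y x 0]
  obtain ⟨c, p, hp, hn⟩ := hlong
  refine ⟨fun i => p.getVert i, fun i j hij => ?_, by simp, fun i => ?_, fun i => ?_⟩
  · have hi := i.2
    have hj := j.2
    exact Fin.ext (hp.getVert_injOn (show (i : ℕ) ≤ p.length by omega)
      (show (j : ℕ) ≤ p.length by omega) hij)
  · have hadj := p.adj_getVert_succ (i := i) (by have := i.2; omega)
    obtain ⟨-, -, h1, h2⟩ := hadj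
    rw [abs_sub_comm] at h1 h2
    exact ⟨h1, h2⟩
  · rcases Fin.eq_zero_or_eq_succ i with rfl | ⟨j, rfl⟩
    · simpa using hact hc₀
    · have hadj := p.adj_getVert_succ (i := j) (by have := j.2; omega)
      exact hadj.2.1.2

variable {Ω : Type u} [MeasurableSpace Ω] {P : Measure Ω} {Φ : Ω → Measure Plane} {a : ℝ}

/-- Markov's inequality. -/
lemma poissonMeasure_ne_zero_le (t : ℝ≥0) : poissonMeasure t {0}ᶜ ≤ t := by
  rw [← lintegral_poissonMeasure_id t]
  have h := mul_meas_ge_le_lintegral (μ := poissonMeasure t) (f := fun n : ℕ => (n : ℝ≥0∞))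
    .of_discrete 1
  rw [one_mul] at h
  refine (measure_mono fun n hn => ?_).trans h
  have : 1 ≤ n := Nat.one_le_iff_ne_zero.2 hn
  exact_mod_cast this

lemma IsPoissonProcess.measure_forall_ne_zero_le (h : IsPoissonProcess P Φ a) {ι : Type*}
    [Fintype ι] {B : ι → Set Plane} (hB : ∀ i, MeasurableSet (B i))
    (hb : ∀ i, Bornology.IsBounded (B i)) (hd : Pairwise fun i j => Disjoint (B i) (B j)) :
    P {ω | ∀ i, Φ ω (B i) ≠ 0} ≤ ∏ i, (ENNReal.ofReal a * volume (B i)) := by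
  have hset : {ω | ∀ i, Φ ω (B i) ≠ 0} =
      (fun ω => countVec (Φ ω) B) ⁻¹' Set.univ.pi fun _ => {0}ᶜ := by
    ext ω
    simp only [Set.mem_ofPred_eq, Set.mem_preimage, Set.mem_pi, Set.mem_univ, true_imp_iff,
      Set.mem_compl_iff, Set.mem_singleton_iff]
    refine forall_congr' fun i => ?_
    rw [← (h.1.counting ω).coe_countVec (hB i) (hb i)]
    simp
  rw [hset, ← Measure.map_apply (measurable_countVec h.1.measurable hB) .of_discrete,
    h.map_countVec hB hb hd, poissonVec, Measure.pi_pi]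
  refine Finset.prod_le_prod' fun i _ => (poissonMeasure_ne_zero_le _).trans ?_
  exact ENNReal.coe_toNNReal_le_self

open Filter Topology in
/-- The Boolean model over a Poisson process with small grains does not percolate. -/
theorem IsPoissonProcess.measure_percolates_eq_zero (h : IsPoissonProcess P Φ a) {r s : ℝ}
    (hs : 0 < s) (hrs : r ≤ s) (ha : a * s ^ 2 ≤ 1 / 50) :
    P {ω | Percolates (booleanModel (Φ ω) r)} = 0 := by
  classical
  set D : Finset (ℤ × ℤ) := Finset.Icc (-2) 2 ×ˢ Finset.Icc (-2) 2 with hD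
  set A : ℤ × ℤ → ℕ → Set Ω := fun c₀ n => {ω | ∃ f : Fin (n + 1) → ℤ × ℤ,
      Function.Injective f ∧ f 0 = c₀ ∧
      (∀ i : Fin n, |(f i.succ - f i.castSucc).1| ≤ 2 ∧ |(f i.succ - f i.castSucc).2| ≤ 2) ∧
      ∀ i, Φ ω (cell s (f i)) ≠ 0} with hA
  have hsub : {ω | Percolates (booleanModel (Φ ω) r)} ⊆ ⋃ c₀, ⋂ n, A c₀ n := by
    intro ω hω
    obtain ⟨c₀, hc₀⟩ := exists_path_of_percolates (h.1.counting ω) hs hrs hω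
    exact Set.mem_iUnion.2 ⟨c₀, Set.mem_iInter.2 hc₀⟩
  set q : ℝ≥0∞ := ENNReal.ofReal (a * s ^ 2) with hq
  have hq25 : 25 * q ≤ 1 / 2 := by
    calc 25 * q ≤ 25 * ENNReal.ofReal (1 / 50) := mul_le_mul_right (ENNReal.ofReal_le_ofReal ha) _
      _ = ENNReal.ofReal (25 * (1 / 50)) := by
        rw [ENNReal.ofReal_mul (by norm_num)]; simp
      _ = 1 / 2 := by
        rw [show (25 : ℝ) * (1 / 50) = 2⁻¹ by norm_num, ENNReal.ofReal_inv_of_pos (by norm_num)]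
        simp
  have hbound : ∀ c₀ n, P (A c₀ n) ≤ 25 ^ n * q ^ (n + 1) := by
    intro c₀ n
    -- A path is encoded by its `n` steps, each one of the `25` vectors of `D`. Only words whose
    -- path is self-avoiding matter, and for these the `n + 1` cells are disjoint, hence
    -- independent.
    set F : (Fin n → D) → Fin (n + 1) → ℤ × ℤ := fun w i =>
      c₀ + Fin.partialSum (fun j => (w j : ℤ × ℤ)) i with hF
    have hcover : A c₀ n ⊆ ⋃ w : Fin n → D,
        {ω | Function.Injective (F w) ∧ ∀ i, Φ ω (cell s (F w i)) ≠ 0} := by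
      rintro ω ⟨f, hf, hf0, hstep, hact⟩
      refine Set.mem_iUnion.2 ⟨fun j => ⟨f j.succ - f j.castSucc, ?_⟩, ?_⟩
      · rw [hD, Finset.mem_product, Finset.mem_Icc, Finset.mem_Icc, ← abs_le, ← abs_le]
        exact hstep j
      · have hfF : F (fun j => ⟨f j.succ - f j.castSucc, by
            rw [hD, Finset.mem_product, Finset.mem_Icc, Finset.mem_Icc, ← abs_le, ← abs_le]
            exact hstep j⟩) = f := by
          funext i
          induction i using Fin.induction with
          | zero => simp [hF, hf0]
          | succ i ih =>
            simp only [hF] at ih ⊢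
            rw [Fin.partialSum_succ, ← add_assoc, ih]
            abel
        rw [Set.mem_ofPred_eq, hfF]
        exact ⟨hf, hact⟩
    refine (measure_mono hcover).trans ((measure_iUnion_fintype_le _ _).trans ?_)
    have hone : ∀ w : Fin n → D, P {ω | Function.Injective (F w) ∧
        ∀ i, Φ ω (cell s (F w i)) ≠ 0} ≤ q ^ (n + 1) := by
      intro w
      by_cases hw : Function.Injective (F w)
      · simp only [hw, true_and]
        refine (h.measure_forall_ne_zero_le (fun i => measurableSet_cell s (F w i))
          (fun i => isBounded_cell hs _) fun i j hij => disjoint_cell (hw.ne hij)).trans ?_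
        simp only [volume_cell hs]
        rw [← ENNReal.ofReal_mul' (by positivity)]
        simp [hq]
      · simp [hw]
    refine (Finset.sum_le_sum fun w _ => hone w).trans ?_
    rw [Finset.sum_const, Finset.card_univ, nsmul_eq_mul, Fintype.card_fun, Fintype.card_coe]
    have : D.card = 25 := by rw [hD]; rfl
    rw [this, Fintype.card_fin]
    push_cast
    exact le_rfl
  refine measure_mono_null hsub (measure_iUnion_null fun c₀ => ?_)
  have hle : ∀ n, P (⋂ n, A c₀ n) ≤ (1 / 2) ^ n * q := fun n => by
    refine (measure_mono (Set.iInter_subset _ n)).trans ((hbound c₀ n).trans ?_)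
    rw [pow_succ, ← mul_assoc, ← mul_pow]
    gcongr
  have hlim : Tendsto (fun n : ℕ => (1 / 2 : ℝ≥0∞) ^ n * q) atTop (𝓝 (0 * q)) :=
    ENNReal.Tendsto.mul_const (ENNReal.tendsto_pow_atTop_nhds_zero_of_lt_one (by simp))
      (Or.inr ENNReal.ofReal_ne_top)
  rw [zero_mul] at hlim
  exact le_antisymm (ge_of_tendsto' hlim hle) zero_le

theorem IsPoissonProcess.criticalRadius_pos (h : IsPoissonProcess P Φ a) (ha : 0 < a) :
    0 < criticalRadius P Φ := by
  -- Chosen so that `a * s ^ 2 = 1 / 50`; the `25` steps then give a ratio of at most `1 / 2`.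
  set s : ℝ := 1 / Real.sqrt (50 * a) with hs
  have hs0 : 0 < s := by positivity
  have has : a * s ^ 2 ≤ 1 / 50 := by
    rw [hs, div_pow, Real.sq_sqrt (by positivity)]
    field_simp
    norm_num
  refine lt_of_lt_of_le (b := ENNReal.ofReal s) (by simpa using hs0) (le_sInf ?_)
  rintro _ ⟨r, rfl, hr⟩
  by_contra hlt
  rw [not_le] at hlt
  have hrs : (r : ℝ) ≤ s := by
    have := hlt.le
    rw [← ENNReal.ofReal_coe_nnreal] at this
    exact (ENNReal.ofReal_le_ofReal_iff hs0.le).1 this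
  exact hr.ne' (h.measure_percolates_eq_zero hs0 hrs has)

end Subcritical

/-! ### Hierarchical blocks: connectivity and probability -/

section Hierarchy

/-- The sub-blocks of the block `b`, in coordinates of the finer level. -/
def subBlock (b : ℕ × ℕ) (d : Fin 3 × Fin 3) : ℕ × ℕ := (3 * b.1 + d.1, 3 * b.2 + d.2)

/-- A block of level `0` is good if it is not in `bad`; a block of level `k + 1` is good if at most
one of its nine sub-blocks of level `k` is not good. -/
def goodBlock (bad : Set (ℕ × ℕ)) : ℕ → ℕ × ℕ → Prop
  | 0, b => b ∉ bad
  | k + 1, b => ∀ d d', ¬ goodBlock bad k (subBlock b d) → ¬ goodBlock bad k (subBlock b d') →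
      d = d'

lemma subBlock_injective : Function.Injective fun p : (ℕ × ℕ) × (Fin 3 × Fin 3) =>
    subBlock p.1 p.2 := by
  rintro ⟨⟨b₁, b₂⟩, ⟨d₁, d₂⟩⟩ ⟨⟨c₁, c₂⟩, ⟨e₁, e₂⟩⟩ h
  simp only [subBlock, Prod.mk.injEq] at h ⊢
  obtain ⟨h1, h2⟩ := h
  refine ⟨⟨by omega, by omega⟩, Fin.ext (by omega), Fin.ext (by omega)⟩

section Deterministic

variable {X : Type*} [TopologicalSpace X] {bad : Set (ℕ × ℕ)} {K : ℕ × ℕ → Set X}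

/-- The union of the sets attached to the good sites of a block which are reached through good
sub-blocks at all levels. -/
def blockSet (bad : Set (ℕ × ℕ)) (K : ℕ × ℕ → Set X) : ℕ → ℕ × ℕ → Set X
  | 0, b => K b
  | k + 1, b => ⋃ d ∈ {d | goodBlock bad k (subBlock b d)}, blockSet bad K k (subBlock b d)

open Relation in
lemma reflTransGen_fin_three {r : Fin 3 → Fin 3 → Prop} (hs : ∀ i j, r i j → r j i) (h01 : r 0 1)
    (h12 : r 1 2) (i j : Fin 3) : ReflTransGen r i j := by
  have h10 := hs _ _ h01
  have h21 := hs _ _ h12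
  have h02 : ReflTransGen r 0 2 := (ReflTransGen.single h01).tail h12
  have h20 : ReflTransGen r 2 0 := (ReflTransGen.single h21).tail h10
  fin_cases i <;> fin_cases j <;>
    first
      | exact ReflTransGen.refl
      | exact ReflTransGen.single (by assumption)
      | assumption

open Relation in
/-- The grid `3 × 3` remains connected when a point is removed. -/
lemma reflTransGen_grid {good : Set (Fin 3 × Fin 3)} {r : Fin 3 × Fin 3 → Fin 3 × Fin 3 → Prop}
    (hone : ∀ d d', d ∉ good → d' ∉ good → d = d') (hs : ∀ d d', r d d' → r d' d)
    (hrow : ∀ i : Fin 3, ∀ j j' : Fin 3, (j : ℕ) + 1 = j' → (i, j) ∈ good → (i, j') ∈ good →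
      r (i, j) (i, j'))
    (hcol : ∀ i i' j : Fin 3, (i : ℕ) + 1 = (i' : ℕ) → (i, j) ∈ good → (i', j) ∈ good →
      r (i, j) (i', j)) {d d' : Fin 3 × Fin 3} (hd : d ∈ good) (hd' : d' ∈ good) :
    ReflTransGen r d d' := by
  -- `e` is the missing point, or an arbitrary one if nothing is missing. Rows and columns avoiding
  -- `e` are entirely good, and every good point is joined to the crossing `(i₀, j₀)` of such a row
  -- and column.
  obtain ⟨e, he⟩ : ∃ e : Fin 3 × Fin 3, ∀ d, d ≠ e → d ∈ good := by
    by_cases h : ∃ e, e ∉ good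
    · obtain ⟨e, he⟩ := h
      exact ⟨e, fun d hde => by by_contra hcon; exact hde (hone d e hcon he)⟩
    · push Not at h
      exact ⟨0, fun d _ => h d⟩
  have rowfull : ∀ i, i ≠ e.1 → ∀ j j', ReflTransGen r (i, j) (i, j') := by
    intro i hi j j'
    have hg : ∀ j, (i, j) ∈ good := fun j => he _ fun h => hi (congrArg Prod.fst h)
    refine ReflTransGen.lift (fun j => (i, j)) (fun _ _ h => h) _ _
      (reflTransGen_fin_three (r := fun j j' => r (i, j) (i, j')) (fun _ _ h => hs _ _ h)
      (hrow i 0 1 rfl (hg _) (hg _)) (hrow i 1 2 rfl (hg _) (hg _)) j j')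
  have colfull : ∀ j, j ≠ e.2 → ∀ i i', ReflTransGen r (i, j) (i', j) := by
    intro j hj i i'
    have hg : ∀ i, (i, j) ∈ good := fun i => he _ fun h => hj (congrArg Prod.snd h)
    refine ReflTransGen.lift (fun i => (i, j)) (fun _ _ h => h) _ _
      (reflTransGen_fin_three (r := fun i i' => r (i, j) (i', j)) (fun _ _ h => hs _ _ h)
      (hcol 0 1 j rfl (hg _) (hg _)) (hcol 1 2 j rfl (hg _) (hg _)) i i')
  obtain ⟨i₀, hi₀⟩ : ∃ i : Fin 3, i ≠ e.1 := exists_ne _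
  obtain ⟨j₀, hj₀⟩ : ∃ j : Fin 3, j ≠ e.2 := exists_ne _
  have hub : ∀ d ∈ good, ReflTransGen r d (i₀, j₀) := by
    rintro ⟨i, j⟩ hd
    by_cases hi : i = e.1
    · by_cases hj : j = e.2
      · by_cases hall : ∀ d, d ∈ good
        · have row : ∀ i j j', ReflTransGen r (i, j) (i, j') := fun i j j' =>
            ReflTransGen.lift (fun j => (i, j)) (fun _ _ h => h) _ _
              (reflTransGen_fin_three (r := fun j j' => r (i, j) (i, j')) (fun _ _ h => hs _ _ h)
              (hrow i 0 1 rfl (hall _) (hall _)) (hrow i 1 2 rfl (hall _) (hall _)) j j')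
          exact (row i j j₀).trans (colfull j₀ hj₀ i i₀)
        · push Not at hall
          obtain ⟨e', he'⟩ := hall
          have h1 : e' = e := by by_contra hne; exact he' (he _ hne)
          have h2 : ((i, j) : Fin 3 × Fin 3) = e := Prod.ext hi hj
          exact absurd hd (by rw [h2, ← h1]; exact he')
      · exact (colfull j hj i i₀).trans (rowfull i₀ hi₀ j j₀)
    · exact (rowfull i hi j j₀).trans (colfull j₀ hj₀ i i₀)
  have : Std.Symm r := ⟨hs⟩
  have hsymm : ∀ x y, ReflTransGen r x y → ReflTransGen r y x :=
    (ReflTransGen.stdSymm (r := r)).symm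
  exact (hub d hd).trans (hsymm _ _ (hub d' hd'))

/-- Sites next to each other. -/
def IsNext (b b' : ℕ × ℕ) : Prop := b' = (b.1 + 1, b.2) ∨ b' = (b.1, b.2 + 1)

lemma isNext_subBlock_row (b : ℕ × ℕ) (i : Fin 3) {j j' : Fin 3} (h : (j : ℕ) + 1 = j') :
    IsNext (subBlock b (i, j)) (subBlock b (i, j')) := by
  right
  simp only [subBlock, Prod.mk.injEq, true_and]
  omega

lemma isNext_subBlock_col (b : ℕ × ℕ) {i i' : Fin 3} (j : Fin 3) (h : (i : ℕ) + 1 = i') :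
    IsNext (subBlock b (i, j)) (subBlock b (i', j)) := by
  left
  simp only [subBlock, Prod.mk.injEq, and_true]
  omega

/-- Each predicate excludes at most one of three indices. It is applied to the three facing pairs of
sub-blocks along the common side of neighbouring blocks. -/
lemma exists_good_pair {p p' : Fin 3 → Prop} (h : ∀ i j, ¬ p i → ¬ p j → i = j)
    (h' : ∀ i j, ¬ p' i → ¬ p' j → i = j) : ∃ j, p j ∧ p' j := by
  by_contra hcon
  push Not at hcon
  have h01 : (0 : Fin 3) ≠ 1 := by decide
  have h02 : (0 : Fin 3) ≠ 2 := by decide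
  have h12 : (1 : Fin 3) ≠ 2 := by decide
  have n01 := fun a b => h01 (h 0 1 a b)
  have n02 := fun a b => h02 (h 0 2 a b)
  have n12 := fun a b => h12 (h 1 2 a b)
  have n01' := fun a b => h01 (h' 0 1 a b)
  have n02' := fun a b => h02 (h' 0 2 a b)
  have n12' := fun a b => h12 (h' 1 2 a b)
  have c0 := hcon 0
  have c1 := hcon 1
  have c2 := hcon 2
  tauto

lemma exists_good_subBlock_pair {k : ℕ} {b b' : ℕ × ℕ} (hn : IsNext b b')
    (hb : goodBlock bad (k + 1) b) (hb' : goodBlock bad (k + 1) b') :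
    ∃ d d', goodBlock bad k (subBlock b d) ∧ goodBlock bad k (subBlock b' d') ∧
      IsNext (subBlock b d) (subBlock b' d') := by
  rcases hn with rfl | rfl
  · obtain ⟨j, h1, h2⟩ := exists_good_pair
      (p := fun j => goodBlock bad k (subBlock b (2, j)))
      (p' := fun j => goodBlock bad k (subBlock (b.1 + 1, b.2) (0, j)))
      (fun i j hi hj => (Prod.ext_iff.1 (hb _ _ hi hj)).2)
      (fun i j hi hj => (Prod.ext_iff.1 (hb' _ _ hi hj)).2)
    refine ⟨_, _, h1, h2, Or.inl ?_⟩
    simp only [subBlock, Prod.mk.injEq]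
    refine ⟨?_, trivial⟩
    change 3 * (b.1 + 1) + 0 = 3 * b.1 + 2 + 1
    ring
  · obtain ⟨j, h1, h2⟩ := exists_good_pair
      (p := fun j => goodBlock bad k (subBlock b (j, 2)))
      (p' := fun j => goodBlock bad k (subBlock (b.1, b.2 + 1) (j, 0)))
      (fun i j hi hj => (Prod.ext_iff.1 (hb _ _ hi hj)).1)
      (fun i j hi hj => (Prod.ext_iff.1 (hb' _ _ hi hj)).1)
    refine ⟨_, _, h1, h2, Or.inr ?_⟩
    simp only [subBlock, Prod.mk.injEq]
    refine ⟨trivial, ?_⟩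
    change 3 * (b.2 + 1) + 0 = 3 * b.2 + 2 + 1
    ring

/-- The last column is singled out so that, starting from the block at the origin, the first
coordinate becomes positive and good sites far away are reached. -/
lemma exists_good_subBlock_right {k : ℕ} {b : ℕ × ℕ} (hb : goodBlock bad (k + 1) b) :
    ∃ d : Fin 3 × Fin 3, d.1 = 2 ∧ goodBlock bad k (subBlock b d) := by
  by_contra hcon
  push Not at hcon
  have := hb (2, 0) (2, 1) (hcon _ rfl) (hcon _ rfl)
  simp at this

/-- The two claims are proved together: a block is connected because its good sub-blocks meet along
the punctured `3 × 3` grid, and neighbouring blocks meet through a facing pair of good sub-blocks.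
-/
lemma blockSet_connected_and_meets (hK : ∀ b ∉ bad, IsConnected (K b))
    (hKn : ∀ b b', b ∉ bad → b' ∉ bad → IsNext b b' → (K b ∩ K b').Nonempty) (k : ℕ) :
    (∀ b, goodBlock bad k b → IsConnected (blockSet bad K k b)) ∧
    ∀ b b', goodBlock bad k b → goodBlock bad k b' → IsNext b b' →
      (blockSet bad K k b ∩ blockSet bad K k b').Nonempty := by
  induction k with
  | zero => exact ⟨hK, hKn⟩
  | succ k ih =>
    obtain ⟨ih1, ih2⟩ := ih
    refine ⟨fun b hb => ?_, fun b b' hb hb' hn => ?_⟩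
    · refine ⟨?_, ?_⟩
      · obtain ⟨d, -, hd⟩ := exists_good_subBlock_right hb
        obtain ⟨x, hx⟩ := (ih1 _ hd).nonempty
        exact ⟨x, Set.mem_biUnion (show d ∈ {d | goodBlock bad k (subBlock b d)} from hd) hx⟩
      · refine IsPreconnected.biUnion_of_reflTransGen (fun d hd => (ih1 _ hd).isPreconnected)
          fun d hd d' hd' => ?_
        have hgrid := reflTransGen_grid (good := {d | goodBlock bad k (subBlock b d)})
          (r := fun d d' => ((blockSet bad K k (subBlock b d) ∩
            blockSet bad K k (subBlock b d')).Nonempty ∧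
              goodBlock bad k (subBlock b d)) ∧ goodBlock bad k (subBlock b d'))
          hb (fun d d' h => ⟨⟨by rw [Set.inter_comm]; exact h.1.1, h.2⟩, h.1.2⟩)
          (fun i j j' h hg hg' => ⟨⟨ih2 _ _ hg hg' (isNext_subBlock_row b i h), hg⟩, hg'⟩)
          (fun i i' j h hg hg' => ⟨⟨ih2 _ _ hg hg' (isNext_subBlock_col b j h), hg⟩, hg'⟩)
          hd hd'
        exact Relation.ReflTransGen.mono (fun _ _ h => h.1) _ _ hgrid
    · obtain ⟨d, d', hd, hd', hdd⟩ := exists_good_subBlock_pair hn hb hb'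
      obtain ⟨x, hx, hx'⟩ := ih2 _ _ hd hd' hdd
      exact ⟨x, Set.mem_biUnion (show d ∈ {d | goodBlock bad k (subBlock b d)} from hd) hx,
        Set.mem_biUnion (show d' ∈ {d | goodBlock bad k (subBlock b' d)} from hd') hx'⟩

omit [TopologicalSpace X] in
lemma blockSet_subset {A : Set X} (hKA : ∀ b ∉ bad, K b ⊆ A) (k : ℕ) :
    ∀ b, goodBlock bad k b → blockSet bad K k b ⊆ A := by
  induction k with
  | zero => exact hKA
  | succ k ih => exact fun b _ => Set.iUnion₂_subset fun d hd => ih _ hd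

omit [TopologicalSpace X] in
lemma exists_site_in_blockSet (k : ℕ) : ∀ b, goodBlock bad k b →
    ∃ b' ∉ bad, 3 ^ k * b.1 ≤ b'.1 ∧ K b' ⊆ blockSet bad K k b := by
  induction k with
  | zero => exact fun b hb => ⟨b, hb, by simp, subset_rfl⟩
  | succ k ih =>
    intro b hb
    obtain ⟨d, -, hd⟩ := exists_good_subBlock_right hb
    obtain ⟨b', hb', hle, hsub⟩ := ih _ hd
    refine ⟨b', hb', le_trans ?_ hle, hsub.trans (Set.subset_biUnion_of_mem
      (u := fun d => blockSet bad K k (subBlock b d)) hd)⟩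
    rw [pow_succ, mul_assoc]
    exact Nat.mul_le_mul_left _ (Nat.le_add_right _ _)

/-- If the blocks of all levels at the origin are good, the sets of good sites contain a connected
set that meets sets of good sites arbitrarily far away. -/
lemma exists_isConnected_of_goodBlock (hK : ∀ b ∉ bad, IsConnected (K b))
    (hKn : ∀ b b', b ∉ bad → b' ∉ bad → IsNext b b' → (K b ∩ K b').Nonempty)
    {A : Set X} (hKA : ∀ b ∉ bad, K b ⊆ A) (h : ∀ k, goodBlock bad k 0) :
    ∃ S ⊆ A, IsConnected S ∧ ∀ N : ℕ, ∃ b ∉ bad, N ≤ b.1 ∧ K b ⊆ S := by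
  have h00 : subBlock 0 0 = 0 := rfl
  have hmono : ∀ k, blockSet bad K k 0 ⊆ blockSet bad K (k + 1) 0 := fun k =>
    Set.subset_biUnion_of_mem (u := fun d => blockSet bad K k (subBlock 0 d))
      (show (0 : Fin 3 × Fin 3) ∈ {d | goodBlock bad k (subBlock 0 d)} from h k)
  have hc := fun k => (blockSet_connected_and_meets hK hKn k).1 0 (h k)
  refine ⟨⋃ k, blockSet bad K k 0, Set.iUnion_subset fun k => blockSet_subset hKA k 0 (h k),
    IsConnected.iUnion_of_chain hc fun k => ?_, fun N => ?_⟩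
  · obtain ⟨x, hx⟩ := (hc k).nonempty
    exact ⟨x, hx, hmono k hx⟩
  · obtain ⟨d, hd2, hd⟩ := exists_good_subBlock_right (h (N + 1))
    obtain ⟨b, hb, hle, hsub⟩ := exists_site_in_blockSet (K := K) N _ hd
    refine ⟨b, hb, le_trans ?_ hle, (hsub.trans (Set.subset_biUnion_of_mem
      (u := fun d => blockSet bad K N (subBlock 0 d)) hd)).trans
      (Set.subset_iUnion (fun k => blockSet bad K k 0) (N + 1))⟩
    have h1 : N < 3 ^ N := Nat.lt_pow_self (by norm_num)
    have h2 : 1 ≤ (subBlock 0 d).1 := by simp [subBlock, hd2]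
    nlinarith

end Deterministic

section Probability

variable {Ω : Type u} [MeasurableSpace Ω] {P : Measure Ω} {bad : Ω → Set (ℕ × ℕ)}

/-- Decoupling of the bad sites is inherited by the bad blocks of higher levels. -/
lemma measure_forall_not_goodBlock_le {q : ℝ≥0∞} (hq : 81 * q ≤ 1 / 2)
    (h : ∀ T : Finset (ℕ × ℕ), P {ω | ∀ b ∈ T, b ∈ bad ω} ≤ q ^ T.card) (k : ℕ) :
    ∀ T : Finset (ℕ × ℕ), P {ω | ∀ b ∈ T, ¬ goodBlock (bad ω) k b} ≤
      (q * (1 / 2) ^ k) ^ T.card := by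
  classical
  induction k with
  | zero => simpa [goodBlock] using h
  | succ k ih =>
    intro T
    -- A bad block contains two distinct bad sub-blocks; `σ` records such a pair for each block of
    -- `T`. Over all of `T` this yields `2 * T.card` distinct sub-blocks, so the induction
    -- hypothesis squares the bound per block, at the cost of at most `81` choices.
    set D := {p : (Fin 3 × Fin 3) × (Fin 3 × Fin 3) // p.1 ≠ p.2}
    set site : (T → D) → T × Bool → ℕ × ℕ := fun σ p =>
      subBlock p.1 (if p.2 then (σ p.1).1.1 else (σ p.1).1.2) with hsite
    have hinj : ∀ σ, Function.Injective (site σ) := by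
      rintro σ ⟨b, i⟩ ⟨b', i'⟩ hbb
      have := @subBlock_injective (_, _) (_, _) hbb
      rw [Prod.mk.injEq] at this
      obtain ⟨h1, h2⟩ := this
      have h1' : b = b' := Subtype.ext h1
      subst h1'
      have hne := (σ b).2
      cases i <;> cases i'
      · rfl
      · exact absurd h2.symm hne
      · exact absurd h2 hne
      · rfl
    have hcover : {ω | ∀ b ∈ T, ¬ goodBlock (bad ω) (k + 1) b} ⊆ ⋃ σ : T → D,
        {ω | ∀ b ∈ Finset.univ.image (site σ), ¬ goodBlock (bad ω) k b} := by
      intro ω hω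
      have hex : ∀ b : T, ∃ d : D, ¬ goodBlock (bad ω) k (subBlock b d.1.1) ∧
          ¬ goodBlock (bad ω) k (subBlock b d.1.2) := by
        intro b
        have hb := hω b b.2
        simp only [goodBlock] at hb
        push Not at hb
        obtain ⟨d, d', h1, h2, h3⟩ := hb
        exact ⟨⟨(d, d'), h3⟩, h1, h2⟩
      choose σ hσ using hex
      refine Set.mem_iUnion.2 ⟨σ, fun b hb => ?_⟩
      obtain ⟨⟨b, i⟩, -, rfl⟩ := Finset.mem_image.1 hb
      cases i
      · simpa [hsite] using (hσ b).2
      · simpa [hsite] using (hσ b).1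
    refine (measure_mono hcover).trans ((measure_iUnion_fintype_le _ _).trans ?_)
    have hcard : ∀ σ, (Finset.univ.image (site σ)).card = T.card * 2 := fun σ => by
      rw [Finset.card_image_of_injective _ (hinj σ)]
      simp
    refine (Finset.sum_le_sum fun σ _ => ih _).trans ?_
    simp_rw [hcard]
    rw [Finset.sum_const, Finset.card_univ, nsmul_eq_mul, Fintype.card_fun, Fintype.card_coe]
    have hD : Fintype.card D ≤ 81 := (Fintype.card_subtype_le _).trans (by simp)
    have hD' : (Fintype.card D : ℝ≥0∞) ≤ 81 := by exact_mod_cast hD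
    push_cast
    rw [mul_comm T.card 2, pow_mul, ← mul_pow]
    refine pow_le_pow_left' ?_ _
    calc (Fintype.card D : ℝ≥0∞) * (q * (1 / 2) ^ k) ^ 2
        ≤ 81 * (q * (1 / 2) ^ k) ^ 2 := by gcongr
      _ = (81 * q) * (1 / 2) ^ k * (q * (1 / 2) ^ k) := by ring
      _ ≤ (1 / 2) * 1 * (q * (1 / 2) ^ k) := by
        gcongr
        exact pow_le_one₀ zero_le (by simp)
      _ = q * (1 / 2) ^ (k + 1) := by ring

/-- Union bound over the levels: the probabilities that the block at the origin fails sum to at most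
`2 * q < 1`. -/
lemma measure_forall_goodBlock_pos [IsProbabilityMeasure P] {q : ℝ≥0∞} (hq : 81 * q ≤ 1 / 2)
    (h : ∀ T : Finset (ℕ × ℕ), P {ω | ∀ b ∈ T, b ∈ bad ω} ≤ q ^ T.card) :
    0 < P {ω | ∀ k, goodBlock (bad ω) k 0} := by
  rw [pos_iff_ne_zero]
  intro h0
  have hsub : Set.univ ⊆ {ω | ∀ k, goodBlock (bad ω) k 0} ∪
      ⋃ k, {ω | ¬ goodBlock (bad ω) k 0} := by
    intro ω _
    by_cases hω : ∀ k, goodBlock (bad ω) k 0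
    · exact Or.inl hω
    · push Not at hω
      exact Or.inr (Set.mem_iUnion.2 hω)
  have h1 : (1 : ℝ≥0∞) ≤ ∑' k : ℕ, q * (1 / 2) ^ k := by
    calc (1 : ℝ≥0∞) = P Set.univ := measure_univ.symm
      _ ≤ _ := (measure_mono hsub).trans (measure_union_le _ _)
      _ ≤ 0 + ∑' k, P {ω | ¬ goodBlock (bad ω) k 0} := by
        rw [h0]; gcongr; exact measure_iUnion_le _
      _ ≤ _ := by
        rw [zero_add]
        refine ENNReal.tsum_le_tsum fun k => ?_
        simpa using measure_forall_not_goodBlock_le hq h k {0}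
  rw [ENNReal.tsum_mul_left, ENNReal.tsum_geometric] at h1
  have h2 : ((1 : ℝ≥0∞) - 1 / 2)⁻¹ = 2 := by
    rw [one_div, ENNReal.one_sub_inv_two, inv_inv]
  rw [h2] at h1
  have h3 : q * 2 ≤ 1 / 2 := by
    calc q * 2 = 2 * q := mul_comm _ _
      _ ≤ 81 * q := by gcongr; norm_num
      _ ≤ 1 / 2 := hq
  have h4 := h1.trans h3
  rw [one_div, ENNReal.one_le_inv] at h4
  norm_num at h4

end Probability

end Hierarchy

/-! ### Complete rings and percolation -/

section Rings

variable {s : ℝ} {n : ℕ} {φ : Measure Plane}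

/-- The lower left corner of the cell `cell s z`. -/
noncomputable def corner (s : ℝ) (z : ℤ × ℤ) : Plane := !₂[s * z.1, s * z.2]

@[simp] lemma corner_zero (s : ℝ) (z : ℤ × ℤ) : corner s z 0 = s * z.1 := rfl

@[simp] lemma corner_one (s : ℝ) (z : ℤ × ℤ) : corner s z 1 = s * z.2 := rfl

lemma corner_mem_cell (hs : 0 < s) (z : ℤ × ℤ) : corner s z ∈ cell s z := by
  rw [mem_cell_iff hs]
  simp [hs]

/-- Two cells are said to be at ring distance if the second meets the sphere of radius `4 * n * s`
centred at the corner of the first. -/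
def AtRing (s : ℝ) (n : ℕ) (z c : ℤ × ℤ) : Prop :=
  (cell s c ∩ Metric.sphere (corner s z) (4 * n * s)).Nonempty

/-- The ring around `z` is complete if all cells at ring distance from `z` are charged. -/
def RingComplete (s : ℝ) (n : ℕ) (φ : Measure Plane) (z : ℤ × ℤ) : Prop :=
  ∀ c, AtRing s n z c → φ (cell s c) ≠ 0

/-- The cells of mesh `s` in a cell of mesh `n * s`. -/
def siteCells (n : ℕ) (b : ℕ × ℕ) : Set (ℤ × ℤ) :=
  {z | ((n * b.1 : ℤ) ≤ z.1 ∧ z.1 < n * b.1 + n) ∧ ((n * b.2 : ℤ) ≤ z.2 ∧ z.2 < n * b.2 + n)}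

/-- The sites which do not contain the centre of a complete ring. -/
def badSites (s : ℝ) (n : ℕ) (φ : Measure Plane) : Set (ℕ × ℕ) :=
  {b | ∀ z ∈ siteCells n b, ¬ RingComplete s n φ z}

/-- Every point of the sphere shares its cell with a point of `φ`, and cells have diameter at most
`2 * s`. -/
lemma RingComplete.sphere_subset (hs : 0 < s) (hφ : IsCountingMeasure φ) {z : ℤ × ℤ}
    (h : RingComplete s n φ z) :
    Metric.sphere (corner s z) (4 * n * s) ⊆ booleanModel φ (2 * s) := by
  intro y hy
  have hyc : y ∈ cell s (cellIndex s y) := rfl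
  refine (hφ.one_le_of_ne_zero (measurableSet_cell s _) (isBounded_cell hs _)
    (h _ ⟨y, hyc, hy⟩)).trans (measure_mono fun x hx => ?_)
  exact dist_le_of_mem_cell hs hx hyc

lemma one_lt_rank_plane : 1 < Module.rank ℝ Plane := by
  rw [← Module.finrank_eq_rank, finrank_euclideanSpace_fin]
  norm_num

/-- Intermediate value theorem for the distance to `c` on the connected sphere about `c'`: at its
two points on the line through the centres this distance is at most `ρ`, respectively at least `ρ`.
-/
lemma sphere_inter_sphere_nonempty {c c' : Plane} {ρ : ℝ} (hρ : 0 ≤ ρ) (h : dist c c' ≤ 2 * ρ) :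
    (Metric.sphere c ρ ∩ Metric.sphere c' ρ).Nonempty := by
  have hconn := isConnected_sphere one_lt_rank_plane c' hρ
  rcases eq_or_ne c c' with rfl | hne
  · rw [Set.inter_self]
    exact hconn.nonempty
  set d := dist c c' with hd
  have hd0 : 0 < d := dist_pos.2 hne
  have hnd : ‖c' - c‖ = d := by rw [hd, dist_comm, dist_eq_norm]
  have key : ∀ t : ℝ, dist (c + t • (c' - c)) c = |t| * d ∧
      dist (c + t • (c' - c)) c' = |t - 1| * d := by
    intro t
    constructor
    · rw [dist_eq_norm, add_sub_cancel_left, norm_smul, hnd, Real.norm_eq_abs]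
    · have : c + t • (c' - c) - c' = (t - 1) • (c' - c) := by module
      rw [dist_eq_norm, this, norm_smul, hnd, Real.norm_eq_abs]
  obtain ⟨h1, h1'⟩ := key (1 - ρ / d)
  obtain ⟨h2, h2'⟩ := key (1 + ρ / d)
  have hq : 0 ≤ ρ / d := by positivity
  have hqd : ρ / d * d = ρ := div_mul_cancel₀ _ hd0.ne'
  have m1 : c + (1 - ρ / d) • (c' - c) ∈ Metric.sphere c' ρ := by
    rw [Metric.mem_sphere, h1', show 1 - ρ / d - 1 = -(ρ / d) by ring, abs_neg, abs_of_nonneg hq,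
      hqd]
  have m2 : c + (1 + ρ / d) • (c' - c) ∈ Metric.sphere c' ρ := by
    rw [Metric.mem_sphere, h2', add_sub_cancel_left, abs_of_nonneg hq, hqd]
  have l1 : dist (c + (1 - ρ / d) • (c' - c)) c ≤ ρ := by
    rw [h1, ← abs_of_pos hd0, ← abs_mul, sub_mul, abs_of_pos hd0, hqd, abs_le]
    constructor <;> linarith
  have l2 : ρ ≤ dist (c + (1 + ρ / d) • (c' - c)) c := by
    rw [h2, abs_of_nonneg (by positivity), add_mul, hqd]
    linarith
  obtain ⟨x, hx, hxc⟩ := hconn.isPreconnected.intermediate_value m1 m2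
    (f := fun x => dist x c) (by fun_prop) ⟨l1, l2⟩
  exact ⟨x, hxc, hx⟩

/-- Ring centres in neighbouring sites differ by at most `2 * n * s` in each coordinate, so their
distance is below twice the ring radius `4 * n * s` and the rings cross. -/
lemma percolates_of_goodBlock (hs : 0 < s) (hn : 0 < n) (hφ : IsCountingMeasure φ)
    (h : ∀ k, goodBlock (badSites s n φ) k 0) : Percolates (booleanModel φ (2 * s)) := by
  have hex : ∀ b, ∃ z, b ∉ badSites s n φ → z ∈ siteCells n b ∧ RingComplete s n φ z := by
    intro b
    by_cases hb : b ∈ badSites s n φ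
    · exact ⟨0, fun h => absurd hb h⟩
    · have hb' := hb
      simp only [badSites, Set.mem_ofPred_eq] at hb'
      push Not at hb'
      obtain ⟨z, hz, hc⟩ := hb'
      exact ⟨z, fun _ => ⟨hz, hc⟩⟩
  choose z hz using hex
  have hρ : (0 : ℝ) ≤ 4 * n * s := by positivity
  have hpos : ∀ {b}, b ∉ badSites s n φ →
      (s * (n * b.1) ≤ s * (z b).1 ∧ s * (z b).1 ≤ s * (n * b.1 + n)) ∧
      (s * (n * b.2) ≤ s * (z b).2 ∧ s * (z b).2 ≤ s * (n * b.2 + n)) := by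
    intro b hb
    obtain ⟨⟨h1, h2⟩, h3, h4⟩ := (hz b hb).1
    have e1 : (n * b.1 : ℝ) ≤ (z b).1 := by exact_mod_cast h1
    have e2 : ((z b).1 : ℝ) ≤ n * b.1 + n := by exact_mod_cast h2.le
    have e3 : (n * b.2 : ℝ) ≤ (z b).2 := by exact_mod_cast h3
    have e4 : ((z b).2 : ℝ) ≤ n * b.2 + n := by exact_mod_cast h4.le
    exact ⟨⟨by gcongr, by gcongr⟩, by gcongr, by gcongr⟩
  obtain ⟨S, hSA, hS, hfar⟩ := exists_isConnected_of_goodBlock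
    (K := fun b => Metric.sphere (corner s (z b)) (4 * n * s))
    (fun b _ => isConnected_sphere one_lt_rank_plane _ hρ)
    (fun b b' hb hb' hnext => by
      refine sphere_inter_sphere_nonempty hρ ((dist_le_abs_add_abs _ _).trans ?_)
      simp only [corner_zero, corner_one]
      obtain ⟨⟨h1, h2⟩, h3, h4⟩ := hpos hb
      obtain ⟨⟨h1', h2'⟩, h3', h4'⟩ := hpos hb'
      have hns : 0 < n * s := by positivity
      have a1 : |s * ((z b).1 : ℝ) - s * (z b').1| ≤ 2 * (n * s) := by
        rcases hnext with rfl | rfl <;> push_cast at * <;> rw [abs_le] <;>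
          constructor <;> linarith
      have a2 : |s * ((z b).2 : ℝ) - s * (z b').2| ≤ 2 * (n * s) := by
        rcases hnext with rfl | rfl <;> push_cast at * <;> rw [abs_le] <;>
          constructor <;> linarith
      linarith)
    (fun b hb => (hz b hb).2.sphere_subset hs hφ) h
  refine ⟨S, hSA, hS, fun hbdd => ?_⟩
  obtain ⟨C, hC⟩ := hbdd.subset_closedBall 0
  have hns : (0 : ℝ) < n * s := by positivity
  -- The extra `4` accounts for the ring radius: a ring of a site with first index at least `N`
  -- stays to the right of `(N - 4) * n * s > C`.
  obtain ⟨N, hN⟩ := exists_nat_gt (C / (n * s) + 4)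
  obtain ⟨b, hb, hNb, hsub⟩ := hfar N
  obtain ⟨x, hx⟩ := (isConnected_sphere one_lt_rank_plane (corner s (z b)) hρ).nonempty
  have h1 : |x 0 - (0 : Plane) 0| ≤ C := (abs_sub_apply_le_dist x 0 0).trans (hC (hsub hx))
  have h2 := (abs_sub_apply_le_dist x (corner s (z b)) 0).trans hx.le
  have h3 := (hpos hb).1.1
  rw [corner_zero] at h2
  have h4 : (N : ℝ) ≤ b.1 := by exact_mod_cast hNb
  have h5 : C / (n * s) * (n * s) = C := div_mul_cancel₀ _ hns.ne'
  have h6 := mul_lt_mul_of_pos_right (hN.trans_le h4) hns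
  rw [add_mul, h5] at h6
  have h7 := (abs_le.1 h2).1
  have h8 := (abs_le.1 h1).2
  simp only [PiLp.zero_apply, sub_zero] at h8
  nlinarith

end Rings

/-! ### Probability of bad sites -/

section RingProbability

variable {Ω : Type u} [MeasurableSpace Ω] {P : Measure Ω} {Φ Λ : Ω → Measure Plane}
  {s a α R δ μ : ℝ} {n : ℕ}

lemma poissonMeasure_zero (t : ℝ≥0) : poissonMeasure t {0} = ENNReal.ofReal (Real.exp (-t)) := by
  rw [poissonMeasure_singleton]
  simp

lemma IsPoissonProcess.measure_eq_zero (h : IsPoissonProcess P Φ a) {B : Set Plane}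
    (hB : MeasurableSet B) (hb : Bornology.IsBounded B) :
    P {ω | Φ ω B = 0} =
      ENNReal.ofReal (Real.exp (-(ENNReal.ofReal a * volume B).toReal)) := by
  have := h.joint_counts 1 (fun _ => B) (fun _ => hB) (fun _ => hb)
    (fun i j hij => absurd (Subsingleton.elim i j) hij) (fun _ => 0)
  simpa [poissonMeasure_zero, ENNReal.coe_toNNReal_eq_toReal] using this

/-- Given `Λ`, the void probability of `B` is `exp (-Λ B)`; here the events `{Λ ∈ G}` in the
definition of a Cox process are really needed. -/
lemma IsCoxProcess.measure_eq_zero_le [IsProbabilityMeasure P] (h : IsCoxProcess P Φ Λ)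
    {B : Set Plane} (hB : MeasurableSet B) (hb : Bornology.IsBounded B) (t : ℝ) :
    P {ω | ENNReal.ofReal t ≤ Λ ω B ∧ Φ ω B = 0} ≤ ENNReal.ofReal (Real.exp (-t)) := by
  have hG : MeasurableSet {ν : Measure Plane | ENNReal.ofReal t ≤ ν B} :=
    measurableSet_le measurable_const (Measure.measurable_coe hB)
  have := h.joint_counts _ hG 1 (fun _ => B) (fun _ => hB) (fun _ => hb)
    (fun i j hij => absurd (Subsingleton.elim i j) hij) (fun _ => 0)
  simp only [Set.mem_ofPred_eq, Fin.forall_fin_one, Nat.cast_zero, Finset.univ_unique,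
    Finset.prod_const, Finset.card_singleton, pow_one, poissonMeasure_zero] at this
  rw [this]
  calc _ ≤ ∫⁻ ω in Λ ⁻¹' {ν : Measure Plane | ENNReal.ofReal t ≤ ν B},
        ENNReal.ofReal (Real.exp (-t)) ∂P := by
        refine setLIntegral_mono measurable_const fun ω hω => ?_
        gcongr
        exact (ENNReal.ofReal_le_iff_le_toReal (h.intensity_lt_top ω B hb).ne).1 hω
    _ ≤ _ := by
      rw [setLIntegral_const]
      exact mul_le_of_le_one_right zero_le prob_le_one

/-- A cell of mesh `n * s`, indexed by a site. -/
def siteCell (s : ℝ) (n : ℕ) (b : ℕ × ℕ) : Set Plane := cell (n * s) (b.1, b.2)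

lemma mem_siteCells_of_inter (hs : 0 < s) (hn : 0 < n) {b : ℕ × ℕ} {z : ℤ × ℤ}
    (h : (siteCell s n b ∩ cell s z).Nonempty) : z ∈ siteCells n b := by
  have hn' : (0 : ℝ) < n := by exact_mod_cast hn
  obtain ⟨x, hx, hxz⟩ := h
  rw [siteCell, mem_cell_iff (by positivity)] at hx
  rw [mem_cell_iff hs] at hxz
  obtain ⟨⟨h1, h2⟩, h3, h4⟩ := hx
  obtain ⟨⟨k1, k2⟩, k3, k4⟩ := hxz
  push_cast at h1 h2 h3 h4
  have key : ∀ {t : ℝ} {m : ℕ} {w : ℤ}, n * s * m ≤ t → t < n * s * m + n * s → s * w ≤ t →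
      t < s * w + s → (n * m : ℤ) ≤ w ∧ w < n * m + n := by
    intro t m w a1 a2 a3 a4
    have b1 : s * (n * m) < s * (w + 1) := by linarith
    have b2 : s * w < s * (n * m + n) := by linarith
    have c1 := lt_of_mul_lt_mul_left b1 hs.le
    have c2 := lt_of_mul_lt_mul_left b2 hs.le
    have d1 : (n * m : ℤ) < w + 1 := by exact_mod_cast c1
    have d2 : w < (n * m + n : ℤ) := by exact_mod_cast c2
    exact ⟨by omega, d2⟩
  exact ⟨key h1 h2 k1 k2, key h3 h4 k3 k4⟩

/-- The pairs of a cell in the site at the origin and a shift to a cell at ring distance. -/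
noncomputable def ringPairs (n : ℕ) : Finset ((ℤ × ℤ) × (ℤ × ℤ)) :=
  (Finset.Ico 0 (n : ℤ) ×ˢ Finset.Ico 0 (n : ℤ)) ×ˢ
    (Finset.Icc (-(4 * n : ℤ)) (4 * n) ×ˢ Finset.Icc (-(4 * n : ℤ)) (4 * n))

lemma card_ringPairs (n : ℕ) : (ringPairs n).card = n ^ 2 * (8 * n + 1) ^ 2 := by
  simp only [ringPairs, Finset.card_product, Int.card_Ico, Int.card_Icc]
  have : (4 * (n : ℤ) + 1 - -(4 * n)).toNat = 8 * n + 1 := by omega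
  rw [this]
  simp
  ring

lemma AtRing.sub_mem (hs : 0 < s) {z c : ℤ × ℤ} (h : AtRing s n z c) :
    c - z ∈ Finset.Icc (-(4 * n : ℤ)) (4 * n) ×ˢ Finset.Icc (-(4 * n : ℤ)) (4 * n) := by
  obtain ⟨y, hy, hyz⟩ := h
  rw [mem_cell_iff hs] at hy
  obtain ⟨⟨h1, h2⟩, h3, h4⟩ := hy
  have key : ∀ {t : ℝ} {w v : ℤ}, |t - s * v| ≤ 4 * n * s → s * w ≤ t → t < s * w + s →
      -(4 * n : ℤ) ≤ w - v ∧ w - v ≤ 4 * n := by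
    intro t w v a1 a2 a3
    obtain ⟨a4, a5⟩ := abs_le.1 a1
    have b1 : s * (v - 4 * n) < s * (w + 1) := by linarith
    have b2 : s * w ≤ s * (v + 4 * n) := by linarith
    have c1 := lt_of_mul_lt_mul_left b1 hs.le
    have c2 := le_of_mul_le_mul_left b2 hs
    have d1 : (v - 4 * n : ℤ) < w + 1 := by exact_mod_cast c1
    have d2 : w ≤ (v + 4 * n : ℤ) := by exact_mod_cast c2
    omega
  rw [Finset.mem_product, Finset.mem_Icc, Finset.mem_Icc]
  exact ⟨key ((abs_sub_apply_le_dist y (corner s z) 0).trans (le_of_eq hyz)) h1 h2,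
    key ((abs_sub_apply_le_dist y (corner s z) 1).trans (le_of_eq hyz)) h3 h4⟩

/-- The cell of the pair `p` in the site `b`. -/
def centreCell (n : ℕ) (b : ℕ × ℕ) (p : (ℤ × ℤ) × (ℤ × ℤ)) : ℤ × ℤ :=
  (n * b.1 + p.1.1, n * b.2 + p.1.2)

/-- The cell at ring distance of the pair `p` in the site `b`. -/
def ringCell (n : ℕ) (b : ℕ × ℕ) (p : (ℤ × ℤ) × (ℤ × ℤ)) : ℤ × ℤ := centreCell n b p + p.2

/-- The cell of a parent and the missed ring cell are recorded relative to the site, so the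
witnesses range over one finite set for all sites. -/
lemma exists_pair_of_mem_badSites (hs : 0 < s) (hn : 0 < n) {φ φα : Measure Plane} {b : ℕ × ℕ}
    (hb : b ∈ badSites s n φ) (h : φα (siteCell s n b) ≠ 0) : ∃ p ∈ ringPairs n,
      φα (cell s (centreCell n b p)) ≠ 0 ∧ AtRing s n (centreCell n b p) (ringCell n b p) ∧
        φ (cell s (ringCell n b p)) = 0 := by
  obtain ⟨z, hz⟩ := exists_inter_cell_ne_zero h s
  have hzb := mem_siteCells_of_inter hs hn (nonempty_of_measure_ne_zero hz)
  have hz' : φα (cell s z) ≠ 0 := fun h0 => hz (measure_mono_null Set.inter_subset_right h0)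
  have hc := hb z hzb
  simp only [RingComplete] at hc
  push Not at hc
  obtain ⟨c, hzc, hc0⟩ := hc
  have e1 : centreCell n b ((z.1 - n * b.1, z.2 - n * b.2), c - z) = z := by
    simp [centreCell]
  have e2 : ringCell n b ((z.1 - n * b.1, z.2 - n * b.2), c - z) = c := by
    rw [ringCell, e1]
    simp
  refine ⟨((z.1 - n * b.1, z.2 - n * b.2), c - z), ?_, ?_, ?_, ?_⟩
  · obtain ⟨⟨h1, h2⟩, h3, h4⟩ := hzb
    refine Finset.mem_product.2 ⟨?_, hzc.sub_mem hs⟩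
    simp only [Finset.mem_product, Finset.mem_Ico]
    omega
  · rwa [e1]
  · rwa [e1, e2]
  · rwa [e2]

lemma centreCell_injOn {b b' : ℕ × ℕ} {p p' : (ℤ × ℤ) × (ℤ × ℤ)} (hp : p ∈ ringPairs n)
    (hp' : p' ∈ ringPairs n) (h : centreCell n b p = centreCell n b' p') : b = b' := by
  simp only [ringPairs, Finset.mem_product, Finset.mem_Ico] at hp hp'
  simp only [centreCell, Prod.mk.injEq] at h
  have key : ∀ {m m' : ℕ} {w w' : ℤ}, 0 ≤ w → w < n → 0 ≤ w' → w' < n →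
      (n * m + w : ℤ) = n * m' + w' → m = m' := by
    intro m m' w w' a1 a2 a3 a4 e
    have d1 : ((n * m + w : ℤ)) / n = m := by
      rw [Int.add_comm, Int.add_mul_ediv_left _ _ (by omega), Int.ediv_eq_zero_of_lt a1 a2, zero_add]
    have d2 : ((n * m' + w' : ℤ)) / n = m' := by
      rw [Int.add_comm, Int.add_mul_ediv_left _ _ (by omega), Int.ediv_eq_zero_of_lt a3 a4, zero_add]
    rw [e, d2] at d1
    exact_mod_cast d1.symm
  exact Prod.ext (key hp.1.1.1 hp.1.1.2 hp'.1.1.1 hp'.1.1.2 h.1)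
    (key hp.1.2.1 hp.1.2.2 hp'.1.2.1 hp'.1.2.2 h.2)

/-- Moving both endpoints within their cells changes the distance `4 * n * s` by at most `4 * s`,
and the annulus allows less than `5 * s` inward and up to `5 * s` outward. -/
lemma AtRing.cell_subset_annulus (hs : 0 < s) {z c : ℤ × ℤ} (h : AtRing s n z c) {x : Plane}
    (hx : x ∈ cell s z) : cell s c ⊆ annulus (4 * n * s + 5 * s) (10 * s) x := by
  intro y hy
  obtain ⟨p, hp, hpz⟩ := h
  rw [Metric.mem_sphere] at hpz
  have h1 := dist_le_of_mem_cell hs hy hp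
  have h2 := dist_le_of_mem_cell hs hx (corner_mem_cell hs z)
  have h3 := dist_triangle4 y p (corner s z) x
  have h4 := dist_triangle4 p y x (corner s z)
  rw [dist_comm (corner s z) x] at h3
  rw [dist_comm p y] at h4
  rw [mem_annulus]
  constructor <;> linarith

lemma AtRing.le_uniform_annulus (hs : 0 < s) (hn : 2 ≤ n) {z c : ℤ × ℤ} (h : AtRing s n z c)
    {x : Plane} (hx : x ∈ cell s z) {W : Set Plane} (hcW : cell s c ⊆ W) :
    ENNReal.ofReal (1 / (80 * n * Real.pi)) ≤
      (volume[|annulus (4 * n * s + 5 * s) (10 * s) x] : Measure Plane) W := by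
  have hn' : (2 : ℝ) ≤ n := by exact_mod_cast hn
  have hle : 10 * s ≤ 4 * n * s + 5 * s := by nlinarith
  rw [cond_apply (measurableSet_annulus _), volume_annulus (by positivity) hle]
  have hpos : 0 < 10 * s * (2 * (4 * n * s + 5 * s) - 10 * s) * Real.pi := by
    have : 0 < 2 * (4 * n * s + 5 * s) - 10 * s := by nlinarith
    have := Real.pi_pos
    positivity
  calc ENNReal.ofReal (1 / (80 * n * Real.pi))
      = (ENNReal.ofReal (10 * s * (2 * (4 * n * s + 5 * s) - 10 * s) * Real.pi))⁻¹ *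
          volume (cell s c) := by
        rw [volume_cell hs, ← ENNReal.ofReal_inv_of_pos hpos,
          ← ENNReal.ofReal_mul (by positivity)]
        congr 1
        have := Real.pi_pos
        have hn0 : (n : ℝ) ≠ 0 := by positivity
        -- The annulus has area `80 * n * π * s ^ 2`, against `s ^ 2` for a cell.
        have : 10 * s * (2 * (4 * n * s + 5 * s) - 10 * s) * Real.pi =
            s ^ 2 * (80 * n * Real.pi) := by ring
        rw [this]
        field_simp
    _ ≤ _ := by
      gcongr
      exact Set.subset_inter (h.cell_subset_annulus hs hx) hcW

/-- Occupied cells in distinct sites force a lower bound on the cluster intensity of the cells at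
ring distance. -/
lemma card_mul_le_clusterIntensity (hs : 0 < s) (hn : 2 ≤ n) {φ : Measure Plane}
    (hφ : IsCountingMeasure φ) (T : Finset (ℕ × ℕ)) {σ : ℕ × ℕ → (ℤ × ℤ) × (ℤ × ℤ)}
    (hσ : ∀ b ∈ T, σ b ∈ ringPairs n)
    (h0 : ∀ b ∈ T, φ (cell s (centreCell n b (σ b))) ≠ 0)
    (hr : ∀ b ∈ T, AtRing s n (centreCell n b (σ b)) (ringCell n b (σ b))) :
    ENNReal.ofReal (T.card * (μ * (1 / (80 * n * Real.pi)))) ≤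
      clusterIntensity (4 * n * s + 5 * s) (10 * s) μ φ
        (⋃ b ∈ T, cell s (ringCell n b (σ b))) := by
  have hW : MeasurableSet (⋃ b ∈ T, cell s (ringCell n b (σ b))) :=
    T.measurableSet_biUnion fun _ _ => measurableSet_cell _ _
  rw [clusterIntensity_apply _ _ hW]
  have hκ : (0 : ℝ) ≤ 1 / (80 * n * Real.pi) := by
    have := Real.pi_pos
    positivity
  rw [mul_left_comm, ENNReal.ofReal_mul' (by positivity)]
  refine mul_le_mul_right ?_ _
  calc ENNReal.ofReal (T.card * (1 / (80 * n * Real.pi)))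
      = ∑ b ∈ T, ENNReal.ofReal (1 / (80 * n * Real.pi)) := by
        rw [Finset.sum_const, nsmul_eq_mul, ENNReal.ofReal_mul (by positivity),
          ENNReal.ofReal_natCast]
    -- The ring cells of different sites may coincide, but the centre cells are disjoint, so each
    -- site contributes its own parent to the intensity of the union.
    _ ≤ ∑ b ∈ T, ∫⁻ x in cell s (centreCell n b (σ b)),
          (volume[|annulus (4 * n * s + 5 * s) (10 * s) x] : Measure Plane)
            (⋃ b ∈ T, cell s (ringCell n b (σ b))) ∂φ := by
        refine Finset.sum_le_sum fun b hb => ?_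
        calc ENNReal.ofReal (1 / (80 * n * Real.pi))
            ≤ ENNReal.ofReal (1 / (80 * n * Real.pi)) * φ (cell s (centreCell n b (σ b))) :=
              le_mul_of_one_le_right zero_le
                (hφ.one_le_of_ne_zero (measurableSet_cell _ _) (isBounded_cell hs _) (h0 b hb))
          _ = ∫⁻ x in cell s (centreCell n b (σ b)), ENNReal.ofReal (1 / (80 * n * Real.pi)) ∂φ :=
              (setLIntegral_const _ _).symm
          _ ≤ _ := setLIntegral_mono' (measurableSet_cell _ _) fun x hx =>
              (hr b hb).le_uniform_annulus hs hn hx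
                (Set.subset_biUnion_of_mem (u := fun b => cell s (ringCell n b (σ b))) hb)
    _ = ∫⁻ x in ⋃ b ∈ T, cell s (centreCell n b (σ b)), _ ∂φ :=
        (lintegral_biUnion_finset (fun b hb b' hb' hne => disjoint_cell fun h =>
          hne (centreCell_injOn (hσ b hb) (hσ b' hb') h)) (fun _ _ => measurableSet_cell _ _) _).symm
    _ ≤ _ := setLIntegral_le_lintegral _ _

lemma measure_forall_siteCell_eq_zero (hs : 0 < s) (hn : 0 < n) (hα : 0 ≤ α)
    (h : IsPoissonProcess P Φ α) (T : Finset (ℕ × ℕ)) :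
    P {ω | ∀ b ∈ T, Φ ω (siteCell s n b) = 0} ≤
      ENNReal.ofReal (Real.exp (-(α * (n * s) ^ 2))) ^ T.card := by
  have hns : 0 < n * s := by
    have : (0 : ℝ) < n := by exact_mod_cast hn
    positivity
  have hset : {ω | ∀ b ∈ T, Φ ω (siteCell s n b) = 0} =
      {ω | Φ ω (⋃ b ∈ T, siteCell s n b) = 0} := by
    ext ω
    exact (measure_biUnion_null_iff T.countable_toSet).symm
  have hvol : volume (⋃ b ∈ T, siteCell s n b) = T.card * ENNReal.ofReal ((n * s) ^ 2) := by
    have hd : (T : Set (ℕ × ℕ)).PairwiseDisjoint (siteCell s n) := fun b _ b' _ hne =>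
      disjoint_cell fun h => hne (by
        simp only [Prod.mk.injEq, Nat.cast_inj] at h
        exact Prod.ext h.1 h.2)
    rw [measure_biUnion_finset hd fun b _ => measurableSet_cell _ _]
    simp_rw [siteCell, volume_cell hns]
    rw [Finset.sum_const, nsmul_eq_mul]
  have hm : MeasurableSet (⋃ b ∈ T, siteCell s n b) :=
    T.measurableSet_biUnion fun _ _ => measurableSet_cell _ _
  have hb : Bornology.IsBounded (⋃ b ∈ T, siteCell s n b) :=
    (Bornology.isBounded_biUnion_finset T).2 fun _ _ => isBounded_cell hns _
  rw [hset, h.measure_eq_zero hm hb, hvol,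
    ← ENNReal.ofReal_pow (Real.exp_pos _).le, ← Real.exp_nat_mul]
  refine le_of_eq ?_
  congr 2
  rw [ENNReal.toReal_mul, ENNReal.toReal_mul, ENNReal.toReal_natCast, ENNReal.toReal_ofReal hα,
    ENNReal.toReal_ofReal (by positivity)]
  ring

/-- The event that the occupied cells of all sites of `T` miss a cell at ring distance. -/
def missingEvent (s : ℝ) (n : ℕ) (Φα Φ : Ω → Measure Plane) (T : Finset (ℕ × ℕ)) : Set Ω :=
  {ω | ∀ b ∈ T, ∃ p ∈ ringPairs n, Φα ω (cell s (centreCell n b p)) ≠ 0 ∧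
    AtRing s n (centreCell n b p) (ringCell n b p) ∧ Φ ω (cell s (ringCell n b p)) = 0}

/-- After a union bound over the choice `σ` of one witness per site, the union of the missed cells
is void although its intensity is at least `T.card * κ`. Dependence between sites is thus harmless.
-/
lemma measure_missingEvent_le [IsProbabilityMeasure P] (hs : 0 < s) (hn : 2 ≤ n)
    {Φα : Ω → Measure Plane} (hα : IsPointProcess Φα)
    (h : IsCoxProcess P Φ fun ω => clusterIntensity (4 * n * s + 5 * s) (10 * s) μ (Φα ω))
    (T : Finset (ℕ × ℕ)) :
    P (missingEvent s n Φα Φ T) ≤ ((ringPairs n).card *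
      ENNReal.ofReal (Real.exp (-(μ * (1 / (80 * n * Real.pi)))))) ^ T.card := by
  classical
  set κ := μ * (1 / (80 * n * Real.pi)) with hκ
  set W : (T → ringPairs n) → Set Plane := fun σ => ⋃ b ∈ T, cell s (ringCell n b
    (if hb : b ∈ T then (σ ⟨b, hb⟩).1 else 0)) with hW
  have hcover : missingEvent s n Φα Φ T ⊆ ⋃ σ : T → ringPairs n,
      {ω | ENNReal.ofReal (T.card * κ) ≤
        clusterIntensity (4 * n * s + 5 * s) (10 * s) μ (Φα ω) (W σ) ∧ Φ ω (W σ) = 0} := by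
    intro ω hω
    choose! σ hσ h1 h2 h3 using hω
    refine Set.mem_iUnion.2 ⟨fun b => ⟨σ b, hσ b b.2⟩, ?_⟩
    have e : W (fun b => ⟨σ b, hσ b b.2⟩) = ⋃ b ∈ T, cell s (ringCell n b (σ b)) := by
      refine Set.iUnion₂_congr fun b hb => ?_
      rw [dif_pos hb]
    rw [Set.mem_ofPred_eq, e]
    refine ⟨card_mul_le_clusterIntensity hs hn (hα.counting ω) T hσ h1 h2, ?_⟩
    exact (measure_biUnion_null_iff T.countable_toSet).2 h3
  refine (measure_mono hcover).trans ((measure_iUnion_fintype_le _ _).trans ?_)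
  refine (Finset.sum_le_sum fun σ _ => h.measure_eq_zero_le
    (T.measurableSet_biUnion fun _ _ => measurableSet_cell _ _)
    ((Bornology.isBounded_biUnion_finset T).2 fun _ _ => isBounded_cell hs _) _).trans ?_
  rw [Finset.sum_const, Finset.card_univ, nsmul_eq_mul, Fintype.card_fun, Fintype.card_coe,
    Fintype.card_coe, mul_pow, ← ENNReal.ofReal_pow (Real.exp_pos _).le, ← Real.exp_nat_mul,
    mul_neg]
  push_cast
  rfl

/-- The larger of `k` and `l` is at least half of `k + l`. This bounds the intersection of two
events without any independence. -/
lemma min_pow_le {x y ε : ℝ≥0∞} (hε : ε ≤ 1) (hx : x ≤ ε ^ 2) (hy : y ≤ ε ^ 2) (k l : ℕ) :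
    min (x ^ k) (y ^ l) ≤ ε ^ (k + l) := by
  rcases le_total k l with h | h
  · refine (min_le_right _ _).trans ((pow_le_pow_left' hy l).trans ?_)
    rw [← pow_mul]
    exact pow_le_pow_right_of_le_one' hε (by omega)
  · refine (min_le_left _ _).trans ((pow_le_pow_left' hx k).trans ?_)
    rw [← pow_mul]
    exact pow_le_pow_right_of_le_one' hε (by omega)

/-- A bad site either has no parent or has one whose ring misses a cell. Splitting `T` accordingly
gives `2 ^ T.card` cases, each of probability at most `ε ^ T.card`. -/
lemma measure_forall_mem_badSites_le [IsProbabilityMeasure P] (hs : 0 < s) (hn : 2 ≤ n)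
    (hα : 0 ≤ α) {Φα : Ω → Measure Plane} (hΦα : IsPoissonProcess P Φα α)
    (h : IsCoxProcess P Φ fun ω => clusterIntensity (4 * n * s + 5 * s) (10 * s) μ (Φα ω))
    {ε : ℝ≥0∞} (hε : ε ≤ 1) (h1 : ENNReal.ofReal (Real.exp (-(α * (n * s) ^ 2))) ≤ ε ^ 2)
    (h2 : (ringPairs n).card * ENNReal.ofReal (Real.exp (-(μ * (1 / (80 * n * Real.pi))))) ≤ ε ^ 2)
    (T : Finset (ℕ × ℕ)) :
    P {ω | ∀ b ∈ T, b ∈ badSites s n (Φ ω)} ≤ (2 * ε) ^ T.card := by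
  classical
  have hcover : {ω | ∀ b ∈ T, b ∈ badSites s n (Φ ω)} ⊆ ⋃ T' ∈ T.powerset,
      ({ω | ∀ b ∈ T', Φα ω (siteCell s n b) = 0} ∩ missingEvent s n Φα Φ (T \ T')) := by
    intro ω hω
    refine Set.mem_biUnion (x := T.filter fun b => Φα ω (siteCell s n b) = 0)
      (Finset.mem_powerset.2 (Finset.filter_subset _ _))
      ⟨fun b hb => (Finset.mem_filter.1 hb).2, fun b hb => ?_⟩
    obtain ⟨hbT, hb⟩ := Finset.mem_sdiff.1 hb
    exact exists_pair_of_mem_badSites hs (by omega) (hω b hbT) fun h0 =>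
      hb (Finset.mem_filter.2 ⟨hbT, h0⟩)
  refine (measure_mono hcover).trans ((measure_biUnion_finset_le _ _).trans ?_)
  calc _ ≤ ∑ T' ∈ T.powerset, ε ^ T.card := by
        refine Finset.sum_le_sum fun T' hT' => ?_
        have hsub := Finset.mem_powerset.1 hT'
        have hcard : T.card = T'.card + (T \ T').card := by
          rw [add_comm, Finset.card_sdiff_add_card_eq_card hsub]
        rw [hcard]
        refine le_trans ?_ (min_pow_le hε h1 h2 _ _)
        exact le_min ((measure_mono Set.inter_subset_left).trans
          (measure_forall_siteCell_eq_zero hs (by omega) hα hΦα T'))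
          ((measure_mono Set.inter_subset_right).trans
          (measure_missingEvent_le hs hn hΦα.1 h _))
    _ = (2 * ε) ^ T.card := by
        rw [Finset.sum_const, Finset.card_powerset, nsmul_eq_mul, mul_pow]
        push_cast
        rfl

end RingProbability

/-! ### Choice of parameters and percolation at a given radius -/

section Supercritical

open Filter Topology in
-- With `n = m ^ 2` and mean cluster size `m ^ 3` both exponents are linear in `m`, while the number
-- of pairs is at most `81 * m ^ 8`.
lemma exists_ring_parameters {a s ε : ℝ} (ha : 0 < a) (hs : 0 < s) (hε : 0 < ε) :
    ∃ m : ℕ, 2 ≤ m ∧ Real.exp (-(a / m ^ 3 * ((m ^ 2 : ℕ) * s) ^ 2)) ≤ ε ∧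
      ((ringPairs (m ^ 2)).card : ℝ) *
        Real.exp (-(m ^ 3 * (1 / (80 * (m ^ 2 : ℕ) * Real.pi)))) ≤ ε := by
  have hpi := Real.pi_pos
  have t1 : Tendsto (fun m : ℕ => Real.exp (-(a * s ^ 2 * m))) atTop (𝓝 0) :=
    Real.tendsto_exp_neg_atTop_nhds_zero.comp
      (tendsto_natCast_atTop_atTop.const_mul_atTop (by positivity))
  have t2 : Tendsto (fun m : ℕ => 81 * (80 * Real.pi) ^ 8 * ((1 / (80 * Real.pi) * m) ^ 8 *
      Real.exp (-(1 / (80 * Real.pi) * m)))) atTop (𝓝 0) := by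
    simpa using ((Real.tendsto_pow_mul_exp_neg_atTop_nhds_zero 8).comp
      (tendsto_natCast_atTop_atTop.const_mul_atTop
        (by positivity : 0 < 1 / (80 * Real.pi)))).const_mul (81 * (80 * Real.pi) ^ 8)
  obtain ⟨m, h1, h2, hm⟩ := ((t1.eventually_le_const hε).and
    ((t2.eventually_le_const hε).and (eventually_ge_atTop 2))).exists
  have hm0 : (0 : ℝ) < m := by exact_mod_cast (by omega : 0 < m)
  have hm1 : (1 : ℝ) ≤ m := by exact_mod_cast (by omega : 1 ≤ m)
  refine ⟨m, hm, ?_, ?_⟩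
  · have e : a / (m : ℝ) ^ 3 * ((m ^ 2 : ℕ) * s) ^ 2 = a * s ^ 2 * m := by
      push_cast
      field_simp
    rwa [e]
  · refine le_trans ?_ h2
    rw [card_ringPairs]
    push_cast
    have e : (m : ℝ) ^ 3 * (1 / (80 * m ^ 2 * Real.pi)) = 1 / (80 * Real.pi) * m := by
      field_simp
    rw [e, ← mul_assoc]
    refine mul_le_mul_of_nonneg_right ?_ (Real.exp_pos _).le
    have hm2 : (1 : ℝ) ≤ m ^ 2 := one_le_pow₀ hm1
    calc ((m : ℝ) ^ 2) ^ 2 * (8 * m ^ 2 + 1) ^ 2 ≤ (m ^ 2) ^ 2 * (9 * m ^ 2) ^ 2 := by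
          gcongr
          linarith
      _ = _ := by
        field_simp
        ring

/-- For every radius there is an annular cluster process of given intensity whose Boolean model
percolates with positive probability. -/
theorem exists_params_percolates {a r : ℝ} (ha : 0 < a) (hr : 0 < r) :
    ∃ α R δ μ : ℝ, AdmissibleParams α R δ μ ∧ α * μ = a ∧
      ∀ {Ω : Type u} [MeasurableSpace Ω] {P : Measure Ω} [IsProbabilityMeasure P]
        {Φ : Ω → Measure Plane}, IsAnnularClusterProcess P Φ α R δ μ →
        0 < P {ω | Percolates (booleanModel (Φ ω) r)} := by
  -- The mesh is `r / 2` because complete rings are covered by grains of radius twice the mesh. With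
  -- `ε = 1 / 324` and `q = 2 * ε` one gets `81 * q = 1 / 2`.
  obtain ⟨m, hm, h1, h2⟩ := exists_ring_parameters ha (half_pos hr)
    (by norm_num : (0 : ℝ) < (1 / 324) ^ 2)
  have hm0 : (0 : ℝ) < m := by exact_mod_cast (by omega : 0 < m)
  have hn : 2 ≤ m ^ 2 := by nlinarith
  have hn' : (2 : ℝ) ≤ (m ^ 2 : ℕ) := by exact_mod_cast hn
  have hs := half_pos hr
  refine ⟨a / m ^ 3, 4 * (m ^ 2 : ℕ) * (r / 2) + 5 * (r / 2), 10 * (r / 2), m ^ 3,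
    ⟨by positivity, by positivity, by positivity, by nlinarith⟩,
    div_mul_cancel₀ _ (by positivity), ?_⟩
  intro Ω _ P _ Φ ⟨Φα, hΦα, hcox⟩
  have hε : ENNReal.ofReal ((1 / 324) ^ 2) = ENNReal.ofReal (1 / 324) ^ 2 :=
    ENNReal.ofReal_pow (by norm_num) 2
  have hq := measure_forall_goodBlock_pos (P := P) (q := 2 * ENNReal.ofReal (1 / 324))
    (bad := fun ω => badSites (r / 2) (m ^ 2) (Φ ω)) (by
      rw [← mul_assoc, show (81 * 2 : ℝ≥0∞) = ENNReal.ofReal 162 by norm_num,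
        ← ENNReal.ofReal_mul (by norm_num), show (1 / 2 : ℝ≥0∞) = ENNReal.ofReal (1 / 2) by
          rw [ENNReal.ofReal_div_of_pos (by norm_num)]; norm_num]
      exact ENNReal.ofReal_le_ofReal (by norm_num))
    (measure_forall_mem_badSites_le hs hn (by positivity) hΦα hcox
      (by rw [ENNReal.ofReal_le_one]; norm_num)
      (hε ▸ ENNReal.ofReal_le_ofReal h1)
      (by
        rw [← hε, ← ENNReal.ofReal_natCast, ← ENNReal.ofReal_mul (by positivity)]
        exact ENNReal.ofReal_le_ofReal h2))
  refine hq.trans_le (measure_mono fun ω hω => ?_)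
  have := percolates_of_goodBlock hs (by omega) (hcox.1.counting ω) hω
  rwa [mul_div_cancel₀ r two_ne_zero] at this

end Supercritical

/-! ### Superpositions and vanishing critical radius -/

section Superposition

variable {Ω : Type u} [MeasurableSpace Ω] {P : Measure Ω} {Φ : Ω → Measure Plane}
  {Φs : ℕ → Ω → Measure Plane} {a : ℝ} {b : ℕ → ℝ}

lemma booleanModel_mono {φ ψ : Measure Plane} (h : φ ≤ ψ) {r r' : ℝ} (hr : r ≤ r') :
    booleanModel φ r ⊆ booleanModel ψ r' := fun _ hy =>
  (hy.trans (measure_mono (Metric.closedBall_subset_closedBall hr))).trans (h _)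

lemma Percolates.mono {A B : Set Plane} (h : Percolates A) (hAB : A ⊆ B) : Percolates B := by
  obtain ⟨S, hS, hc, hb⟩ := h
  exact ⟨S, hS.trans hAB, hc, hb⟩

lemma criticalRadius_le {r : ℝ} (hr : 0 ≤ r)
    (h : 0 < P {ω | Percolates (booleanModel (Φ ω) r)}) :
    criticalRadius P Φ ≤ ENNReal.ofReal r := by
  refine sInf_le ⟨r.toNNReal, rfl, ?_⟩
  rwa [Real.coe_toNNReal r hr]

lemma criticalRadius_eq_zero
    (h : ∀ r : ℝ, 0 < r → 0 < P {ω | Percolates (booleanModel (Φ ω) r)}) :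
    criticalRadius P Φ = 0 := by
  by_contra hne
  obtain ⟨r, hr0, hr⟩ := ENNReal.lt_iff_exists_nnreal_btwn.1 (pos_iff_ne_zero.2 hne)
  have hr0' : (0 : ℝ) < r := by exact_mod_cast hr0
  have := criticalRadius_le hr0'.le (h r hr0')
  rw [ENNReal.ofReal_coe_nnreal] at this
  exact absurd hr (not_lt.2 this)

lemma exists_nat_tsum_eq {f : ℕ → ℝ≥0∞} (hf : ∀ n, ∃ m : ℕ, f n = m) (h : ∑' n, f n ≠ ∞) :
    ∃ m : ℕ, ∑' n, f n = m := by
  choose m hm using hf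
  have hfin := ENNReal.finite_const_le_of_tsum_ne_top h one_ne_zero
  refine ⟨∑ n ∈ hfin.toFinset, m n, ?_⟩
  rw [tsum_eq_sum (s := hfin.toFinset) fun n hn => ?_]
  · push_cast
    exact Finset.sum_congr rfl fun n _ => hm n
  · have h1 : ¬ 1 ≤ f n := fun h1 => hn (hfin.mem_toFinset.2 h1)
    rw [hm] at h1 ⊢
    have : m n = 0 := by
      by_contra h0
      exact h1 (by exact_mod_cast Nat.one_le_iff_ne_zero.2 h0)
    rw [this, Nat.cast_zero]

/-- Point processes with summable intensities can be superposed. -/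
lemma exists_superposition (hΦ : ∀ n, IsPointProcess (Φs n)) (hb : ∀ n, 0 ≤ b n)
    (hab : HasSum b a) (hi : ∀ n, HasIntensity P (Φs n) (b n)) :
    ∃ Φ : Ω → Measure Plane, IsPointProcess Φ ∧ HasIntensity P Φ a ∧
      ∀ᵐ ω ∂P, Φ ω = Measure.sum fun n => Φs n ω := by
  classical
  have hm : ∀ {B : Set Plane}, MeasurableSet B → Measurable fun ω => ∑' n, Φs n ω B :=
    fun hB => Measurable.tsum fun n => (Measure.measurable_coe hB).comp (hΦ n).measurable
  have hint : ∀ {B : Set Plane}, MeasurableSet B →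
      ∫⁻ ω, ∑' n, Φs n ω B ∂P = ENNReal.ofReal a * volume B := by
    intro B hB
    have hm' : ∀ n, AEMeasurable (fun ω => Φs n ω B) P := fun n =>
      ((Measure.measurable_coe hB).comp (hΦ n).measurable).aemeasurable
    rw [lintegral_tsum hm']
    simp_rw [hi _ B hB]
    rw [ENNReal.tsum_mul_right, ← ENNReal.ofReal_tsum_of_nonneg hb hab.summable, hab.tsum_eq]
  set G : Set Ω := {ω | ∀ k : ℕ, ∑' n, Φs n ω (Metric.closedBall 0 k) < ∞} with hG
  have hGm : MeasurableSet G := by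
    rw [hG, Set.ofPred_forall]
    exact MeasurableSet.iInter fun k =>
      measurableSet_lt (hm Metric.isClosed_closedBall.measurableSet) measurable_const
  have hGae : ∀ᵐ ω ∂P, ω ∈ G := by
    refine ae_all_iff.2 fun k => ae_lt_top (hm Metric.isClosed_closedBall.measurableSet) ?_
    rw [hint Metric.isClosed_closedBall.measurableSet]
    exact ENNReal.mul_ne_top ENNReal.ofReal_ne_top
      (volume_lt_top_of_isBounded Metric.isBounded_closedBall).ne
  -- On the null set where the sum is not locally finite the value `0` is used, since a point
  -- process must be a counting measure for every `ω`.
  set Φ : Ω → Measure Plane := fun ω => if ω ∈ G then Measure.sum fun n => Φs n ω else 0 with hΦd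
  have hsum : ∀ᵐ ω ∂P, Φ ω = Measure.sum fun n => Φs n ω := by
    filter_upwards [hGae] with ω hω
    exact if_pos hω
  refine ⟨Φ, ⟨?_, fun ω B hB hbd => ?_⟩, fun B hB => ?_, hsum⟩
  · refine Measurable.ite hGm (Measure.measurable_of_measurable_coe _ fun B hB => ?_)
      measurable_const
    simp_rw [Measure.sum_apply _ hB]
    exact hm hB
  · by_cases hω : ω ∈ G
    · simp only [hΦd, if_pos hω, Measure.sum_apply _ hB]
      refine exists_nat_tsum_eq (fun n => (hΦ n).counting ω B hB hbd) (ne_of_lt ?_)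
      obtain ⟨C, hC⟩ := hbd.subset_closedBall 0
      obtain ⟨k, hk⟩ := exists_nat_ge C
      exact (ENNReal.tsum_le_tsum fun n => measure_mono
        (hC.trans (Metric.closedBall_subset_closedBall hk))).trans_lt (hω k)
    · exact ⟨0, by simp [hΦd, if_neg hω]⟩
  · rw [← hint hB]
    refine lintegral_congr_ae ?_
    filter_upwards [hsum] with ω hω
    rw [hω, Measure.sum_apply _ hB]

lemma dominatesPoisson_superposition [IsProbabilityMeasure P] (hΦ : IsPointProcess Φ)
    (hΦs : ∀ n, IsPointProcess (Φs n)) (hi : iIndepFun Φs P)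
    (hsum : ∀ᵐ ω ∂P, Φ ω = Measure.sum fun n => Φs n ω) (hb : ∀ n, 0 ≤ b n) (hab : HasSum b a)
    {ι : Type*} [Fintype ι] {A : ι → Set Plane} (hA : ∀ i, MeasurableSet (A i))
    (hbd : ∀ i, Bornology.IsBounded (A i))
    (h : ∀ n, DominatesPoisson P (fun ω => countVec (Φs n ω) A)
      fun i => (ENNReal.ofReal (b n) * volume (A i)).toNNReal) :
    DominatesPoisson P (fun ω => countVec (Φ ω) A)
      fun i => (ENNReal.ofReal a * volume (A i)).toNNReal := by
  have hNm : ∀ n, Measurable fun ω => countVec (Φs n ω) A := fun n =>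
    measurable_countVec (hΦs n).measurable hA
  have hNi : iIndepFun (fun n ω => countVec (Φs n ω) A) P :=
    hi.comp (fun _ φ => countVec φ A) fun _ => measurable_countVec measurable_id hA
  refine DominatesPoisson.of_tendsto (fun K => ?_) (DominatesPoisson.sum_range hNm hNi h) ?_
  · filter_upwards [hsum] with ω hω i
    have h1 : ((∑ n ∈ Finset.range K, fun ω => countVec (Φs n ω) A) ω i : ℕ) =
        ∑ n ∈ Finset.range K, countVec (Φs n ω) A i := by
      simp [Finset.sum_apply]
    rw [h1, ← Nat.cast_le (α := ℝ≥0∞)]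
    push_cast
    rw [(hΦ.counting ω).coe_countVec (hA i) (hbd i), hω, Measure.sum_apply _ (hA i)]
    simp_rw [((hΦs _).counting ω).coe_countVec (hA i) (hbd i)]
    exact ENNReal.sum_le_tsum _
  · rw [tendsto_pi_nhds]
    intro i
    have e : ∀ x, (ENNReal.ofReal x * volume (A i)).toNNReal =
        x.toNNReal * (volume (A i)).toNNReal := fun x => by
      rw [ENNReal.toNNReal_mul, ENNReal.ofReal, ENNReal.toNNReal_coe]
    simp only [Finset.sum_apply, e]
    simp_rw [← Finset.sum_mul, ← Real.toNNReal_sum_of_nonneg fun n _ => hb n]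
    exact ((continuous_real_toNNReal.tendsto _).comp hab.tendsto_sum_nat).mul_const _

end Superposition

lemma isPointProcess_of_isAnnularCluster {Ω : Type u} [MeasurableSpace Ω] {P : Measure Ω}
    {Φ : Ω → Measure Plane} {α R δ μ : ℝ} (h : IsAnnularClusterProcess P Φ α R δ μ) :
    IsPointProcess Φ := by
  obtain ⟨_, -, hcox⟩ := h
  exact hcox.1

/-- A superposition of independent annular cluster processes of given intensity, larger than the
Poisson process in the `dcx` order, whose Boolean models all percolate. -/
theorem exists_superposition_percolates {a : ℝ} (ha : 0 < a) :
    ∃ (Ω : Type) (_ : MeasurableSpace Ω) (P : Measure Ω) (_ : IsProbabilityMeasure P)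
      (Φ : Ω → Measure Plane),
      IsPointProcess Φ ∧ IsAnnularClusterSuperposition P Φ ∧ HasIntensity P Φ a ∧
      (∀ {ι : Type} [Fintype ι] (A : ι → Set Plane), (∀ i, MeasurableSet (A i)) →
        (∀ i, Bornology.IsBounded (A i)) → (Pairwise fun i j => Disjoint (A i) (A j)) →
        DominatesPoisson P (fun ω => countVec (Φ ω) A)
          fun i => (ENNReal.ofReal a * volume (A i)).toNNReal) ∧
      ∀ r : ℝ, 0 < r → 0 < P {ω | Percolates (booleanModel (Φ ω) r)} := by
  have hapos : ∀ n : ℕ, 0 < a / 2 / 2 ^ n := fun n => by positivity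
  -- Component `n` has intensity `a / 2 / 2 ^ n`, summing to `a`, and percolates at radius `1 / (n +
  -- 1)`; for any `r > 0` some component already percolates at radius `r`.
  choose α R δ μ hp hαμ hperc using fun n : ℕ =>
    exists_params_percolates.{0} (hapos n) (Nat.one_div_pos_of_nat (α := ℝ) (n := n))
  choose Ω mΩ P hP Φ hΦ using fun n => exists_annularClusterProcess (hp n)
  set Φs : ℕ → (∀ n, Ω n) → Measure Plane := fun n ω => Φ n (ω n)
  have hΦs : ∀ n, IsAnnularClusterProcess (Measure.infinitePi P) (Φs n) (α n) (R n) (δ n) (μ n) :=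
    fun n => (hΦ n).comp (measurePreserving_eval_infinitePi P n)
  have hind : iIndepFun Φs (Measure.infinitePi P) :=
    iIndepFun_infinitePi fun n => (isPointProcess_of_isAnnularCluster (hΦ n)).measurable
  have hi : ∀ n, HasIntensity (Measure.infinitePi P) (Φs n) (a / 2 / 2 ^ n) := fun n =>
    hαμ n ▸ (hΦs n).hasIntensity (hp n)
  have hpp := fun n => isPointProcess_of_isAnnularCluster (hΦs n)
  obtain ⟨Ψ, hΨ, hΨi, hsum⟩ :=
    exists_superposition hpp (fun n => (hapos n).le) (hasSum_geometric_two' a) hi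
  refine ⟨∀ n, Ω n, inferInstance, Measure.infinitePi P, inferInstance, Ψ, hΨ,
    ⟨α, R, δ, μ, Φs, hp, hΦs, hind, hsum⟩, hΨi, ?_, fun r hr => ?_⟩
  · intro ι _ A hA hb hd
    refine dominatesPoisson_superposition hΨ hpp hind hsum (fun n => (hapos n).le)
      (hasSum_geometric_two' a) hA hb fun n => ?_
    rw [← hαμ n]
    exact (hΦs n).dominatesPoisson (hp n) hA hb hd
  · obtain ⟨n, hn⟩ := exists_nat_one_div_lt hr
    refine (hperc n (hΦs n)).trans_le (measure_mono_ae ?_)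
    filter_upwards [hsum] with ω hω hperc
    refine hperc.mono (booleanModel_mono ?_ hn.le)
    rw [hω]
    exact Measure.le_sum (fun n => Φs n ω) n

end ClusterPerc

/-! ### Assembly of the three claims -/

theorem propositionp (a : ℝ) (ha : 0 < a) :
    -- For every `r > 0` some annular cluster process of intensity `a` has `r_c ≤ r`.
    (∀ r : ℝ, 0 < r → ∃ α R δ μ : ℝ, AdmissibleParams α R δ μ ∧ α * μ = a ∧
      (∃ (Ω : Type) (_ : MeasurableSpace Ω) (P : Measure Ω) (_ : IsProbabilityMeasure P)
        (Φ : Ω → Measure Plane), IsAnnularClusterProcess P Φ α R δ μ) ∧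
      ∀ (Ω : Type u) [MeasurableSpace Ω] (P : Measure Ω) [IsProbabilityMeasure P]
        (Φ : Ω → Measure Plane), IsAnnularClusterProcess P Φ α R δ μ →
        HasIntensity P Φ a ∧
        (∀ (Ω' : Type v) [MeasurableSpace Ω'] (P' : Measure Ω') [IsProbabilityMeasure P']
          (Ψ : Ω' → Measure Plane), IsPoissonProcess P' Ψ a → DcxLE P' Ψ P Φ) ∧
        criticalRadius P Φ ≤ ENNReal.ofReal r) ∧
    -- A superposition of such processes has intensity `a`, is `dcx`-larger than Poisson,
    -- and has `r_c = 0`, whereas `r_c > 0` for Poisson.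
    (∃ (Ω : Type) (_ : MeasurableSpace Ω) (P : Measure Ω) (_ : IsProbabilityMeasure P)
        (Φ : Ω → Measure Plane),
      IsPointProcess Φ ∧ IsAnnularClusterSuperposition P Φ ∧ HasIntensity P Φ a ∧
      (∀ (Ω' : Type v) [MeasurableSpace Ω'] (P' : Measure Ω') [IsProbabilityMeasure P']
        (Ψ : Ω' → Measure Plane), IsPoissonProcess P' Ψ a →
          DcxLE P' Ψ P Φ ∧ 0 < criticalRadius P' Ψ) ∧
      (∀ r : ℝ, 0 < r → 0 < P {ω | Percolates (booleanModel (Φ ω) r)}) ∧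
      criticalRadius P Φ = 0) ∧
    -- The critical radius is not monotone in the `dcx` order.
    (∃ (Ω₁ : Type) (_ : MeasurableSpace Ω₁) (P₁ : Measure Ω₁) (_ : IsProbabilityMeasure P₁)
        (Φ₁ : Ω₁ → Measure Plane)
        (Ω₂ : Type) (_ : MeasurableSpace Ω₂) (P₂ : Measure Ω₂) (_ : IsProbabilityMeasure P₂)
        (Φ₂ : Ω₂ → Measure Plane),
      IsPoissonProcess P₁ Φ₁ a ∧ IsPointProcess Φ₂ ∧ HasIntensity P₂ Φ₂ a ∧
      DcxLE P₁ Φ₁ P₂ Φ₂ ∧ criticalRadius P₂ Φ₂ < criticalRadius P₁ Φ₁) := by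
  obtain ⟨Ω₂, _, P₂, _, Φ₂, hpp, hsup, hint, hdom, hperc⟩ := exists_superposition_percolates ha
  refine ⟨fun r hr => ?_, ⟨Ω₂, _, P₂, ‹_›, Φ₂, hpp, hsup, hint, fun Ω' _ P' _ Ψ hΨ =>
    ⟨dcxLE_of_dominatesPoisson hΨ hpp hint fun _ A hA hb hd => hdom A hA hb hd,
      hΨ.criticalRadius_pos ha⟩, hperc, criticalRadius_eq_zero hperc⟩, ?_⟩
  · obtain ⟨α, R, δ, μ, hp, rfl, hpr⟩ := exists_params_percolates ha hr
    refine ⟨α, R, δ, μ, hp, rfl, exists_annularClusterProcess hp, fun Ω _ P _ Φ hΦ =>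
      ⟨hΦ.hasIntensity hp, fun Ω' _ P' _ Ψ hΨ => dcxLE_of_dominatesPoisson hΨ
        (isPointProcess_of_isAnnularCluster hΦ)
        (hΦ.hasIntensity hp) fun _ A hA hb hd => hΦ.dominatesPoisson hp hA hb hd,
        criticalRadius_le hr.le (hpr hΦ)⟩⟩
  · obtain ⟨Ω₁, _, P₁, _, Φ₁, -, hΦ₁⟩ := exists_poissonProcess a
    refine ⟨Ω₁, _, P₁, ‹_›, Φ₁, Ω₂, _, P₂, ‹_›, Φ₂, hΦ₁, hpp, hint,
      dcxLE_of_dominatesPoisson hΦ₁ hpp hint fun _ A hA hb hd => hdom A hA hb hd, ?_⟩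
    rw [criticalRadius_eq_zero hperc]
    exact hΦ₁.criticalRadius_pos ha
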